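/- **Setting.** Let $d=3$, $Y=(0,1)^3$, $\langle f\rangle=\int_Y f$, let $\mathbb S^3$ be the real symmetric $3\times3$ matrices, and let $H^1_\#$ denote the closure of the smooth $Y$-periodic functions in the $H^1(Y)$ norm; $\nabla^{s}$ is the symmetric gradient. For a fourth-order tensor $T$ and matrices $F,G$ put $(T:F)_{mn}=\sum_{p,q}T_{mnpq}F_{pq}$ and $F:G=\sum_{m,n}F_{mn}G_{mn}$. Assume: (A) $Y$ consists, up to their boundaries, of pairwise disjoint Lipschitz subdomains $D_0,\dots,D_M$ (that is, $D_l\subset Y\subset\bigcup_{l'}\overline{D_{l'}}$), and $\mathbf C(x)=\Lambda_l$ for $x\in D_l$; (B) each $\Lambda_l$ is a real tensor with $[\Lambda_l]_{mnpq}=[\Lambda_l]_{nmpq}=[\Lambda_l]_{mnqp}=[\Lambda_l]_{pqmn}$, and there are constants $\Lambda',\Lambda''>0$ with $\Lambda' F:F\le F:\Lambda_l:F\le\Lambda''F:F$ for all $F\in\mathbb S^3$ and all $l$; (C) for each $N\ge1$ and each $I\in\mathcal I_N=\{0,\dots,N-1\}^3$, with the voxel $Y_I=\prod_m(I_m/N,(I_m+1)/N)$,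 one has $\mathbf C_N^\star[I]=\Lambda_l$ if $Y_I\subset D_l$, and otherwise $\mathbf C_N^\star[I]$ is an arbitrary element of $\{\Lambda_{l}:Y_I\cap D_{l}\ne\emptyset\}$. Let $\mathbf C_N(x)=\mathbf C_N^\star[I]$ for $x\in Y_I$. Let $\mathbf C^{\rm ref}$ be a constant reference tensor with the symmetries in (B) and $F:\mathbf C^{\rm ref}:F\ge cF:F$ on $\mathbb S^3$ for some $c>0$. *Cell problem.* For $E\in\mathbb S^3$ find $u\in H^1_\#(Y;\mathbb R^3)$ with $\langle u\rangle=0$ and $\langle\nabla^sv:\mathbf C:\nabla^su\rangle=-\langle\nabla^sv:\mathbf C\rangle:E$ for all $v\in H^1_\#(Y;\mathbb R^3)$. The effective tensor is given by $\mathbf C^{\rm eff}:E=\langle\mathbf C:(\nabla^su+E)\rangle$ for all $E\in\mathbb S^3$ (and $\mathbf C^{\rm eff}_{mnpq}=\mathbf C^{\rm eff}_{mnqp}$). *Willot's scheme.* Let $\mathcal F_N=\{\xi\in\mathbb Z^3:-N/2\le\xi_m<N/2\}$ and $\mathcal F_{N-}=\{\xi\in\mathbb Z^3:-N/2<\xi_m<N/2\}$.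 For $f^\star$ on $\mathcal I_N$ put $\widehat{f^\star}[\xi]=N^{-3}\sum_{I}f^\star[I]e^{-2\pi i\xi\cdot I/N}$. Let $$k_N[\xi]=\tfrac{iN}{4}\prod_{m=1}^3\bigl(e^{2\pi i\xi_m/N}+1\bigr)\bigl(\tan\tfrac{\pi\xi_1}N,\tan\tfrac{\pi\xi_2}N,\tan\tfrac{\pi\xi_3}N\bigr),$$ and let $\widehat\Gamma_W[\xi]:F=k_N\otimes^sa$ for symmetric $F$, where $(\overline{k_N}\cdot\mathbf C^{\rm ref}\cdot k_N)\,a=F\,\overline{k_N}$ and $a\otimes^sb=\frac12(a\otimes b+b\otimes a)$. The scheme's strain field is the fixed point $\varepsilon_N^\star:\mathcal I_N\to\mathbb S^3$ with $$\widehat{\varepsilon_N^\star}[0]=E,\qquad \widehat{\varepsilon_N^\star}[\xi]=-\widehat\Gamma_W[\xi]:\widehat{\tau_N^\star}[\xi]\ \ (\xi\in\mathcal F_{N-}\setminus\{0\}),\qquad \widehat{\varepsilon_N^\star}[\xi]=0\ \ (\xi\in\mathcal F_N\setminus\mathcal F_{N-}),$$ where $\tau_N^\star[I]=(\mathbf C_N^\star[I]-\mathbf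 C^{\rm ref}):\varepsilon_N^\star[I]$. The effective tensor of the scheme is given by $\mathbf C_N^{\rm eff,W}:E=N^{-3}\sum_{I\in\mathcal I_N}\mathbf C_N^\star[I]:\varepsilon_N^\star[I]$ for all $E\in\mathbb S^3$ (and is symmetric in its last two indices). *Rescaled problem.* For $f$ on $Y$ let $\widehat f[\xi]=\langle f\,e^{-2\pi i\xi\cdot x}\rangle$. Let $\tilde k_N[\xi]=2iN(\tan\frac{\pi\xi_1}N,\tan\frac{\pi\xi_2}N,\tan\frac{\pi\xi_3}N)$ and $\tilde{\mathcal D}^s_Nf=\sum_{\xi\in\mathcal F_{N-}}\tilde k_N[\xi]\otimes^s\widehat f[\xi]\,e^{2\pi i\xi\cdot x}$. Let $G_N=N^3\mathbf 1_{[-1/(2N),1/(2N)]^3}$ and $\mathcal R_Nf=G_N*G_N*f$, with $f$ extended periodically. Let $\widehat{G_N}[\xi]=\prod_m\frac{\sin(\pi\xi_m/N)}{\pi\xi_m/N}$ (a factor with $\xi_m=0$ being $1$), and $$\mathcal Q_Nf(x)=\sum_{\xi\in\mathcal F_N}\widehat{G_N}[\xi]^{-1}e^{-\pi i(\xi_1+\xi_2+\xi_3)/N}\,\widehat{f^\star}[\xi]\,e^{2\pi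 i\xi\cdot x},\qquad f^\star[I]=\frac1{|Y_I|}\int_{Y_I}f.$$ Let $S_{N-}$ be the span of the $e^{2\pi i\xi\cdot x}$, $\xi\in\mathcal F_{N-}$. For $E\in\mathbb S^3$ find $w_N\in S_{N-}^3$ with $\langle w_N\rangle=0$ such that for all $v\in H^1_\#(Y;\mathbb C^3)$ $$\bigl\langle\mathcal R_N(\tilde{\mathcal D}^s_N\bar v):\mathcal Q_N(\mathbf C_N:\tilde{\mathcal D}^s_Nw_N)\bigr\rangle=-\bigl\langle\mathcal R_N(\tilde{\mathcal D}^s_N\bar v):\mathcal Q_N(\mathbf C_N:E)\bigr\rangle .$$ **Theorem.** Under these assumptions: 1. For every $E\in\mathbb S^3$ the cell problem has a unique solution $u$, and for every $N\ge1$ the fixed point $\varepsilon_N^\star$ exists and is unique; the tensors $\mathbf C^{\rm eff}$ and $\mathbf C_N^{\rm eff,W}$ are thus well defined and unique. 2. For every $E\in\mathbb S^3$ and $N\ge1$ the rescaled problem has a unique solution $w_N$, and $w_N\rightharpoonup u$ weakly in $H^1_\#(Y;\mathbb C^3)$ as $N\to\infty$. 3. $\mathbf C_N^{\rm eff,W}\to\mathbf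 C^{\rm eff}$ as $N\to\infty$. -/

import Mathlib

open MeasureTheory Filter Topology
open scoped ContDiff ENNReal

noncomputable section

namespace Willot

/-! ### Tensors in dimension three -/

/-- Points of space. -/
abbrev Space := Fin 3 → ℝ

/-- Frequencies. -/
abbrev Freq := Fin 3 → ℤ

abbrev Mat (R : Type*) := Matrix (Fin 3) (Fin 3) R

/-- Fourth-order tensors, `T m n p q`. -/
abbrev Tensor4 (R : Type*) := Fin 3 → Fin 3 → Fin 3 → Fin 3 → R

/-- `T : F`, a matrix. -/
def ddot {R : Type*} [CommRing R] (T : Tensor4 R) (F : Mat R) : Mat R :=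
  fun m n => ∑ p, ∑ q, T m n p q * F p q

/-- `A : B`, a scalar (bilinear, no complex conjugation). -/
def mdot {R : Type*} [CommRing R] (A B : Mat R) : R := ∑ m, ∑ n, A m n * B m n

/-- A real tensor with its entries regarded as elements of `𝕜`. -/
def castT (𝕜 : Type*) [RCLike 𝕜] (T : Tensor4 ℝ) : Tensor4 𝕜 := fun m n p q => (T m n p q : 𝕜)

/-- A real matrix with its entries regarded as elements of `𝕜`. -/
def castM (𝕜 : Type*) [RCLike 𝕜] (F : Mat ℝ) : Mat 𝕜 := fun m n => (F m n : 𝕜)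

/-- The symmetries of a stiffness tensor. -/
def IsElasticSymm (T : Tensor4 ℝ) : Prop :=
  ∀ m n p q, T m n p q = T n m p q ∧ T m n p q = T m n q p ∧ T m n p q = T p q m n

/-- A linear elastic (reference) medium: symmetric and coercive on symmetric matrices. -/
def IsElasticMedium (T : Tensor4 ℝ) : Prop :=
  IsElasticSymm T ∧
    ∃ c : ℝ, 0 < c ∧ ∀ F : Mat ℝ, F.IsSymm → c * mdot F F ≤ mdot F (ddot T F)

/-! ### The unit cell, its phases and its voxels -/

/-- The representative volume element `Y = (0,1)^3`. -/
def cell : Set Space := {x | ∀ m, 0 < x m ∧ x m < 1}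

/-- An open set with Lipschitz boundary: near each of its boundary points, and after a rotation
that takes the last axis to the unit vector `ν`, the set is the part of space strictly above the
graph of a Lipschitz function of the variables orthogonal to `ν`. -/
def IsLipschitzOpen (D : Set Space) : Prop :=
  IsOpen D ∧ ∀ x ∈ frontier D, ∃ ν : Space, ν ⬝ᵥ ν = 1 ∧
    ∃ (K : NNReal) (g : Space → ℝ), LipschitzWith K g ∧
      ∃ r : ℝ, 0 < r ∧ ∀ y ∈ Metric.ball x r, y ∈ D ↔ g (y - (y ⬝ᵥ ν) • ν) < y ⬝ᵥ ν

/-- `Y` consists of the disjoint Lipschitz subdomains `D 0, …, D M`, and `C` takes the constant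
value `Λ l` in `D l`. -/
def IsPhaseStructure {M : ℕ} (D : Fin (M + 1) → Set Space) (Λ : Fin (M + 1) → Tensor4 ℝ)
    (C : Space → Tensor4 ℝ) : Prop :=
  (∀ l, IsLipschitzOpen (D l) ∧ D l ⊆ cell) ∧
  (∀ l l', l ≠ l' → Disjoint (D l) (D l')) ∧
  cell ⊆ ⋃ l, closure (D l) ∧
  ∀ l, ∀ x ∈ D l, C x = Λ l

/-- The symmetry and uniform coercivity of the stiffness tensors of the phases. -/
def IsUniformlyElastic {M : ℕ} (Λ : Fin (M + 1) → Tensor4 ℝ) : Prop :=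
  (∀ l, IsElasticSymm (Λ l)) ∧
  ∃ a b : ℝ, 0 < a ∧ 0 < b ∧ ∀ F : Mat ℝ, F.IsSymm → ∀ l,
    a * mdot F F ≤ mdot F (ddot (Λ l) F) ∧ mdot F (ddot (Λ l) F) ≤ b * mdot F F

/-- Voxel indices at resolution `N`. -/
abbrev Idx (N : ℕ) := Fin 3 → Fin N

/-- The open voxel `Y_I`. -/
def voxel (N : ℕ) (I : Idx N) : Set Space :=
  {x | ∀ m, (I m : ℝ) / N < x m ∧ x m < ((I m : ℝ) + 1) / N}

/-- The image `Cs` at resolution `N` of the phases: a voxel inside one phase carries the stiffness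
of that phase, any other voxel that of some phase which it meets. -/
def IsVoxelImage {M : ℕ} (D : Fin (M + 1) → Set Space) (Λ : Fin (M + 1) → Tensor4 ℝ)
    (N : ℕ) (Cs : Idx N → Tensor4 ℝ) : Prop :=
  ∀ I, (∀ l, voxel N I ⊆ D l → Cs I = Λ l) ∧
    ((¬ ∃ l, voxel N I ⊆ D l) → ∃ l, (voxel N I ∩ D l).Nonempty ∧ Cs I = Λ l)

open Classical in
/-- The piecewise constant function with value `Cs I` in the voxel `Y_I` (and `0` on the voxel
faces, a null set). -/
def pwConst (N : ℕ) (Cs : Idx N → Tensor4 ℝ) (x : Space) : Tensor4 ℝ :=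
  ∑ I, if x ∈ voxel N I then Cs I else 0

/-! ### The periodic Sobolev space -/

/-- `L²(Y)`. -/
abbrev L2 (𝕜 : Type*) [RCLike 𝕜] := Lp 𝕜 2 (volume.restrict cell)

/-- Families of `L²` functions: the entry `(j, none)` stands for the `j`-th component of a vector
field, the entry `(j, some m)` for its derivative in direction `m`. The norm is the `H¹` norm. -/
abbrev Jet (𝕜 : Type*) [RCLike 𝕜] := PiLp 2 (fun _ : Fin 3 × Option (Fin 3) => L2 𝕜)

/-- The partial derivative in direction `m`. -/
def pderiv {𝕜 : Type*} [RCLike 𝕜] (m : Fin 3) (f : Space → 𝕜) (x : Space) : 𝕜 :=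
  fderiv ℝ f x (Pi.single m 1)

/-- Smooth `Y`-periodic functions. -/
def IsSmoothPeriodic {𝕜 : Type*} [RCLike 𝕜] (f : Space → 𝕜) : Prop :=
  ContDiff ℝ ∞ f ∧ ∀ (m : Fin 3) (x : Space), f (x + Pi.single m 1) = f x

/-- `U` consists of the smooth periodic vector field `φ` and its derivatives. -/
def IsJetOf {𝕜 : Type*} [RCLike 𝕜] (U : Jet 𝕜) (φ : Fin 3 → Space → 𝕜) : Prop :=
  (∀ j, IsSmoothPeriodic (φ j)) ∧
  (∀ j, U (j, none) =ᵐ[volume.restrict cell] φ j) ∧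
  ∀ j m, U (j, some m) =ᵐ[volume.restrict cell] pderiv m (φ j)

/-- Smooth periodic vector fields with their derivatives. -/
def smoothJets (𝕜 : Type*) [RCLike 𝕜] : Submodule 𝕜 (Jet 𝕜) where
  carrier := {U | ∃ φ, IsJetOf U φ}
  add_mem' := by
    rintro U V ⟨φ, hφ, hU, hU'⟩ ⟨ψ, hψ, hV, hV'⟩
    refine ⟨fun j => φ j + ψ j, fun j => ⟨(hφ j).1.add (hψ j).1, fun m x => ?_⟩,
      fun j => ?_, fun j m => ?_⟩
    · simp [(hφ j).2 m x, (hψ j).2 m x]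
    · exact (Lp.coeFn_add (U (j, none)) (V (j, none))).trans ((hU j).add (hV j))
    · refine (Lp.coeFn_add (U (j, some m)) (V (j, some m))).trans
        (((hU' j m).add (hV' j m)).trans (Eventually.of_forall fun x => ?_))
      have h1 := (hφ j).1.differentiable (by simp) x
      have h2 := (hψ j).1.differentiable (by simp) x
      simp [pderiv, fderiv_add h1 h2]
  zero_mem' := by
    refine ⟨fun _ => 0, fun j => ⟨contDiff_const, fun _ _ => rfl⟩, fun j => ?_, fun j m => ?_⟩
    · exact Lp.coeFn_zero 𝕜 2 _
    · refine (Lp.coeFn_zero 𝕜 2 _).trans (Eventually.of_forall fun x => ?_)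
      simp [pderiv]
  smul_mem' := by
    rintro c U ⟨φ, hφ, hU, hU'⟩
    refine ⟨fun j => c • φ j, fun j => ⟨(hφ j).1.const_smul c, fun m x => ?_⟩,
      fun j => ?_, fun j m => ?_⟩
    · simp [(hφ j).2 m x]
    · exact (Lp.coeFn_smul c (U (j, none))).trans ((hU j).const_smul c)
    · refine (Lp.coeFn_smul c (U (j, some m))).trans
        (((hU' j m).const_smul c).trans (Eventually.of_forall fun x => ?_))
      have h1 := (hφ j).1.differentiable (by simp) x
      simp [pderiv, fderiv_const_smul h1]

/-- The space `H¹_#(Y; 𝕜³)`: the closure of the smooth periodic vector fields in the `H¹` norm.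
An element is a vector field together with its weak gradient. -/
def H1 (𝕜 : Type*) [RCLike 𝕜] : Submodule 𝕜 (Jet 𝕜) := (smoothJets 𝕜).topologicalClosure

/-- The components of the vector field `u`. -/
def comp {𝕜 : Type*} [RCLike 𝕜] (u : H1 𝕜) (j : Fin 3) : Space → 𝕜 :=
  ((u : Jet 𝕜) (j, none) : L2 𝕜)

/-- `grad u m j` is the weak derivative `∂_m u_j`. -/
def grad {𝕜 : Type*} [RCLike 𝕜] (u : H1 𝕜) (m j : Fin 3) : Space → 𝕜 :=
  ((u : Jet 𝕜) (j, some m) : L2 𝕜)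

/-- The symmetric gradient. -/
def symGrad {𝕜 : Type*} [RCLike 𝕜] (u : H1 𝕜) (x : Space) : Mat 𝕜 :=
  fun m n => (grad u m n x + grad u n m x) / 2

/-- The mean value over `Y` vanishes. -/
def MeanZero {𝕜 : Type*} [RCLike 𝕜] (u : H1 𝕜) : Prop := ∀ j, ∫ x in cell, comp u j x = 0

/-- Entrywise inclusion of real in complex `L²` families. -/
def jetOfReal (U : Jet ℝ) : Jet ℂ :=
  WithLp.toLp 2 fun i => Complex.ofRealCLM.compLpL 2 (volume.restrict cell) (U i)

theorem continuous_jetOfReal : Continuous jetOfReal := by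
  unfold jetOfReal
  fun_prop

theorem jetOfReal_mem {U : Jet ℝ} (hU : U ∈ H1 ℝ) : jetOfReal U ∈ H1 ℂ := by
  refine map_mem_closure continuous_jetOfReal hU ?_
  rintro V ⟨φ, hφ, hV, hV'⟩
  refine ⟨fun j x => (φ j x : ℂ), fun j => ⟨?_, fun m x => ?_⟩, fun j => ?_, fun j m => ?_⟩
  · exact Complex.ofRealCLM.contDiff.comp (hφ j).1
  · simp [(hφ j).2 m x]
  · refine (Complex.ofRealCLM.coeFn_compLpL (V (j, none))).trans ?_
    filter_upwards [hV j] with x hx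
    simp [hx]
  · refine (Complex.ofRealCLM.coeFn_compLpL (V (j, some m))).trans ?_
    filter_upwards [hV' j m] with x hx
    have h1 := ((hφ j).1.differentiable (by simp) x).hasFDerivAt
    have h2 := (Complex.ofRealCLM.hasFDerivAt.comp x h1).fderiv
    have h3 : (Complex.ofRealCLM ∘ φ j) = fun x => (φ j x : ℂ) := rfl
    rw [h3] at h2
    simp [hx, pderiv, h2]

/-- A real vector field in `H¹_#(Y; ℝ³)` as an element of `H¹_#(Y; ℂ³)`. -/
def ofRealH1 (u : H1 ℝ) : H1 ℂ := ⟨jetOfReal u, jetOfReal_mem u.2⟩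

/-! ### The cell problem and the effective tensor -/

/-- `u` solves the periodic cell problem for the stiffness `C` and the macroscopic strain `E`. -/
def IsCellSolution (C : Space → Tensor4 ℝ) (E : Mat ℝ) (u : H1 ℝ) : Prop :=
  MeanZero u ∧ ∀ v : H1 ℝ,
    ∫ x in cell, mdot (symGrad v x) (ddot (C x) (symGrad u x)) =
      -∫ x in cell, mdot (symGrad v x) (ddot (C x) E)

/-- `T` is the effective stiffness tensor of `C`: `T : E = ⟨C : (∇ˢu + E)⟩` for every symmetric
`E`, where `u` solves the cell problem for `E`. As a tensor acting on symmetric matrices, `T` is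
normalised to be symmetric in its last two indices. -/
def IsEffective (C : Space → Tensor4 ℝ) (T : Tensor4 ℝ) : Prop :=
  (∀ m n p q, T m n p q = T m n q p) ∧
  ∀ E : Mat ℝ, E.IsSymm → ∃ u, IsCellSolution C E u ∧
    ∀ m n, ddot T E m n = ∫ x in cell, ddot (C x) (symGrad u x + E) m n

/-! ### Discrete and continuous Fourier coefficients -/

/-- The frequencies with `-N/2 ≤ ξ_m < N/2`. -/
def freqs (N : ℕ) : Finset Freq :=
  Fintype.piFinset fun _ =>
    (Finset.Icc (-(N : ℤ)) N).filter fun k => -(N : ℤ) ≤ 2 * k ∧ 2 * k < N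

/-- The frequencies with `-N/2 < ξ_m < N/2`. -/
def freqsMinus (N : ℕ) : Finset Freq :=
  Fintype.piFinset fun _ =>
    (Finset.Icc (-(N : ℤ)) N).filter fun k => -(N : ℤ) < 2 * k ∧ 2 * k < N

/-- `exp(2πi ξ·x)`. -/
def expo (ξ : Freq) (x : Space) : ℂ :=
  Complex.exp (2 * Real.pi * Complex.I * ∑ m, (ξ m : ℂ) * (x m : ℂ))

/-- The Fourier coefficient of a function on `Y`. -/
def fcoef (f : Space → ℂ) (ξ : Freq) : ℂ := ∫ x in cell, expo (-ξ) x * f x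

/-- The discrete Fourier coefficient of a function on the grid. -/
def dft {N : ℕ} (f : Idx N → ℂ) (ξ : Freq) : ℂ :=
  ((N : ℂ) ^ 3)⁻¹ * ∑ I, f I * expo (-ξ) (fun m => (I m : ℝ) / N)

/-! ### Willot's scheme -/

/-- The discrete gradient symbol of the scheme. -/
def kW (N : ℕ) (ξ : Freq) (m : Fin 3) : ℂ :=
  Complex.I * N / 4 * (∏ j, (Complex.exp (2 * Real.pi * Complex.I * ((ξ j : ℂ) / N)) + 1)) *
    Real.tan (Real.pi * ξ m / N)

/-- The acoustic matrix `k̄ · Cref · k`. -/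
def acoustic (Cref : Tensor4 ℝ) (k : Fin 3 → ℂ) : Mat ℂ :=
  fun n p => ∑ m, ∑ q, star (k m) * (Cref m n p q : ℂ) * k q

/-- The strain Green operator with the gradient symbol `k`: it sends a symmetric matrix `F` to
`k ⊗ˢ a`, where the vector `a` solves `(k̄ · Cref · k) · a = F · k̄`. -/
def green (Cref : Tensor4 ℝ) (k : Fin 3 → ℂ) : Tensor4 ℂ := fun m n p q =>
  let B := (acoustic Cref k)⁻¹
  (k m * star (k q) * B n p + k n * star (k q) * B m p +
    k m * star (k p) * B n q + k n * star (k p) * B m q) / 4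

/-- The isotropic medium with Lamé coefficients `lam`, `mu`. -/
def isotropic (lam mu : ℝ) : Tensor4 ℝ := fun m n p q =>
  let δ : Fin 3 → Fin 3 → ℝ := fun i j => if i = j then 1 else 0
  lam * (δ m n * δ p q) + mu * (δ m p * δ n q + δ m q * δ n p)

theorem acoustic_isotropic (lam mu : ℝ) (k : Fin 3 → ℂ) (n p : Fin 3) :
    acoustic (isotropic lam mu) k n p =
      lam * (star (k n) * k p) + mu * (star (k p) * k n) +
        mu * ((∑ j, star (k j) * k j) * if n = p then 1 else 0) := by
  fin_cases n <;> fin_cases p <;>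
    simp [acoustic, isotropic, Fin.sum_univ_three] <;> ring

/-- For an isotropic reference medium and a symbol `k` which is a complex multiple of a real
vector, `green` has the familiar closed form. -/
theorem green_isotropic {lam mu : ℝ} (hmu : mu ≠ 0) (hlam : lam + 2 * mu ≠ 0) (c : ℂ)
    (t : Fin 3 → ℝ) {k : Fin 3 → ℂ} (hk : k = fun m => c * t m) {s : ℂ}
    (hs : s = ∑ j, star (k j) * k j) (hs0 : s ≠ 0) (m n p q : Fin 3) :
    let δ : Fin 3 → Fin 3 → ℂ := fun i j => if i = j then 1 else 0
    green (isotropic lam mu) k m n p q =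
      (k m * star (k q) * δ n p + k n * star (k q) * δ m p +
        k m * star (k p) * δ n q + k n * star (k p) * δ m q) / (4 * mu * s) -
      (lam + mu) * (k m * star (k n) * k p * star (k q)) / (mu * (lam + 2 * mu) * s ^ 2) := by
  intro δ
  have hmu' : (mu : ℂ) ≠ 0 := by exact_mod_cast hmu
  have hlam' : (lam + 2 * mu : ℂ) ≠ 0 := by exact_mod_cast hlam
  have hcomm : ∀ i j, star (k i) * k j = star (k j) * k i := by
    intro i j; simp [hk]; ring
  have hB : (acoustic (isotropic lam mu) k)⁻¹ = Matrix.of fun n p =>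
      δ n p / (mu * s) - (lam + mu) * (k n * star (k p)) / (mu * (lam + 2 * mu) * s ^ 2) := by
    refine Matrix.inv_eq_right_inv ?_
    ext i j
    simp only [Matrix.mul_apply, Matrix.one_apply, Matrix.of_apply]
    have h : ∀ l, acoustic (isotropic lam mu) k i l =
        (lam + mu) * (k i * star (k l)) + mu * s * δ i l := by
      intro l
      rw [acoustic_isotropic, ← hs, hcomm i l]; ring
    have hδ : ∀ l, acoustic (isotropic lam mu) k i l * (δ l j / (mu * s) -
        (lam + mu) * (k l * star (k j)) / (mu * (lam + 2 * mu) * s ^ 2)) =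
        δ l j * ((lam + mu) * (k i * star (k l)) / (mu * s)) + δ i l * δ l j
        - (star (k l) * k l) * ((lam + mu) ^ 2 * (k i * star (k j)) /
            (mu * (lam + 2 * mu) * s ^ 2))
        - δ i l * ((lam + mu) * (k l * star (k j)) / ((lam + 2 * mu) * s)) := by
      intro l
      rw [h l]; field_simp; ring
    simp only [hδ, Finset.sum_add_distrib, Finset.sum_sub_distrib, ← Finset.sum_mul, ← hs]
    simp only [δ, ite_mul, mul_ite, one_mul, zero_mul, mul_one, mul_zero, Finset.sum_ite_eq,
      Finset.sum_ite_eq', Finset.mem_univ, if_true]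
    have hz : ∀ X : ℂ, (lam + mu) * X / (mu * s) - s * ((lam + mu) ^ 2 * X /
        (mu * (lam + 2 * mu) * s ^ 2)) - (lam + mu) * X / ((lam + 2 * mu) * s) = 0 := by
      intro X
      obtain ⟨L, hL⟩ : ∃ L : ℂ, L = lam + 2 * mu := ⟨_, rfl⟩
      have hl : (lam : ℂ) = L - 2 * mu := by rw [hL]; ring
      rw [← hL] at hlam' ⊢
      rw [hl]
      field_simp
      ring
    linear_combination hz (k i * star (k j))
  have hst : ∀ i, star (k i) = star c * t i := by intro i; simp [hk]
  simp only [green, hB, Matrix.of_apply, hst]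
  simp only [hk]
  field_simp
  ring

open Classical in
/-- `ε` is a fixed point of Willot's scheme with stiffness `Cs`, reference medium `Cref` and
macroscopic strain `E`; here `τ = (Cs - Cref) : ε` is the polarization. -/
def IsWillotStrain {N : ℕ} (Cs : Idx N → Tensor4 ℝ) (Cref : Tensor4 ℝ) (E : Mat ℝ)
    (ε : Idx N → Mat ℝ) : Prop :=
  (∀ I, (ε I).IsSymm) ∧
  ∀ ξ ∈ freqs N, ∀ m n, dft (fun I => (ε I m n : ℂ)) ξ =
    if ξ = 0 then (E m n : ℂ)
    else if ξ ∈ freqsMinus N then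
      -ddot (green Cref (kW N ξ))
        (fun p q => dft (fun I => ((ddot (Cs I - Cref) (ε I) p q : ℝ) : ℂ)) ξ) m n
    else 0

/-- `T` is the effective tensor delivered by Willot's scheme at resolution `N`:
`T : E = N⁻³ ∑_I Cs[I] : ε[I]` for every symmetric `E`, with `ε` the strain field of the scheme. -/
def IsWillotEffective {N : ℕ} (Cs : Idx N → Tensor4 ℝ) (Cref : Tensor4 ℝ) (T : Tensor4 ℝ) :
    Prop :=
  (∀ m n p q, T m n p q = T m n q p) ∧
  ∀ E : Mat ℝ, E.IsSymm → ∃ ε, IsWillotStrain Cs Cref E ε ∧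
    ddot T E = ((N : ℝ) ^ 3)⁻¹ • ∑ I, ddot (Cs I) (ε I)

/-! ### The rescaled problem -/

/-- The symbol of the modified discrete gradient. -/
def kMod (N : ℕ) (ξ : Freq) (m : Fin 3) : ℂ :=
  2 * Complex.I * N * Real.tan (Real.pi * ξ m / N)

/-- The symmetrized modified discrete gradient of a vector field. -/
def symDMod (N : ℕ) (f : Fin 3 → Space → ℂ) (x : Space) : Mat ℂ := fun m n =>
  ∑ ξ ∈ freqsMinus N,
    (kMod N ξ m * fcoef (f n) ξ + kMod N ξ n * fcoef (f m) ξ) / 2 * expo ξ x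

/-- `G_N * f`, where `f` is first extended periodically from `Y`, and `G_N` is `N³` times the
indicator of the cube of edge `1/N` centred at `0`. -/
def convG (N : ℕ) (f : Space → ℂ) (x : Space) : ℂ :=
  (N : ℂ) ^ 3 * ∫ y in {y : Space | ∀ m, |y m| ≤ 1 / (2 * N)}, f (fun m => Int.fract (x m - y m))

/-- `R_N f = G_N * G_N * f`. -/
def opR (N : ℕ) (f : Space → ℂ) : Space → ℂ := convG N (convG N f)

/-- The Fourier coefficients of `G_N` (with `sinc 0 = 1`). -/
def hatG (N : ℕ) (ξ : Freq) : ℝ := ∏ m, Real.sinc (Real.pi * ξ m / N)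

/-- The operator `Q_N`: trigonometric interpolation of the voxel averages, deconvolved by `G_N`. -/
def opQ (N : ℕ) (f : Space → ℂ) (x : Space) : ℂ :=
  ∑ ξ ∈ freqs N, (hatG N ξ : ℂ)⁻¹ * Complex.exp (-(Real.pi * Complex.I * ((∑ m, (ξ m : ℂ)) / N))) *
    dft (fun I : Idx N => ⨍ y in voxel N I, f y) ξ * expo ξ x

/-- The components of `w` are trigonometric polynomials with frequencies in `-N/2 < ξ_m < N/2`. -/
def IsTrigMinus (N : ℕ) (w : H1 ℂ) : Prop :=
  ∃ c : Freq → Fin 3 → ℂ, ∀ j,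
    comp w j =ᵐ[volume.restrict cell] fun x => ∑ ξ ∈ freqsMinus N, c ξ j * expo ξ x

/-- `w` solves the rescaled problem at resolution `N`: it is a trigonometric polynomial with mean
zero, and for all `v` in `H¹_#(Y; ℂ³)`
`⟨R_N(D̃ˢ v̄) : Q_N(C_N : D̃ˢ w)⟩ = -⟨R_N(D̃ˢ v̄) : Q_N(C_N : E)⟩`. -/
def IsRescaledSolution {N : ℕ} (Cs : Idx N → Tensor4 ℝ) (E : Mat ℝ) (w : H1 ℂ) : Prop :=
  IsTrigMinus N w ∧ MeanZero w ∧ ∀ v : H1 ℂ,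
    let V : Space → Mat ℂ := fun x m n =>
      opR N (fun y => symDMod N (fun j z => star (comp v j z)) y m n) x
    ∫ x in cell, mdot (V x) (fun m n =>
        opQ N (fun y => ddot (castT ℂ (pwConst N Cs y)) (symDMod N (comp w) y) m n) x) =
      -∫ x in cell, mdot (V x) (fun m n =>
        opQ N (fun y => ddot (castT ℂ (pwConst N Cs y)) (castM ℂ E) m n) x)

end Willot

end

noncomputable section

namespace Willot

/-! ### Exponentials -/

/-! Everything reduces to one finite linear system. The symbol of Willot's scheme is a scalar
`gammaW` times the real vector of tangents, and this scalar does not vanish on `freqsMinus N`. The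
Green operator undoes `Cref` on strains of the form k ⊗ˢ a. Hence at a nonzero frequency of
`freqsMinus N` the fixed point equation says that the strain is compatible with the tangent symbol
and that the stress has zero discrete divergence (`willot_frequency_iff`, `isWillotStrain_iff`). The
reference medium and the scalar drop out, and `IsGridSolution` remains.

The rescaled problem is the same system (`isRescaledSolution_iff`). Averaging an exponential over a
voxel produces the factor `hatG` and the phase of a half-voxel shift; the multipliers of R_N and Q_N
combine with these into one nonzero scalar `gammaR`. The system is square, and it is injective by
the coercivity of the phases, discrete Parseval and Korn's inequality for symbols. The same energy
estimate bounds the grid strain uniformly in N. Since `hatG` is at least (2/π)^3 and |tan x| ≥ |x|,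
the rescaled solutions w_N are bounded in H¹ (`exists_rescaled_bound`).

For the limit, the discrete Fourier coefficient of the grid stress is an integral of a piecewise
constant multiplier against the modified strain (`dft_gridStress_eq`). The multipliers are bounded
and converge almost everywhere, because the phase boundaries are null. The modified and the true
gradient of w_N differ by a weakly null sequence, because their symbols agree in the limit at each
fixed frequency. Therefore the grid stress and C : (E + ∇ˢw_N) have asymptotically equal Fourier
coefficients (`tendsto_stress_sub`).

At ξ ≠ 0 this means that w_N asymptotically satisfies the cell problem tested with each Fourier
mode. The energy operator is injective, so its adjoint maps the modes to a set with dense span; with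
the H¹ bound this gives w_N ⇀ u for the whole sequence (`tendsto_inner_rescaled_sub`). At ξ = 0 the
same asymptotics concern mean stresses, that is, the effective tensors (`tendsto_willotEffective`).
-/

theorem expo_eq_prod (ξ : Freq) (x : Space) :
    expo ξ x = ∏ m, Complex.exp (2 * Real.pi * Complex.I * (ξ m * x m)) := by
  rw [expo, ← Complex.exp_sum, Finset.mul_sum]

theorem expo_add (ξ η : Freq) (x : Space) : expo (ξ + η) x = expo ξ x * expo η x := by
  simp only [expo, ← Complex.exp_add]
  congr 1
  simp only [Pi.add_apply, Int.cast_add, add_mul, Finset.sum_add_distrib]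
  ring

@[simp] theorem expo_zero (x : Space) : expo 0 x = 1 := by simp [expo]

theorem expo_add_right (ξ : Freq) (x y : Space) : expo ξ (x + y) = expo ξ x * expo ξ y := by
  simp only [expo, ← Complex.exp_add]
  congr 1
  simp only [Pi.add_apply, Complex.ofReal_add, mul_add, Finset.sum_add_distrib]

theorem expo_neg (ξ : Freq) (x : Space) : expo (-ξ) x = star (expo ξ x) := by
  simp only [expo, Complex.star_def, ← Complex.exp_conj]
  congr 1
  simp only [map_mul, map_sum, Complex.conj_I, Complex.conj_ofReal, map_intCast, Pi.neg_apply,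
    Int.cast_neg, neg_mul, Finset.sum_neg_distrib, map_ofNat]
  ring

theorem norm_expo (ξ : Freq) (x : Space) : ‖expo ξ x‖ = 1 := by
  have : (2 * Real.pi * Complex.I * ∑ m, (ξ m : ℂ) * (x m : ℂ)) =
      ((2 * Real.pi * ∑ m, (ξ m : ℝ) * x m : ℝ) : ℂ) * Complex.I := by push_cast; ring
  rw [expo, this, Complex.norm_exp_ofReal_mul_I]

theorem expo_ne_zero (ξ : Freq) (x : Space) : expo ξ x ≠ 0 := Complex.exp_ne_zero _

theorem expo_neg_right (ξ : Freq) (x : Space) : expo ξ (-x) = expo (-ξ) x := by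
  simp [expo]

theorem expo_sub_right (ξ : Freq) (x y : Space) : expo ξ (x - y) = expo ξ x * expo (-ξ) y := by
  rw [sub_eq_add_neg, expo_add_right, expo_neg_right]

theorem expo_int (ξ : Freq) (n : Fin 3 → ℤ) : expo ξ (fun m => (n m : ℝ)) = 1 := by
  rw [expo, Complex.exp_eq_one_iff]
  exact ⟨∑ m, ξ m * n m, by push_cast; ring⟩

theorem expo_fract (ξ : Freq) (x : Space) : expo ξ (fun m => Int.fract (x m)) = expo ξ x := by
  have h : x = (fun m => Int.fract (x m)) + fun m => ((⌊x m⌋ : ℤ) : ℝ) := by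
    ext m; simp [Int.fract_add_floor]
  conv_rhs => rw [h, expo_add_right, expo_int, mul_one]

theorem contDiff_expo (ξ : Freq) : ContDiff ℝ ∞ (expo ξ) := by
  unfold expo
  have : ∀ m : Fin 3, ContDiff ℝ ∞ fun x : Space => ((x m : ℝ) : ℂ) := fun m =>
    Complex.ofRealCLM.contDiff.comp (contDiff_apply ℝ ℝ m)
  fun_prop

theorem continuous_expo (ξ : Freq) : Continuous (expo ξ) := (contDiff_expo ξ).continuous

theorem isSmoothPeriodic_expo (ξ : Freq) : IsSmoothPeriodic (expo ξ) := by
  refine ⟨contDiff_expo ξ, fun m x => ?_⟩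
  have h : (Pi.single m 1 : Space) = fun j => ((Pi.single m 1 : Fin 3 → ℤ) j : ℝ) := by
    ext j; by_cases hj : j = m
    · subst hj; simp
    · simp [hj]
  rw [expo_add_right, h, expo_int, mul_one]

theorem pderiv_expo (ξ : Freq) (m : Fin 3) (x : Space) :
    pderiv m (expo ξ) x = 2 * Real.pi * Complex.I * ξ m * expo ξ x := by
  have h1 : ∀ j : Fin 3, HasFDerivAt (fun x : Space => ((x j : ℝ) : ℂ))
      (Complex.ofRealCLM.comp (ContinuousLinearMap.proj (R := ℝ) j)) x := fun j =>
    Complex.ofRealCLM.hasFDerivAt.comp x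
      (ContinuousLinearMap.proj (R := ℝ) (φ := fun _ : Fin 3 => ℝ) j).hasFDerivAt
  have h2 : HasFDerivAt (fun x : Space => ∑ j, (ξ j : ℂ) * (x j : ℂ))
      (∑ j, (ξ j : ℂ) • Complex.ofRealCLM.comp (ContinuousLinearMap.proj (R := ℝ) j)) x := by
    refine HasFDerivAt.fun_sum fun j _ => ?_
    exact (h1 j).const_mul (ξ j : ℂ)
  have h3 := ((h2.const_mul (2 * Real.pi * Complex.I)).cexp).fderiv
  have h4 : expo ξ = fun x => Complex.exp (2 * Real.pi * Complex.I * ∑ m, (ξ m : ℂ) * (x m : ℂ)) :=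
    rfl
  have h5 : ∑ j, (ξ j : ℂ) * (((Pi.single m 1 : Space) j : ℝ) : ℂ) = ξ m := by
    rw [Finset.sum_eq_single m]
    · simp
    · intro j _ hj; simp [hj]
    · simp
  rw [pderiv, h4, h3]
  simp only [smul_apply, sum_apply, smul_eq_mul, ContinuousLinearMap.comp_apply,
    ContinuousLinearMap.proj_apply, Complex.ofRealCLM_apply, h5]
  ring

/-! ### Integrals of exponentials over boxes -/

theorem cell_eq_pi : cell = Set.univ.pi fun _ => Set.Ioo (0 : ℝ) 1 := by
  ext x; simp [cell]

theorem measurableSet_cell : MeasurableSet cell := by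
  rw [cell_eq_pi]; exact MeasurableSet.univ_pi fun _ => measurableSet_Ioo

theorem volume_cell : volume cell = 1 := by
  rw [cell_eq_pi, Real.volume_pi_Ioo]; simp

instance : IsProbabilityMeasure (volume.restrict cell) :=
  ⟨by rw [Measure.restrict_apply_univ, volume_cell]⟩

/-- Centring the interval separates a real sinc factor from a pure phase. Products of these
integrals yield both the multiplier of G_N and the voxel averages of exponentials. -/
theorem integral_exp_centered (k : ℤ) (c h : ℝ) :
    ∫ t in (c - h / 2)..(c + h / 2), Complex.exp (2 * Real.pi * Complex.I * (k * t)) =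
      h * Real.sinc (Real.pi * k * h) * Complex.exp (2 * Real.pi * Complex.I * (k * c)) := by
  by_cases hk : k = 0
  · subst hk; simp
  by_cases hh : h = 0
  · subst hh; simp
  have hkc : (k : ℂ) ≠ 0 := by exact_mod_cast hk
  have hhc : (h : ℂ) ≠ 0 := by exact_mod_cast hh
  have hpi : (Real.pi : ℂ) ≠ 0 := by exact_mod_cast Real.pi_ne_zero
  have hne : 2 * Real.pi * Complex.I * k ≠ 0 := by
    simp [hkc, Real.pi_ne_zero]
  have h1 := integral_exp_mul_complex (a := c - h / 2) (b := c + h / 2) hne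
  have h2 : ∀ t : ℝ, 2 * Real.pi * Complex.I * (k * t) = 2 * Real.pi * Complex.I * k * t := by
    intro t; ring
  simp only [h2, h1]
  have h3 : Real.pi * k * h ≠ 0 := by
    have : (k : ℝ) ≠ 0 := by exact_mod_cast hk
    simp [hh, this, Real.pi_ne_zero]
  rw [Real.sinc_of_ne_zero h3]
  push_cast
  rw [Complex.sin]
  have e1 : 2 * (Real.pi : ℂ) * Complex.I * k * (c + h / 2) =
      2 * Real.pi * Complex.I * k * c + Real.pi * k * h * Complex.I := by ring
  have e2 : 2 * (Real.pi : ℂ) * Complex.I * k * (c - h / 2) =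
      2 * Real.pi * Complex.I * k * c + -(Real.pi * k * h) * Complex.I := by ring
  rw [e1, e2, Complex.exp_add, Complex.exp_add]
  field_simp
  rw [Complex.I_sq]
  ring

theorem integral_expo_box (ξ : Freq) (c : Space) {h : ℝ} (hh : 0 ≤ h) :
    ∫ x in Set.univ.pi fun m => Set.Ioo (c m - h / 2) (c m + h / 2), expo ξ x =
      h ^ 3 * (∏ m, Real.sinc (Real.pi * ξ m * h) : ℝ) * expo ξ c := by
  rw [volume_pi, Measure.restrict_pi_pi]
  simp only [expo_eq_prod]
  rw [integral_fintype_prod_eq_prod (𝕜 := ℂ)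
    (fun m (t : ℝ) => Complex.exp (2 * Real.pi * Complex.I * (ξ m * t)))]
  have : ∀ m, ∫ t in Set.Ioo (c m - h / 2) (c m + h / 2),
      Complex.exp (2 * Real.pi * Complex.I * (ξ m * t)) =
      h * Real.sinc (Real.pi * ξ m * h) * Complex.exp (2 * Real.pi * Complex.I * (ξ m * c m)) := by
    intro m
    rw [← integral_exp_centered, intervalIntegral.integral_of_le (by linarith),
      integral_Ioc_eq_integral_Ioo]
  simp only [this, Finset.prod_mul_distrib]
  simp

theorem integral_expo_cell (ξ : Freq) : ∫ x in cell, expo ξ x = if ξ = 0 then 1 else 0 := by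
  have h := integral_expo_box ξ (fun _ => 1 / 2) zero_le_one
  have h0 : (Set.univ.pi fun _ : Fin 3 => Set.Ioo ((1 : ℝ) / 2 - 1 / 2) (1 / 2 + 1 / 2)) = cell := by
    rw [cell_eq_pi]; norm_num
  rw [h0] at h
  rw [h]
  split_ifs with hξ
  · subst hξ; simp
  · obtain ⟨m, hm⟩ := Function.ne_iff.mp hξ
    have : (∏ m, Real.sinc (Real.pi * ξ m * 1)) = 0 := by
      refine Finset.prod_eq_zero (Finset.mem_univ m) ?_
      have hm' : (ξ m : ℝ) ≠ 0 := by exact_mod_cast hm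
      rw [Real.sinc_of_ne_zero (by simp [Real.pi_ne_zero, hm']), mul_one, mul_comm, Real.sin_int_mul_pi,
        zero_div]
    rw [this]; simp

/-! ### The Fourier basis of `L²(Y)` -/

theorem memLp_expo (ξ : Freq) : MemLp (expo ξ) 2 (volume.restrict cell) :=
  MemLp.of_bound (continuous_expo ξ).aestronglyMeasurable 1
    (Eventually.of_forall fun x => (norm_expo ξ x).le)

/-- The exponential `expo ξ` as an element of `L²(Y)`. -/
def eL2 (ξ : Freq) : L2 ℂ := (memLp_expo ξ).toLp _

theorem coeFn_eL2 (ξ : Freq) : eL2 ξ =ᵐ[volume.restrict cell] expo ξ := (memLp_expo ξ).coeFn_toLp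

theorem inner_eL2 (ξ : Freq) (f : L2 ℂ) : inner ℂ (eL2 ξ) f = fcoef f ξ := by
  rw [L2.inner_def, fcoef]
  refine integral_congr_ae ?_
  filter_upwards [coeFn_eL2 ξ] with x hx
  rw [hx, RCLike.inner_apply, expo_neg, mul_comm]; rfl

theorem fcoef_congr {f g : Space → ℂ} (h : f =ᵐ[volume.restrict cell] g) (ξ : Freq) :
    fcoef f ξ = fcoef g ξ :=
  integral_congr_ae (h.mono fun x hx => by simp only [hx])

theorem fcoef_expo (ξ η : Freq) : fcoef (expo η) ξ = if ξ = η then 1 else 0 := by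
  simp only [fcoef, ← expo_add, integral_expo_cell]
  congr 1
  rw [neg_add_eq_zero]

theorem orthonormal_eL2 : Orthonormal ℂ eL2 := by
  classical
  rw [orthonormal_iff_ite]
  intro ξ η
  rw [inner_eL2, fcoef_congr (coeFn_eL2 η), fcoef_expo]

/-- The covering of the torus by space. -/
def toTorus (x : Space) : UnitAddTorus (Fin 3) := fun m => (x m : UnitAddCircle)

theorem measurable_toTorus : Measurable toTorus :=
  measurable_pi_lambda _ fun m => AddCircle.measurable_mk'.comp (measurable_pi_apply m)

theorem mFourier_toTorus (ξ : Freq) (x : Space) :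
    UnitAddTorus.mFourier ξ (toTorus x) = expo ξ x := by
  rw [expo_eq_prod]
  simp only [UnitAddTorus.mFourier, ContinuousMap.coe_mk, toTorus]
  refine Finset.prod_congr rfl fun m _ => ?_
  rw [fourier_coe_apply]
  congr 1
  push_cast
  ring

/-- A measurable section of the covering of the torus. -/
def ofTorus (z : UnitAddTorus (Fin 3)) : Space :=
  fun m => (AddCircle.measurableEquivIco 1 0 (z m) : ℝ)

theorem measurable_ofTorus : Measurable ofTorus :=
  measurable_pi_lambda _ fun m => measurable_subtype_coe.comp
    ((AddCircle.measurableEquivIco 1 0).measurable.comp (measurable_pi_apply m))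

theorem ofTorus_toTorus {x : Space} (hx : x ∈ cell) : ofTorus (toTorus x) = x := by
  ext m
  have : x m ∈ Set.Ico (0 : ℝ) (0 + 1) := ⟨(hx m).1.le, by simpa using (hx m).2⟩
  exact AddCircle.equivIco_coe_of_mem (p := (1 : ℝ)) (a := 0) this

/-- Stone–Weierstrass on the torus, transported to the cell. Taking the pushforward of Lebesgue
measure on the cell as the measure on the torus makes the covering measure preserving by
construction. Composition with the covering is onto `L2 ℂ` because `ofTorus` inverts it on the cell,
so density is inherited. -/
theorem span_eL2_dense : (Submodule.span ℂ (Set.range eL2)).topologicalClosure = ⊤ := by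
  let μ : Measure (UnitAddTorus (Fin 3)) := (volume.restrict cell).map toTorus
  have hmp : MeasurePreserving toTorus (volume.restrict cell) μ :=
    measurable_toTorus.measurePreserving _
  have : IsProbabilityMeasure μ := Measure.isProbabilityMeasure_map measurable_toTorus.aemeasurable
  have h1 : (Submodule.span ℂ (Set.range fun ξ : Freq =>
      ContinuousMap.toLp (E := ℂ) 2 μ ℂ (UnitAddTorus.mFourier ξ))).topologicalClosure = ⊤ := by
    simpa only [Submodule.map_span, ContinuousLinearMap.coe_coe, ← Set.range_comp,
      Function.comp_def] using
      (ContinuousMap.toLp_denseRange ℂ μ ℂ (by simp : (2 : ℝ≥0∞) ≠ ⊤)).topologicalClosure_map_submodule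
        UnitAddTorus.span_mFourier_closure_eq_top
  let J : Lp ℂ 2 μ →L[ℂ] L2 ℂ := (Lp.compMeasurePreservingₗᵢ ℂ toTorus hmp).toContinuousLinearMap
  have hJ : Function.Surjective J := by
    intro f
    have hae : ∀ᵐ x ∂(volume.restrict cell), (f : Space → ℂ) (ofTorus (toTorus x)) = f x := by
      filter_upwards [ae_restrict_mem measurableSet_cell] with x hx
      rw [ofTorus_toTorus hx]
    have hmeas : AEStronglyMeasurable (fun z => (f : Space → ℂ) (ofTorus z)) μ :=
      ((Lp.stronglyMeasurable f).comp_measurable measurable_ofTorus).aestronglyMeasurable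
    have hg : MemLp (fun z => (f : Space → ℂ) (ofTorus z)) 2 μ :=
      (memLp_map_measure_iff hmeas measurable_toTorus.aemeasurable).2
        ((memLp_congr_ae hae).2 (Lp.memLp f))
    refine ⟨hg.toLp _, ?_⟩
    refine Lp.ext ?_
    refine (Lp.coeFn_compMeasurePreserving (hg.toLp _) hmp).trans ?_
    exact (hmp.quasiMeasurePreserving.ae_eq_comp hg.coeFn_toLp).trans hae
  have h2 := hJ.denseRange.topologicalClosure_map_submodule h1
  rw [Submodule.map_span, ← Set.range_comp] at h2
  have h3 : (⇑(J : Lp ℂ 2 μ →ₗ[ℂ] L2 ℂ) ∘ fun ξ : Freq =>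
      ContinuousMap.toLp (E := ℂ) 2 μ ℂ (UnitAddTorus.mFourier ξ)) = eL2 := by
    ext1 ξ
    refine Lp.ext ?_
    refine (Lp.coeFn_compMeasurePreserving _ hmp).trans (EventuallyEq.trans ?_ (coeFn_eL2 ξ).symm)
    refine (hmp.quasiMeasurePreserving.ae_eq_comp (ContinuousMap.coeFn_toLp μ _)).trans ?_
    exact Eventually.of_forall fun x => mFourier_toTorus ξ x
  rwa [h3] at h2

/-- The Fourier basis of `L²(Y)`. -/
def fourierL2 : HilbertBasis Freq ℂ (L2 ℂ) := HilbertBasis.mk orthonormal_eL2 span_eL2_dense.ge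

@[simp] theorem coe_fourierL2 : ⇑fourierL2 = eL2 := HilbertBasis.coe_mk _ _

theorem hasSum_fcoef (f : L2 ℂ) : HasSum (fun ξ => fcoef f ξ • eL2 ξ) f := by
  simpa [HilbertBasis.repr_apply_apply, inner_eL2] using fourierL2.hasSum_repr f

theorem hasSum_norm_fcoef_sq (f : L2 ℂ) : HasSum (fun ξ => ‖fcoef f ξ‖ ^ 2) (‖f‖ ^ 2) := by
  have h := RCLike.hasSum_re ℂ (fourierL2.hasSum_inner_mul_inner f f)
  simp only [coe_fourierL2, inner_self_eq_norm_sq] at h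
  refine h.congr_fun fun ξ => ?_
  rw [← inner_conj_symm, RCLike.conj_mul, inner_eL2]
  norm_cast

theorem fcoef_sum_expo (s : Finset Freq) (c : Freq → ℂ) (η : Freq) :
    fcoef (fun x => ∑ ξ ∈ s, c ξ * expo ξ x) η = if η ∈ s then c η else 0 := by
  classical
  simp only [fcoef, Finset.mul_sum]
  rw [integral_finsetSum]
  · have : ∀ ξ, ∫ x in cell, expo (-η) x * (c ξ * expo ξ x) = if ξ = η then c ξ else 0 := by
      intro ξ
      have : ∀ x, expo (-η) x * (c ξ * expo ξ x) = c ξ * expo (-η + ξ) x := by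
        intro x; rw [expo_add]; ring
      simp only [this, integral_const_mul, integral_expo_cell, neg_add_eq_zero, eq_comm (a := η)]
      simp
    simp only [this, Finset.sum_ite_eq']
  · intro ξ _
    have hc : Continuous fun x => expo (-η) x * (c ξ * expo ξ x) :=
      (continuous_expo _).mul (continuous_const.mul (continuous_expo _))
    refine MemLp.integrable le_rfl (MemLp.of_bound hc.aestronglyMeasurable ‖c ξ‖
      (Eventually.of_forall fun x => ?_))
    simp [norm_expo]

/-! ### Fourier coefficients of derivatives -/

theorem continuous_pderiv {𝕜 : Type*} [RCLike 𝕜] {f : Space → 𝕜} (hf : ContDiff ℝ ∞ f)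
    (m : Fin 3) : Continuous (pderiv m f) :=
  (hf.continuous_fderiv (by simp)).clm_apply continuous_const

/-- Divergence theorem on the closed cube for the field whose only component is f in direction m;
opposite faces cancel by periodicity. -/
theorem integral_pderiv_eq_zero {f : Space → ℂ} (hf : IsSmoothPeriodic f) (m : Fin 3) :
    ∫ x in cell, pderiv m f x = 0 := by
  have hcell : cell =ᵐ[volume] Set.Icc (0 : Space) 1 := by
    rw [cell_eq_pi]
    exact Measure.univ_pi_Ioo_ae_eq_Icc (f := fun _ : Fin 3 => (0 : ℝ)) (g := fun _ => 1)
  rw [setIntegral_congr_set hcell]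
  have hfd : ∀ x, HasFDerivAt f (fderiv ℝ f x) x := fun x =>
    (hf.1.differentiable (by simp) x).hasFDerivAt
  have key := integral_divergence_of_hasFDerivAt_off_countable' (n := 2) (0 : Space) 1
    (fun _ => zero_le_one) (fun i => if i = m then f else 0)
    (fun i => if i = m then fderiv ℝ f else 0) ∅ Set.countable_empty
    (fun i => by
      split_ifs
      · exact hf.1.continuous.continuousOn
      · exact continuousOn_const)
    (fun x _ i => by
      split_ifs
      · exact hfd x
      · exact hasFDerivAt_const (0 : ℂ) x)
    (by
      refine Continuous.integrableOn_Icc ?_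
      refine continuous_finsetSum _ fun i _ => ?_
      split_ifs
      · exact (hf.1.continuous_fderiv (by simp)).clm_apply continuous_const
      · exact continuous_const)
  have hper : ∀ (i : Fin 3) (y : Fin 2 → ℝ), (if i = m then f else 0) (i.insertNth (1 : ℝ) y) =
      (if i = m then f else 0) (i.insertNth (0 : ℝ) y) := by
    intro i y
    have h1 : (i.insertNth (1 : ℝ) y : Space) = (i.insertNth (0 : ℝ) y : Space) + Pi.single i 1 := by
      ext k
      refine Fin.succAboveCases i ?_ (fun l => ?_) k
      · simp
      · simp [Fin.succAbove_ne]
    split_ifs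
    · rw [h1, hf.2]
    · rfl
  simp only [Pi.one_apply, Pi.zero_apply, hper, sub_self, Finset.sum_const_zero] at key
  rw [← key]
  refine integral_congr_ae (Eventually.of_forall fun x => ?_)
  simp only [pderiv]
  rw [Finset.sum_eq_single m]
  · simp
  · intro i _ hi; simp [hi]
  · simp

theorem pderiv_mul {f g : Space → ℂ} (hf : ContDiff ℝ ∞ f) (hg : ContDiff ℝ ∞ g) (m : Fin 3)
    (x : Space) : pderiv m (fun x => f x * g x) x = f x * pderiv m g x + pderiv m f x * g x := by
  have h1 := hf.differentiable (by simp) x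
  have h2 := hg.differentiable (by simp) x
  simp only [pderiv, fderiv_fun_mul h1 h2]
  simp [mul_comm]

theorem fcoef_pderiv {f : Space → ℂ} (hf : IsSmoothPeriodic f) (m : Fin 3) (ξ : Freq) :
    fcoef (pderiv m f) ξ = 2 * Real.pi * Complex.I * ξ m * fcoef f ξ := by
  have he := isSmoothPeriodic_expo (-ξ)
  have h := integral_pderiv_eq_zero (f := fun x => expo (-ξ) x * f x)
    ⟨he.1.mul hf.1, fun m x => by simp only [he.2, hf.2]⟩ m
  have hint : ∀ g : Space → ℂ, Continuous g → Integrable g (volume.restrict cell) := by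
    intro g hg
    refine IntegrableOn.mono_set (t := Set.Icc (0 : Space) 1) hg.integrableOn_Icc ?_
    exact fun x hx => ⟨fun i => (hx i).1.le, fun i => (hx i).2.le⟩
  simp only [pderiv_mul he.1 hf.1, pderiv_expo] at h
  rw [integral_add (f := fun x => expo (-ξ) x * pderiv m f x)
    (g := fun x => 2 * Real.pi * Complex.I * ((-ξ) m : ℤ) * expo (-ξ) x * f x)
    (hint _ (he.1.continuous.mul (continuous_pderiv hf.1 m)))
    (hint _ ((continuous_const.mul he.1.continuous).mul hf.1.continuous))] at h
  have h2 : ∀ x, 2 * Real.pi * Complex.I * ((-ξ) m : ℤ) * expo (-ξ) x * f x =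
      -(2 * Real.pi * Complex.I * ξ m) * (expo (-ξ) x * f x) := by
    intro x; push_cast [Pi.neg_apply]; ring
  simp only [h2, integral_const_mul] at h
  simp only [fcoef]
  linear_combination h

/-! ### Fourier description of the Sobolev space -/

/-- The Fourier coefficient as a continuous functional on `L²(Y)`. -/
def fcoefL (ξ : Freq) : L2 ℂ →L[ℂ] ℂ := innerSL ℂ (eL2 ξ)

theorem fcoefL_apply (ξ : Freq) (f : L2 ℂ) : fcoefL ξ f = fcoef f ξ := inner_eL2 ξ f

theorem fcoefL_eL2 (ξ η : Freq) : fcoefL ξ (eL2 η) = if ξ = η then 1 else 0 := by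
  rw [fcoefL_apply, fcoef_congr (coeFn_eL2 η), fcoef_expo]

/-- The entry of a jet with a given index. -/
def entryL (𝕜 : Type*) [RCLike 𝕜] (i : Fin 3 × Option (Fin 3)) : Jet 𝕜 →L[𝕜] L2 𝕜 :=
  PiLp.proj 2 (fun _ : Fin 3 × Option (Fin 3) => L2 𝕜) i

@[simp] theorem entryL_apply {𝕜 : Type*} [RCLike 𝕜] (i : Fin 3 × Option (Fin 3)) (U : Jet 𝕜) :
    entryL 𝕜 i U = U i := rfl

/-- A closed linear condition that holds for smooth jets, hence on their closure. It ties the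
gradient entries of a jet to its displacement entries. -/
theorem fcoef_grad {U : Jet ℂ} (hU : U ∈ H1 ℂ) (j m : Fin 3) (ξ : Freq) :
    fcoef (U (j, some m)) ξ = 2 * Real.pi * Complex.I * ξ m * fcoef (U (j, none)) ξ := by
  have hcl : IsClosed {U : Jet ℂ | fcoefL ξ (entryL ℂ (j, some m) U) =
      2 * Real.pi * Complex.I * ξ m * fcoefL ξ (entryL ℂ (j, none) U)} :=
    isClosed_eq (by fun_prop) (by fun_prop)
  have : U ∈ {U : Jet ℂ | fcoefL ξ (entryL ℂ (j, some m) U) =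
      2 * Real.pi * Complex.I * ξ m * fcoefL ξ (entryL ℂ (j, none) U)} := by
    refine closure_minimal ?_ hcl hU
    rintro V ⟨φ, hφ, hV, hV'⟩
    simp only [Set.mem_ofPred_eq, fcoefL_apply, entryL_apply]
    rw [fcoef_congr (hV j), fcoef_congr (hV' j m), fcoef_pderiv (hφ j)]
  simpa only [Set.mem_ofPred_eq, fcoefL_apply, entryL_apply] using this

/-- The coefficient of `expo ξ` in the entries of the jet of `x ↦ expo ξ x • b_j`. -/
def modeCoef (ξ : Freq) : Option (Fin 3) → ℂ
  | none => 1
  | some m => 2 * Real.pi * Complex.I * ξ m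

/-- The jet of the vector field `x ↦ expo ξ x • b_j`. -/
def modeJet (ξ : Freq) (j : Fin 3) : Jet ℂ :=
  WithLp.toLp 2 fun i => if i.1 = j then modeCoef ξ i.2 • eL2 ξ else 0

theorem modeJet_mem (ξ : Freq) (j : Fin 3) : modeJet ξ j ∈ H1 ℂ := by
  refine Submodule.le_topologicalClosure _ ⟨fun k => if k = j then expo ξ else 0,
    fun k => ?_, fun k => ?_, fun k m => ?_⟩
  · dsimp only
    split_ifs
    · exact isSmoothPeriodic_expo ξ
    · exact ⟨contDiff_const, fun _ _ => rfl⟩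
  · simp only [modeJet]
    split_ifs
    · simpa [modeCoef] using coeFn_eL2 ξ
    · exact Lp.coeFn_zero ℂ 2 _
  · simp only [modeJet]
    split_ifs
    · refine (Lp.coeFn_smul _ _).trans ?_
      filter_upwards [coeFn_eL2 ξ] with x hx
      rw [Pi.smul_apply, hx, pderiv_expo, smul_eq_mul, modeCoef]
    · refine (Lp.coeFn_zero ℂ 2 _).trans (Eventually.of_forall fun x => ?_)
      simp [pderiv]

/-- The vector field `x ↦ expo ξ x • b_j` in the Sobolev space. -/
def mode (ξ : Freq) (j : Fin 3) : H1 ℂ := ⟨modeJet ξ j, modeJet_mem ξ j⟩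

/-- The topology of `H1 ℂ` is induced from a finite product of copies of `L2 ℂ`, so convergence may
be checked entrywise. Each entry is an ordinary Fourier series with coefficients given by
`fcoef_grad`. -/
theorem hasSum_mode (u : H1 ℂ) :
    HasSum (fun ξ => ∑ j, fcoef (comp u j) ξ • mode ξ j) u := by
  rw [← (H1 ℂ).subtypeₗᵢ.isometry.isEmbedding.isInducing.hasSum_iff (g := (H1 ℂ).subtypeₗᵢ),
    ← (PiLp.continuousLinearEquiv 2 ℂ
      (fun _ : Fin 3 × Option (Fin 3) => L2 ℂ)).toHomeomorph.isInducing.hasSum_iff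
      (g := PiLp.continuousLinearEquiv 2 ℂ (fun _ : Fin 3 × Option (Fin 3) => L2 ℂ)), Pi.hasSum]
  intro i
  have h := hasSum_fcoef ((u : Jet ℂ) i)
  refine h.congr_fun fun ξ => ?_
  have h1 : ∀ j, (modeJet ξ j) i = if i.1 = j then modeCoef ξ i.2 • eL2 ξ else 0 := fun j => rfl
  have h2 : fcoef ((u : Jet ℂ) i) ξ = fcoef (comp u i.1) ξ * modeCoef ξ i.2 := by
    rcases i with ⟨j, _ | m⟩
    · simp [modeCoef, comp]
    · simp only [modeCoef, comp]
      rw [fcoef_grad u.2, mul_comm]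
  have h3 : (PiLp.continuousLinearEquiv 2 ℂ (fun _ : Fin 3 × Option (Fin 3) => L2 ℂ))
      ((H1 ℂ).subtypeₗᵢ (∑ j, fcoef (comp u j) ξ • mode ξ j)) i =
      entryL ℂ i ((H1 ℂ).subtypeₗᵢ (∑ j, fcoef (comp u j) ξ • mode ξ j)) := rfl
  have h4 : ∀ j, (H1 ℂ).subtypeₗᵢ (mode ξ j) = modeJet ξ j := fun j => rfl
  simp only [Function.comp_apply]
  rw [h3, h2, map_sum, map_sum]
  simp only [map_smul, h4, entryL_apply, h1]
  simp [mul_smul]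

theorem span_mode_dense :
    (Submodule.span ℂ (Set.range fun p : Freq × Fin 3 => mode p.1 p.2)).topologicalClosure = ⊤ := by
  rw [eq_top_iff]
  intro u _
  refine mem_closure_of_tendsto (hasSum_mode u) (Eventually.of_forall fun s => ?_)
  exact Submodule.sum_mem _ fun ξ _ => Submodule.sum_mem _ fun j _ =>
    Submodule.smul_mem _ _ (Submodule.subset_span ⟨(ξ, j), rfl⟩)

/-! ### Korn and Poincaré inequalities -/

/-- The entry `(m, n)` of the symmetric gradient. -/
def symL (𝕜 : Type*) [RCLike 𝕜] (m n : Fin 3) : Jet 𝕜 →L[𝕜] L2 𝕜 :=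
  (2⁻¹ : 𝕜) • (entryL 𝕜 (n, some m) + entryL 𝕜 (m, some n))

theorem symL_apply {𝕜 : Type*} [RCLike 𝕜] (m n : Fin 3) (U : Jet 𝕜) :
    symL 𝕜 m n U = (2⁻¹ : 𝕜) • (U (n, some m) + U (m, some n)) := rfl

theorem coeFn_symL {𝕜 : Type*} [RCLike 𝕜] (u : H1 𝕜) (m n : Fin 3) :
    symL 𝕜 m n (u : Jet 𝕜) =ᵐ[volume.restrict cell] fun x => symGrad u x m n := by
  rw [symL_apply]
  refine (Lp.coeFn_smul _ _).trans ?_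
  filter_upwards [Lp.coeFn_add ((u : Jet 𝕜) (n, some m)) ((u : Jet 𝕜) (m, some n))] with x hx
  simp only [Pi.smul_apply, hx, Pi.add_apply, symGrad, grad, smul_eq_mul]
  ring

theorem fcoef_symL (u : H1 ℂ) (m n : Fin 3) (ξ : Freq) :
    fcoef (symL ℂ m n (u : Jet ℂ)) ξ = 2 * Real.pi * Complex.I *
      ((ξ m * fcoef (comp u n) ξ + ξ n * fcoef (comp u m) ξ) / 2) := by
  rw [← fcoefL_apply]
  simp only [symL, smul_apply, add_apply, map_smul, map_add, entryL_apply, fcoefL_apply,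
    fcoef_grad u.2, comp, smul_eq_mul]
  ring

/-- The Korn inequality for symbols. -/
theorem korn_symbol (t : Fin 3 → ℝ) (a : Fin 3 → ℂ) :
    (∑ m, t m ^ 2) * (∑ n, ‖a n‖ ^ 2) ≤
      2 * ∑ m, ∑ n, ‖((t m : ℂ) * a n + t n * a m) / 2‖ ^ 2 := by
  have hre : ∀ m n, ‖((t m : ℂ) * a n + t n * a m) / 2‖ ^ 2 =
      ((t m * (a n).re + t n * (a m).re) / 2) ^ 2 + ((t m * (a n).im + t n * (a m).im) / 2) ^ 2 := by
    intro m n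
    rw [Complex.sq_norm, Complex.normSq_apply]
    have h : ((t m : ℂ) * a n + t n * a m) / 2 =
        (((t m * (a n).re + t n * (a m).re) / 2 : ℝ) : ℂ) +
        (((t m * (a n).im + t n * (a m).im) / 2 : ℝ) : ℂ) * Complex.I := by
      apply Complex.ext <;> simp
    rw [h]; simp; ring
  have hn : ∀ n, ‖a n‖ ^ 2 = (a n).re ^ 2 + (a n).im ^ 2 := by
    intro n; rw [Complex.sq_norm, Complex.normSq_apply]; ring
  simp only [hre, hn, Fin.sum_univ_three]
  -- For real a, twice the squared norm of t ⊗ˢ a is |t|²|a|² + (t·a)². As t is real, this applies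
  -- to the real and imaginary parts separately.
  nlinarith [sq_nonneg (t 0 * (a 0).re + t 1 * (a 1).re + t 2 * (a 2).re),
    sq_nonneg (t 0 * (a 0).im + t 1 * (a 1).im + t 2 * (a 2).im)]

theorem one_le_sum_sq {ξ : Freq} (hξ : ξ ≠ 0) : (1 : ℝ) ≤ ∑ m, (ξ m : ℝ) ^ 2 := by
  obtain ⟨m, hm⟩ := Function.ne_iff.mp hξ
  have h1 : (1 : ℤ) ≤ ξ m ^ 2 := Int.add_one_le_of_lt (sq_pos_of_ne_zero hm)
  have h2 : (1 : ℝ) ≤ (ξ m : ℝ) ^ 2 := by exact_mod_cast h1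
  exact h2.trans (Finset.single_le_sum (f := fun m => (ξ m : ℝ) ^ 2) (fun i _ => sq_nonneg _)
    (Finset.mem_univ m))

theorem norm_sq_jet {𝕜 : Type*} [RCLike 𝕜] (U : Jet 𝕜) :
    ‖U‖ ^ 2 = ∑ j, (‖U (j, none)‖ ^ 2 + ∑ m, ‖U (j, some m)‖ ^ 2) := by
  rw [PiLp.norm_sq_eq_of_L2, Fintype.sum_prod_type]
  simp [Fintype.sum_option]

theorem hasSum_norm_sq (u : H1 ℂ) :
    HasSum (fun ξ : Freq => (1 + (2 * Real.pi) ^ 2 * ∑ m, (ξ m : ℝ) ^ 2) *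
      ∑ j, ‖fcoef (comp u j) ξ‖ ^ 2) (‖u‖ ^ 2) := by
  have hN : ‖u‖ ^ 2 = ‖(u : Jet ℂ)‖ ^ 2 := rfl
  rw [hN, norm_sq_jet]
  have h := hasSum_sum (s := Finset.univ) fun (j : Fin 3) _ =>
    (hasSum_norm_fcoef_sq ((u : Jet ℂ) (j, none))).add
      (hasSum_sum (s := Finset.univ) fun (m : Fin 3) _ =>
        hasSum_norm_fcoef_sq ((u : Jet ℂ) (j, some m)))
  refine h.congr_fun fun ξ => ?_
  rw [Finset.mul_sum]
  refine Finset.sum_congr rfl fun j _ => ?_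
  simp only [fcoef_grad u.2, norm_mul, mul_pow]
  rw [← Finset.sum_mul]
  have : ∀ m, ‖(2 : ℂ)‖ ^ 2 * ‖(Real.pi : ℂ)‖ ^ 2 * ‖Complex.I‖ ^ 2 * ‖(ξ m : ℂ)‖ ^ 2 =
      2 ^ 2 * Real.pi ^ 2 * (ξ m : ℝ) ^ 2 := by
    intro m; simp
  simp only [this, ← Finset.mul_sum, comp]
  ring

/-- Compared frequency by frequency. For ξ ≠ 0 the weight 1 + (2π)²|ξ|² is at most 2(2π)²|ξ|², and
`korn_symbol` costs another factor 2, whence the 4. The frequency 0 is covered by the mean values.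
-/
theorem korn_poincare (u : H1 ℂ) :
    ‖u‖ ^ 2 ≤ 4 * (∑ m, ∑ n, ‖symL ℂ m n (u : Jet ℂ)‖ ^ 2 + ∑ j, ‖fcoef (comp u j) 0‖ ^ 2) := by
  have h1 := hasSum_norm_sq u
  have h2 : HasSum (fun ξ : Freq => ∑ m, ∑ n, ‖fcoef (symL ℂ m n (u : Jet ℂ)) ξ‖ ^ 2)
      (∑ m, ∑ n, ‖symL ℂ m n (u : Jet ℂ)‖ ^ 2) :=
    hasSum_sum fun m _ => hasSum_sum fun n _ => hasSum_norm_fcoef_sq _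
  have h3 : HasSum (fun ξ : Freq => if ξ = 0 then ∑ j, ‖fcoef (comp u j) 0‖ ^ 2 else 0)
      (∑ j, ‖fcoef (comp u j) 0‖ ^ 2) := hasSum_ite_eq 0 _
  refine hasSum_le (fun ξ => ?_) h1 ((h2.add h3).mul_left 4)
  have h0 : (0 : ℝ) ≤ ∑ j, ‖fcoef (comp u j) ξ‖ ^ 2 := Finset.sum_nonneg fun _ _ => sq_nonneg _
  by_cases hξ : ξ = 0
  · subst hξ
    have : (0 : ℝ) ≤ ∑ m, ∑ n, ‖fcoef (symL ℂ m n (u : Jet ℂ)) 0‖ ^ 2 :=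
      Finset.sum_nonneg fun _ _ => Finset.sum_nonneg fun _ _ => sq_nonneg _
    simp only [Pi.zero_apply, Int.cast_zero, if_true]
    simp only [ne_eq, OfNat.ofNat_ne_zero, not_false_eq_true, zero_pow, Finset.sum_const_zero,
      mul_zero, add_zero, one_mul]
    linarith
  · have hk := korn_symbol (fun m => (ξ m : ℝ)) (fun j => fcoef (comp u j) ξ)
    have h5 : ∀ m n, ‖fcoef (symL ℂ m n (u : Jet ℂ)) ξ‖ ^ 2 = (2 * Real.pi) ^ 2 *
        ‖(((ξ m : ℝ) : ℂ) * fcoef (comp u n) ξ + ((ξ n : ℝ) : ℂ) * fcoef (comp u m) ξ) / 2‖ ^ 2 := by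
      intro m n
      rw [fcoef_symL, norm_mul, mul_pow]
      simp [abs_of_pos Real.pi_pos]
    simp only [h5, ← Finset.mul_sum, if_neg hξ, add_zero]
    have h6 : (1 : ℝ) ≤ (2 * Real.pi) ^ 2 * ∑ m, (ξ m : ℝ) ^ 2 := by
      have : (1 : ℝ) ≤ (2 * Real.pi) ^ 2 := by nlinarith [Real.pi_gt_three]
      nlinarith [one_le_sum_sq hξ]
    have h7 := mul_le_mul_of_nonneg_left hk (sq_nonneg (2 * Real.pi))
    nlinarith [mul_le_mul_of_nonneg_right h6 h0]

theorem jetOfReal_apply (U : Jet ℝ) (i : Fin 3 × Option (Fin 3)) :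
    jetOfReal U i =ᵐ[volume.restrict cell] fun x => ((U i : Space → ℝ) x : ℂ) :=
  Complex.ofRealCLM.coeFn_compLpL (U i)

theorem norm_of_ae_ofReal {f : L2 ℂ} {g : L2 ℝ}
    (h : f =ᵐ[volume.restrict cell] fun x => ((g : Space → ℝ) x : ℂ)) : ‖f‖ = ‖g‖ := by
  rw [Lp.norm_def, Lp.norm_def]
  congr 1
  refine eLpNorm_congr_norm_ae ?_
  filter_upwards [h] with x hx
  rw [hx]; simp

theorem norm_ofRealH1 (u : H1 ℝ) : ‖ofRealH1 u‖ = ‖u‖ := by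
  have : ‖ofRealH1 u‖ ^ 2 = ‖u‖ ^ 2 := by
    change ‖jetOfReal u‖ ^ 2 = ‖(u : Jet ℝ)‖ ^ 2
    rw [PiLp.norm_sq_eq_of_L2, PiLp.norm_sq_eq_of_L2]
    simp only [norm_of_ae_ofReal (jetOfReal_apply _ _)]
  exact (pow_left_inj₀ (norm_nonneg _) (norm_nonneg _) two_ne_zero).1 this

theorem symL_ofReal (u : H1 ℝ) (m n : Fin 3) :
    symL ℂ m n (ofRealH1 u : Jet ℂ) =ᵐ[volume.restrict cell]
      fun x => ((symL ℝ m n (u : Jet ℝ) : Space → ℝ) x : ℂ) := by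
  filter_upwards [coeFn_symL u m n, coeFn_symL (ofRealH1 u) m n, jetOfReal_apply u (n, some m),
    jetOfReal_apply u (m, some n)] with x h1 h2 h3 h4
  have h3' : (((ofRealH1 u : H1 ℂ) : Jet ℂ) (n, some m) : Space → ℂ) x =
    (((u : Jet ℝ) (n, some m) : Space → ℝ) x : ℂ) := h3
  have h4' : (((ofRealH1 u : H1 ℂ) : Jet ℂ) (m, some n) : Space → ℂ) x =
    (((u : Jet ℝ) (m, some n) : Space → ℝ) x : ℂ) := h4
  rw [h1, h2]
  simp [symGrad, grad, h3', h4']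

theorem fcoef_zero (f : Space → ℂ) : fcoef f 0 = ∫ x in cell, f x := by simp [fcoef]

theorem fcoef_zero_ofReal (u : H1 ℝ) (j : Fin 3) :
    fcoef (comp (ofRealH1 u) j) 0 = ((∫ x in cell, comp u j x : ℝ) : ℂ) := by
  rw [fcoef_zero, ← integral_complex_ofReal]
  exact integral_congr_ae (jetOfReal_apply u (j, none))

/-- Complexification is isometric and commutes with symmetric gradients and means, so the inequality
descends from the complex space, where Fourier series are available. -/
theorem korn_poincare_real (u : H1 ℝ) :
    ‖u‖ ^ 2 ≤ 4 * (∑ m, ∑ n, ‖symL ℝ m n (u : Jet ℝ)‖ ^ 2 +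
      ∑ j, (∫ x in cell, comp u j x) ^ 2) := by
  have h := korn_poincare (ofRealH1 u)
  rw [norm_ofRealH1] at h
  simpa only [norm_of_ae_ofReal (symL_ofReal u _ _), fcoef_zero_ofReal, Complex.norm_real,
    Real.norm_eq_abs, sq_abs] using h

/-! ### Stiffness tensors acting on complex matrices -/

/-- The lower bound for the quadratic form of a stiffness tensor. -/
def IsCoerciveTensor (a : ℝ) (T : Tensor4 ℝ) : Prop :=
  ∀ F : Mat ℝ, F.IsSymm → a * mdot F F ≤ mdot F (ddot T F)

/-- A real tensor acts separately on real and imaginary parts, and the mixed terms contribute only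
to the imaginary part of the form. -/
theorem IsCoerciveTensor.hermitian {𝕜 : Type*} [RCLike 𝕜] {a : ℝ} {T : Tensor4 ℝ}
    (hT : IsCoerciveTensor a T) {F : Mat 𝕜} (hF : F.IsSymm) :
    a * ∑ m, ∑ n, ‖F m n‖ ^ 2 ≤
      RCLike.re (∑ m, ∑ n, star (F m n) * ddot (castT 𝕜 T) F m n) := by
  have hre := hT (fun m n => RCLike.re (F m n))
    (Matrix.IsSymm.ext fun m n => congrArg RCLike.re (hF.apply m n))
  have him := hT (fun m n => RCLike.im (F m n))
    (Matrix.IsSymm.ext fun m n => congrArg RCLike.im (hF.apply m n))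
  simp only [mdot, ddot] at hre him
  have hn : ∀ m n, ‖F m n‖ ^ 2 =
      RCLike.re (F m n) * RCLike.re (F m n) + RCLike.im (F m n) * RCLike.im (F m n) := by
    intro m n; rw [← RCLike.normSq_eq_def', RCLike.normSq_apply]
  have h : RCLike.re (∑ m, ∑ n, star (F m n) * ddot (castT 𝕜 T) F m n) =
      (∑ m, ∑ n, RCLike.re (F m n) * ∑ p, ∑ q, T m n p q * RCLike.re (F p q)) +
      ∑ m, ∑ n, RCLike.im (F m n) * ∑ p, ∑ q, T m n p q * RCLike.im (F p q) := by
    simp only [ddot, castT, map_sum, ← Finset.sum_add_distrib, RCLike.star_def, RCLike.mul_re,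
      RCLike.conj_re, RCLike.conj_im, RCLike.ofReal_re, RCLike.ofReal_im, RCLike.mul_im]
    refine Finset.sum_congr rfl fun m _ => Finset.sum_congr rfl fun n _ => ?_
    simp only [zero_mul, sub_zero, add_zero, neg_mul, sub_neg_eq_add]
  rw [h]
  simp only [hn, Finset.sum_add_distrib, mul_add]
  linarith

theorem ddot_symm {𝕜 : Type*} [RCLike 𝕜] {T : Tensor4 ℝ} (hT : IsElasticSymm T) (F : Mat 𝕜)
    (m n : Fin 3) : ddot (castT 𝕜 T) F m n = ddot (castT 𝕜 T) F n m := by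
  simp only [ddot, castT]
  refine Finset.sum_congr rfl fun p _ => Finset.sum_congr rfl fun q _ => ?_
  rw [(hT m n p q).1]

theorem castT_real (T : Tensor4 ℝ) : castT ℝ T = T := rfl

theorem ddot_add {R : Type*} [CommRing R] (T : Tensor4 R) (F G : Mat R) :
    ddot T (F + G) = ddot T F + ddot T G := by
  ext m n
  simp [ddot, mul_add, Finset.sum_add_distrib]

theorem ddot_smul {R : Type*} [CommRing R] (T : Tensor4 R) (c : R) (F : Mat R) :
    ddot T (c • F) = c • ddot T F := by
  ext m n
  simp [ddot, Finset.mul_sum, mul_left_comm]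

theorem ddot_cast (T : Tensor4 ℝ) (F : Mat ℝ) (m n : Fin 3) :
    ddot (castT ℂ T) (castM ℂ F) m n = ((ddot T F m n : ℝ) : ℂ) := by
  simp [ddot, castT, castM]

/-- A common bound for the entries of finitely many tensors. -/
theorem exists_tensor_bound {M : ℕ} (Λ : Fin (M + 1) → Tensor4 ℝ) :
    ∃ K : ℝ, 0 ≤ K ∧ ∀ l m n p q, |Λ l m n p q| ≤ K := by
  refine ⟨∑ l, ∑ m, ∑ n, ∑ p, ∑ q, |Λ l m n p q|, by positivity, fun l m n p q => ?_⟩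
  refine le_trans ?_ (Finset.single_le_sum (f := fun l => ∑ m, ∑ n, ∑ p, ∑ q, |Λ l m n p q|)
    (fun _ _ => by positivity) (Finset.mem_univ l))
  refine le_trans ?_ (Finset.single_le_sum (f := fun m => ∑ n, ∑ p, ∑ q, |Λ l m n p q|)
    (fun _ _ => by positivity) (Finset.mem_univ m))
  refine le_trans ?_ (Finset.single_le_sum (f := fun n => ∑ p, ∑ q, |Λ l m n p q|)
    (fun _ _ => by positivity) (Finset.mem_univ n))
  refine le_trans ?_ (Finset.single_le_sum (f := fun p => ∑ q, |Λ l m n p q|)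
    (fun _ _ => by positivity) (Finset.mem_univ p))
  exact Finset.single_le_sum (f := fun q => |Λ l m n p q|) (fun _ _ => abs_nonneg _)
    (Finset.mem_univ q)

/-! ### Boundaries of the phases are null sets -/

-- The translates of the graph by ν/(n+1) are pairwise disjoint, since the height y·ν − g over the
-- graph equals 1/(n+1) on the n-th. Infinitely many disjoint translates by a bounded set of vectors
-- force measure zero.
open scoped Pointwise in
theorem volume_graph_eq_zero {ν : Space} (hν : ν ⬝ᵥ ν = 1) {g : Space → ℝ} (hg : Continuous g) :
    volume {y : Space | g (y - (y ⬝ᵥ ν) • ν) = y ⬝ᵥ ν} = 0 := by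
  have hdot : Continuous fun y : Space => y ⬝ᵥ ν := by unfold dotProduct; fun_prop
  have hcl : IsClosed {y : Space | g (y - (y ⬝ᵥ ν) • ν) = y ⬝ᵥ ν} :=
    isClosed_eq (hg.comp (continuous_id.sub (hdot.smul continuous_const))) hdot
  refine Measure.addHaar_eq_zero_of_disjoint_translates volume (fun n : ℕ => ((n + 1 : ℝ)⁻¹) • ν)
    ?_ ?_ hcl.measurableSet
  · refine (Metric.isBounded_closedBall (x := (0 : Space)) (r := ‖ν‖)).subset ?_
    rintro _ ⟨n, rfl⟩
    rw [mem_closedBall_zero_iff, norm_smul]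
    refine mul_le_of_le_one_left (norm_nonneg _) ?_
    rw [norm_inv, Real.norm_of_nonneg (by positivity)]
    exact inv_le_one_of_one_le₀ (by linarith [n.cast_nonneg (α := ℝ)])
  · have key : ∀ (t : ℝ) (y : Space), y ∈ ({t • ν} : Set Space) +
        {y : Space | g (y - (y ⬝ᵥ ν) • ν) = y ⬝ᵥ ν} → y ⬝ᵥ ν - g (y - (y ⬝ᵥ ν) • ν) = t := by
      rintro t _ ⟨_, rfl, z, hz, rfl⟩
      have h1 : (t • ν + z) ⬝ᵥ ν = t + z ⬝ᵥ ν := by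
        rw [add_dotProduct, smul_dotProduct, hν]; simp
      have h2 : t • ν + z - (t + z ⬝ᵥ ν) • ν = z - (z ⬝ᵥ ν) • ν := by
        rw [add_smul]; abel
      simp only [h1, h2]
      rw [Set.mem_ofPred_eq] at hz
      rw [hz]; ring
    intro i j hij
    refine Set.disjoint_left.2 fun y hi hj => hij ?_
    have h := (key _ y hi).symm.trans (key _ y hj)
    have h' := inv_injective h
    exact_mod_cast add_right_cancel h'

/-- Near a boundary point the frontier lies in the graph: being in the closure of D gives one weak
inequality, and not being in the open set D gives the other. -/
theorem IsLipschitzOpen.volume_frontier {D : Set Space} (hD : IsLipschitzOpen D) :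
    volume (frontier D) = 0 := by
  refine measure_null_of_locally_null _ fun x hx => ?_
  obtain ⟨ν, hν, K, g, hg, r, hr, h⟩ := hD.2 x hx
  refine ⟨_, inter_mem_nhdsWithin _ (Metric.ball_mem_nhds x hr),
    measure_mono_null ?_ (volume_graph_eq_zero hν hg.continuous)⟩
  rintro y ⟨hy, hyr⟩
  have hdot : Continuous fun y : Space => y ⬝ᵥ ν := by unfold dotProduct; fun_prop
  have hcl : IsClosed {y : Space | g (y - (y ⬝ᵥ ν) • ν) ≤ y ⬝ᵥ ν} :=
    isClosed_le (hg.continuous.comp (continuous_id.sub (hdot.smul continuous_const))) hdot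
  have hyD : y ∉ D := fun hyD => hy.2 (by rwa [hD.1.interior_eq])
  have hyc : y ∈ closure (Metric.ball x r ∩ D) := Metric.isOpen_ball.inter_closure ⟨hyr, hy.1⟩
  refine le_antisymm (closure_minimal (fun z hz => ((h z hz.1).1 hz.2).le) hcl hyc) ?_
  exact not_lt.1 fun hlt => hyD ((h y hyr).2 hlt)

/-! ### Almost every point of the cell lies in a phase -/

section Phases

variable {M : ℕ} {D : Fin (M + 1) → Set Space} {Λ : Fin (M + 1) → Tensor4 ℝ}
  {C : Space → Tensor4 ℝ}

theorem IsPhaseStructure.ae_mem (hD : IsPhaseStructure D Λ C) :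
    ∀ᵐ x ∂(volume.restrict cell), ∃ l, x ∈ D l := by
  have h : ∀ᵐ x ∂(volume.restrict cell), ∀ l, x ∉ frontier (D l) := by
    refine ae_all_iff.2 fun l => ae_restrict_of_ae ?_
    exact measure_eq_zero_iff_ae_notMem.1 (hD.1 l).1.volume_frontier
  filter_upwards [h, ae_restrict_mem measurableSet_cell] with x hx hxc
  obtain ⟨l, hl⟩ := Set.mem_iUnion.1 (hD.2.2.1 hxc)
  refine ⟨l, by_contra fun hn => hx l ⟨hl, ?_⟩⟩
  rwa [(hD.1 l).1.1.interior_eq]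

theorem IsPhaseStructure.ae_eq (hD : IsPhaseStructure D Λ C) :
    ∀ᵐ x ∂(volume.restrict cell), ∃ l, C x = Λ l :=
  hD.ae_mem.mono fun x ⟨l, hl⟩ => ⟨l, hD.2.2.2 l x hl⟩

theorem IsPhaseStructure.aestronglyMeasurable (hD : IsPhaseStructure D Λ C) (m n p q : Fin 3) :
    AEStronglyMeasurable (fun x => C x m n p q) (volume.restrict cell) := by
  have h : Measurable fun x => ∑ l, (D l).indicator (fun _ => Λ l m n p q) x :=
    Finset.measurable_sum _ fun l _ => measurable_const.indicator (hD.1 l).1.1.measurableSet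
  refine h.aestronglyMeasurable.congr ?_
  filter_upwards [hD.ae_mem] with x ⟨l, hl⟩
  rw [hD.2.2.2 l x hl, Finset.sum_eq_single l]
  · simp [hl]
  · intro l' _ hne
    exact Set.indicator_of_notMem (fun h' => Set.disjoint_left.1 (hD.2.1 l' l hne) h' hl) _
  · simp

end Phases

/-! ### Voxels -/

theorem mem_voxel_iff {N : ℕ} (hN : 1 ≤ N) (I : Idx N) (x : Space) :
    x ∈ voxel N I ↔ ∀ m, (I m : ℝ) < N * x m ∧ N * x m < (I m : ℝ) + 1 := by
  have hN' : (0 : ℝ) < N := by exact_mod_cast hN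
  simp only [voxel, Set.mem_ofPred_eq]
  refine forall_congr' fun m => ?_
  rw [div_lt_iff₀' hN', lt_div_iff₀' hN']

theorem voxel_unique {N : ℕ} (hN : 1 ≤ N) {I J : Idx N} {x : Space} (hI : x ∈ voxel N I)
    (hJ : x ∈ voxel N J) : I = J := by
  rw [mem_voxel_iff hN] at hI hJ
  ext m
  have h1 : ((I m : ℕ) : ℝ) < (J m : ℕ) + 1 := (hI m).1.trans (hJ m).2
  have h2 : ((J m : ℕ) : ℝ) < (I m : ℕ) + 1 := (hJ m).1.trans (hI m).2
  have h1' : (I m : ℕ) < (J m : ℕ) + 1 := by exact_mod_cast h1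
  have h2' : (J m : ℕ) < (I m : ℕ) + 1 := by exact_mod_cast h2
  omega

theorem voxel_eq_pi (N : ℕ) (I : Idx N) :
    voxel N I = Set.univ.pi fun m => Set.Ioo ((I m : ℝ) / N) (((I m : ℝ) + 1) / N) := by
  ext x; simp [voxel]

theorem measurableSet_voxel (N : ℕ) (I : Idx N) : MeasurableSet (voxel N I) := by
  rw [voxel_eq_pi]; exact MeasurableSet.univ_pi fun _ => measurableSet_Ioo

theorem volume_real_voxel {N : ℕ} (I : Idx N) :
    volume.real (voxel N I) = ((N : ℝ) ^ 3)⁻¹ := by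
  rw [Measure.real, voxel_eq_pi, Real.volume_pi_Ioo, ENNReal.toReal_prod]
  have : ∀ m, (ENNReal.ofReal (((I m : ℝ) + 1) / N - (I m : ℝ) / N)).toReal = (N : ℝ)⁻¹ := by
    intro m
    rw [← sub_div, add_sub_cancel_left, one_div, ENNReal.toReal_ofReal (by positivity)]
  simp [this]

theorem voxel_subset_cell {N : ℕ} (hN : 1 ≤ N) (I : Idx N) : voxel N I ⊆ cell := by
  have hN' : (0 : ℝ) < N := by exact_mod_cast hN
  intro x hx m
  obtain ⟨h1, h2⟩ := (mem_voxel_iff hN I x).1 hx m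
  have h3 : ((I m : ℕ) : ℝ) + 1 ≤ N := by exact_mod_cast (I m).2
  constructor
  · have : 0 < N * x m := lt_of_le_of_lt (by positivity) h1
    exact pos_of_mul_pos_right this hN'.le
  · by_contra hx1
    have := mul_le_mul_of_nonneg_left (not_lt.1 hx1) hN'.le
    linarith

/-- Voxel faces have a rational coordinate. A point without rational coordinates lies in an open
voxel at every resolution, so a single null set serves all N. -/
theorem ae_mem_voxel : ∀ᵐ x ∂(volume.restrict cell), ∀ N : ℕ, 1 ≤ N → ∃ I, x ∈ voxel N I := by
  have h : ∀ᵐ x : Space, ∀ (m : Fin 3) (q : ℚ), x m ≠ q := by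
    refine ae_all_iff.2 fun m => ae_all_iff.2 fun q => ?_
    have h0 : volume {x : Space | x m = q} = 0 := by
      rw [volume_pi]; exact Measure.pi_hyperplane (fun _ : Fin 3 => (volume : Measure ℝ)) m (q : ℝ)
    exact measure_eq_zero_iff_ae_notMem.1 h0
  filter_upwards [ae_restrict_of_ae h, ae_restrict_mem measurableSet_cell] with x hx hxc N hN
  have hN' : (0 : ℝ) < N := by exact_mod_cast hN
  have hlt : ∀ m, ⌊(N : ℝ) * x m⌋₊ < N := fun m => by
    rw [Nat.floor_lt (mul_nonneg hN'.le (hxc m).1.le)]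
    exact mul_lt_of_lt_one_right hN' (hxc m).2
  refine ⟨fun m => ⟨⌊(N : ℝ) * x m⌋₊, hlt m⟩, (mem_voxel_iff hN _ x).2 fun m => ⟨?_, ?_⟩⟩
  · refine lt_of_le_of_ne (Nat.floor_le (mul_nonneg hN'.le (hxc m).1.le)) fun heq => ?_
    refine hx m ((⌊(N : ℝ) * x m⌋₊ : ℚ) / N) ?_
    push_cast
    rw [eq_div_iff hN'.ne', mul_comm]
    exact heq.symm
  · exact Nat.lt_floor_add_one _

theorem pwConst_of_mem {N : ℕ} (hN : 1 ≤ N) (Cs : Idx N → Tensor4 ℝ) {I : Idx N} {x : Space}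
    (hx : x ∈ voxel N I) : pwConst N Cs x = Cs I := by
  classical
  rw [pwConst, Finset.sum_eq_single I]
  · simp [hx]
  · intro J _ hJ
    rw [if_neg fun h => hJ (voxel_unique hN h hx)]
  · simp

/-- The scalar piecewise constant function with value `a I` in the voxel `Y_I`. -/
def pwScalar (N : ℕ) (a : Idx N → ℂ) (x : Space) : ℂ :=
  ∑ I, (voxel N I).indicator (fun _ => a I) x

theorem pwScalar_of_mem {N : ℕ} (hN : 1 ≤ N) (a : Idx N → ℂ) {I : Idx N} {x : Space}
    (hx : x ∈ voxel N I) : pwScalar N a x = a I := by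
  rw [pwScalar, Finset.sum_eq_single I]
  · simp [hx]
  · intro J _ hJ
    exact Set.indicator_of_notMem (fun h => hJ (voxel_unique hN h hx)) _
  · simp

theorem measurable_pwScalar (N : ℕ) (a : Idx N → ℂ) : Measurable (pwScalar N a) :=
  Finset.measurable_sum _ fun I _ => measurable_const.indicator (measurableSet_voxel N I)

theorem norm_pwScalar_le {N : ℕ} (hN : 1 ≤ N) {a : Idx N → ℂ} {K : ℝ} (hK : 0 ≤ K)
    (ha : ∀ I, ‖a I‖ ≤ K) (x : Space) : ‖pwScalar N a x‖ ≤ K := by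
  by_cases h : ∃ I, x ∈ voxel N I
  · obtain ⟨I, hI⟩ := h
    rw [pwScalar_of_mem hN a hI]; exact ha I
  · push Not at h
    rw [pwScalar, Finset.sum_eq_zero fun I _ => Set.indicator_of_notMem (h I) _]
    simpa using hK

/-- The bridge from grid sums to L² pairings: each voxel has volume N⁻³, so a weight on the grid may
be moved inside the integral as a piecewise constant function. -/
theorem sum_mul_average_voxel {N : ℕ} (hN : 1 ≤ N) (a : Idx N → ℂ) {F : Space → ℂ}
    (hF : Integrable F (volume.restrict cell)) :
    ((N : ℂ) ^ 3)⁻¹ * ∑ I, a I * ⨍ x in voxel N I, F x = ∫ x in cell, pwScalar N a x * F x := by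
  have hN' : (N : ℂ) ≠ 0 := by exact_mod_cast (by omega : N ≠ 0)
  have h1 : ∀ x, pwScalar N a x * F x = ∑ I, (voxel N I).indicator (fun x => a I * F x) x := by
    intro x
    rw [pwScalar, Finset.sum_mul]
    refine Finset.sum_congr rfl fun I _ => ?_
    by_cases h : x ∈ voxel N I <;> simp [h]
  simp only [h1]
  rw [integral_finsetSum]
  · rw [Finset.mul_sum]
    refine Finset.sum_congr rfl fun I _ => ?_
    rw [setIntegral_indicator (measurableSet_voxel N I),
      Set.inter_eq_self_of_subset_right (voxel_subset_cell hN I), integral_const_mul,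
      setAverage_eq, volume_real_voxel]
    rw [inv_inv, Complex.real_smul]
    push_cast
    field_simp
  · intro I _
    exact (hF.const_mul _).indicator (measurableSet_voxel N I)

/-! ### Pointwise convergence of the voxel images -/

section Convergence

variable {M : ℕ} {D : Fin (M + 1) → Set Space} {Λ : Fin (M + 1) → Tensor4 ℝ}
  {C : Space → Tensor4 ℝ} {Cs : ∀ N : ℕ, Idx N → Tensor4 ℝ}

theorem IsVoxelImage.exists_eq {N : ℕ} {Cs : Idx N → Tensor4 ℝ} (h : IsVoxelImage D Λ N Cs)
    (I : Idx N) : ∃ l, Cs I = Λ l := by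
  by_cases hl : ∃ l, voxel N I ⊆ D l
  · obtain ⟨l, hl⟩ := hl; exact ⟨l, (h I).1 l hl⟩
  · obtain ⟨l, -, hl⟩ := (h I).2 hl; exact ⟨l, hl⟩

/-- A point of an open phase has a ball inside that phase, and the voxel containing it lies in this
ball once 1/N is small. The arbitrary choice made in mixed voxels is therefore invisible in the
limit, while the voxel corner tends to the point. -/
theorem tendsto_pwScalar (hD : IsPhaseStructure D Λ C)
    (hCs : ∀ N : ℕ, 1 ≤ N → IsVoxelImage D Λ N (Cs N)) {φ : Space → ℂ} (hφ : Continuous φ)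
    (m n p q : Fin 3) :
    ∀ᵐ x ∂(volume.restrict cell), Tendsto (fun N => pwScalar N
      (fun I => φ (fun m => (I m : ℝ) / N) * (Cs N I m n p q : ℂ)) x) atTop
      (𝓝 (φ x * (C x m n p q : ℂ))) := by
  filter_upwards [hD.ae_mem, ae_mem_voxel] with x ⟨l, hl⟩ hx
  -- At N = 0 there are no voxels; shifting the index makes every resolution positive.
  rw [← tendsto_add_atTop_iff_nat 1]
  choose I hI using fun N : ℕ => hx (N + 1) (Nat.le_add_left 1 N)
  have hpos : ∀ N : ℕ, (0 : ℝ) < (N + 1 : ℕ) := fun N => by positivity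
  have hlim : Tendsto (fun N : ℕ => 1 / ((N + 1 : ℕ) : ℝ)) atTop (𝓝 0) := by
    simpa using tendsto_one_div_add_atTop_nhds_zero_nat (𝕜 := ℝ)
  -- Weak inequalities, so that the estimate covers the corner of the voxel as well as its interior
  -- points.
  have hclose : ∀ (N : ℕ) (t : ℝ) (m : Fin 3), (I N m : ℝ) ≤ (N + 1 : ℕ) * t →
      (N + 1 : ℕ) * t ≤ I N m + 1 → dist t (x m) ≤ 1 / (N + 1 : ℕ) := by
    intro N t m h1 h2
    obtain ⟨h3, h4⟩ := (mem_voxel_iff (Nat.le_add_left 1 N) _ x).1 (hI N) m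
    rw [Real.dist_eq, le_div_iff₀ (hpos N), ← abs_of_pos (hpos N), ← abs_mul, abs_le]
    constructor <;> nlinarith
  have hx0 : Tendsto (fun N : ℕ => (fun m => (I N m : ℝ) / (N + 1 : ℕ) : Space)) atTop (𝓝 x) := by
    rw [tendsto_iff_dist_tendsto_zero]
    refine squeeze_zero (fun _ => dist_nonneg) (fun N => ?_) hlim
    refine (dist_pi_le_iff (by positivity)).2 fun m => hclose N _ m ?_ ?_ <;>
      rw [mul_div_cancel₀ _ (hpos N).ne']
    linarith
  have hev : ∀ᶠ N : ℕ in atTop, voxel (N + 1) (I N) ⊆ D l := by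
    obtain ⟨r, hr, hball⟩ := Metric.isOpen_iff.1 (hD.1 l).1.1 x hl
    filter_upwards [hlim.eventually (gt_mem_nhds hr)] with N hNr y hy
    refine hball (lt_of_le_of_lt ((dist_pi_le_iff (by positivity)).2 fun m => ?_) hNr)
    obtain ⟨h1, h2⟩ := (mem_voxel_iff (Nat.le_add_left 1 N) _ y).1 hy m
    exact hclose N _ m h1.le h2.le
  refine Tendsto.congr' ?_ ((hφ.tendsto x).comp hx0 |>.mul_const (C x m n p q : ℂ))
  filter_upwards [hev] with N hv
  rw [pwScalar_of_mem (Nat.le_add_left 1 N) _ (hI N),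
    (hCs (N + 1) (Nat.le_add_left 1 N) (I N)).1 l hv, hD.2.2.2 l x hl]
  rfl

end Convergence

/-! ### The energy operator of a stiffness field -/

/-- A measurable, bounded, symmetric and uniformly coercive stiffness field. -/
structure IsStiffnessField (C : Space → Tensor4 ℝ) (a K : ℝ) : Prop where
  meas : ∀ m n p q, AEStronglyMeasurable (fun x => C x m n p q) (volume.restrict cell)
  symm : ∀ᵐ x ∂(volume.restrict cell), IsElasticSymm (C x)
  coercive : ∀ᵐ x ∂(volume.restrict cell), IsCoerciveTensor a (C x)
  bound : ∀ᵐ x ∂(volume.restrict cell), ∀ m n p q, |C x m n p q| ≤ K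
  pos : 0 < a

theorem IsPhaseStructure.isStiffnessField {M : ℕ} {D : Fin (M + 1) → Set Space}
    {Λ : Fin (M + 1) → Tensor4 ℝ} {C : Space → Tensor4 ℝ} (hD : IsPhaseStructure D Λ C) {a K : ℝ}
    (ha : 0 < a) (hsymm : ∀ l, IsElasticSymm (Λ l)) (hcoer : ∀ l, IsCoerciveTensor a (Λ l))
    (hK : ∀ l m n p q, |Λ l m n p q| ≤ K) : IsStiffnessField C a K where
  meas := hD.aestronglyMeasurable
  symm := hD.ae_eq.mono fun _ ⟨l, hl⟩ => hl ▸ hsymm l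
  coercive := hD.ae_eq.mono fun _ ⟨l, hl⟩ => hl ▸ hcoer l
  bound := hD.ae_eq.mono fun _ ⟨l, hl⟩ => hl ▸ hK l
  pos := ha

instance {𝕜 : Type*} [RCLike 𝕜] : CompleteSpace (H1 𝕜) :=
  inferInstanceAs (CompleteSpace (smoothJets 𝕜).topologicalClosure)

section Operators

variable (𝕜 : Type*) [RCLike 𝕜]

theorem IsStiffnessField.memLp_coef {C : Space → Tensor4 ℝ} {a K : ℝ} (h : IsStiffnessField C a K)
    (m n p q : Fin 3) : MemLp (fun x => (C x m n p q : 𝕜)) ⊤ (volume.restrict cell) :=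
  memLp_top_of_bound (RCLike.continuous_ofReal.comp_aestronglyMeasurable (h.meas m n p q)) K
    (h.bound.mono fun x hx => by simpa using hx m n p q)

/-- Multiplication by a bounded function. -/
def mulL {c : Space → 𝕜} (hc : MemLp c ⊤ (volume.restrict cell)) : L2 𝕜 →L[𝕜] L2 𝕜 :=
  (ContinuousLinearMap.mul 𝕜 𝕜).holderL (volume.restrict cell) ⊤ 2 2 (hc.toLp c)

theorem coeFn_mulL {c : Space → 𝕜} (hc : MemLp c ⊤ (volume.restrict cell)) (f : L2 𝕜) :
    mulL 𝕜 hc f =ᵐ[volume.restrict cell] fun x => c x * f x := by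
  refine ((ContinuousLinearMap.mul 𝕜 𝕜).coeFn_holder (r := 2) (hc.toLp c) f).trans ?_
  filter_upwards [hc.coeFn_toLp] with x hx
  simp [hx]

/-- The entry `(m, n)` of the symmetric gradient as an operator on the Sobolev space. -/
def gradL (m n : Fin 3) : H1 𝕜 →L[𝕜] L2 𝕜 := symL 𝕜 m n ∘L (H1 𝕜).subtypeL

variable {𝕜} in
theorem coeFn_gradL (u : H1 𝕜) (m n : Fin 3) :
    gradL 𝕜 m n u =ᵐ[volume.restrict cell] fun x => symGrad u x m n := coeFn_symL u m n

/-- The constant function `1`. -/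
def oneL2 : L2 𝕜 := (memLp_const (1 : 𝕜)).toLp _

/-- The mean value of the component `j`. -/
def meanL (j : Fin 3) : H1 𝕜 →L[𝕜] 𝕜 := innerSL 𝕜 (oneL2 𝕜) ∘L entryL 𝕜 (j, none) ∘L (H1 𝕜).subtypeL

variable {𝕜} in
theorem meanL_apply (u : H1 𝕜) (j : Fin 3) : meanL 𝕜 j u = ∫ x in cell, comp u j x := by
  change inner 𝕜 (oneL2 𝕜) ((u : Jet 𝕜) (j, none)) = _
  rw [L2.inner_def]
  refine integral_congr_ae ?_
  filter_upwards [(memLp_const (μ := volume.restrict cell) (p := 2) (1 : 𝕜)).coeFn_toLp] with x hx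
  have hx' : (oneL2 𝕜 : Space → 𝕜) x = 1 := hx
  rw [hx', RCLike.inner_apply, map_one, mul_one]
  rfl

variable {C : Space → Tensor4 ℝ} {a K : ℝ} (h : IsStiffnessField C a K)

/-- The entry `(m, n)` of the stress. -/
def stressL (m n : Fin 3) : H1 𝕜 →L[𝕜] L2 𝕜 :=
  ∑ p, ∑ q, mulL 𝕜 (h.memLp_coef 𝕜 m n p q) ∘L gradL 𝕜 p q

variable {𝕜} in
theorem coeFn_finset_sum {ι : Type*} (s : Finset ι) (f : ι → L2 𝕜) :
    ((∑ i ∈ s, f i : L2 𝕜) : Space → 𝕜) =ᵐ[volume.restrict cell] fun x => ∑ i ∈ s, f i x :=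
  (Lp.coeFn_finsetSum s f).trans (Eventually.of_forall fun x => by simp)

variable {𝕜} in
theorem coeFn_stressL (u : H1 𝕜) (m n : Fin 3) :
    stressL 𝕜 h m n u =ᵐ[volume.restrict cell]
      fun x => ddot (castT 𝕜 (C x)) (symGrad u x) m n := by
  have h1 : stressL 𝕜 h m n u = ∑ p, ∑ q, mulL 𝕜 (h.memLp_coef 𝕜 m n p q) (gradL 𝕜 p q u) := by
    simp [stressL]
  have h2 : ∀ᵐ x ∂(volume.restrict cell), ∀ p q,
      (mulL 𝕜 (h.memLp_coef 𝕜 m n p q) (gradL 𝕜 p q u) : Space → 𝕜) x =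
        (C x m n p q : 𝕜) * symGrad u x p q := by
    refine ae_all_iff.2 fun p => ae_all_iff.2 fun q => ?_
    filter_upwards [coeFn_mulL 𝕜 (h.memLp_coef 𝕜 m n p q) (gradL 𝕜 p q u), coeFn_gradL u p q]
      with x hx hx'
    rw [hx, hx']
  have h3 : ∀ᵐ x ∂(volume.restrict cell), ∀ p,
      ((∑ q, mulL 𝕜 (h.memLp_coef 𝕜 m n p q) (gradL 𝕜 p q u) : L2 𝕜) : Space → 𝕜) x =
        ∑ q, (mulL 𝕜 (h.memLp_coef 𝕜 m n p q) (gradL 𝕜 p q u) : Space → 𝕜) x :=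
    ae_all_iff.2 fun p => coeFn_finset_sum _ _
  rw [h1]
  filter_upwards [h2, h3, coeFn_finset_sum Finset.univ
    (fun p => ∑ q, mulL 𝕜 (h.memLp_coef 𝕜 m n p q) (gradL 𝕜 p q u))] with x hx hx' hx''
  rw [hx'']
  simp only [hx', hx, ddot, castT]

/-- The operator of the energy form, augmented by the mean values. -/
def energyL : H1 𝕜 →L[𝕜] H1 𝕜 :=
  (∑ m, ∑ n, (gradL 𝕜 m n).adjoint ∘L stressL 𝕜 h m n) + ∑ j, (meanL 𝕜 j).adjoint ∘L meanL 𝕜 j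

variable {𝕜} in
theorem inner_energyL (v u : H1 𝕜) :
    inner 𝕜 v (energyL 𝕜 h u) = (∑ m, ∑ n, inner 𝕜 (gradL 𝕜 m n v) (stressL 𝕜 h m n u)) +
      ∑ j, star (meanL 𝕜 j v) * meanL 𝕜 j u := by
  simp only [energyL, add_apply, sum_apply, ContinuousLinearMap.comp_apply, inner_add_right,
    inner_sum, ContinuousLinearMap.adjoint_inner_right, RCLike.inner_apply, RCLike.star_def]
  simp only [mul_comm]

variable {𝕜} in
theorem sum_inner_eq_integral (f g : Fin 3 → Fin 3 → L2 𝕜) :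
    ∑ m, ∑ n, inner 𝕜 (f m n) (g m n) =
      ∫ x in cell, ∑ m, ∑ n, star ((f m n : Space → 𝕜) x) * (g m n : Space → 𝕜) x := by
  have hi : ∀ m n, Integrable (fun x => star ((f m n : Space → 𝕜) x) * (g m n : Space → 𝕜) x)
      (volume.restrict cell) := fun m n =>
    (L2.integrable_inner (𝕜 := 𝕜) (f m n) (g m n)).congr
      (Eventually.of_forall fun x => by simp [RCLike.inner_apply, mul_comm])
  rw [integral_finsetSum _ fun m _ => integrable_finsetSum _ fun n _ => hi m n]
  refine Finset.sum_congr rfl fun m _ => ?_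
  rw [integral_finsetSum _ fun n _ => hi m n]
  refine Finset.sum_congr rfl fun n _ => ?_
  rw [L2.inner_def]
  exact integral_congr_ae (Eventually.of_forall fun x => by simp [RCLike.inner_apply, mul_comm])

variable {𝕜} in
theorem re_sum_inner_stressL (u : H1 𝕜) :
    a * ∑ m, ∑ n, ‖gradL 𝕜 m n u‖ ^ 2 ≤
      RCLike.re (∑ m, ∑ n, inner 𝕜 (gradL 𝕜 m n u) (stressL 𝕜 h m n u)) := by
  have h1 : (((∑ m, ∑ n, ‖gradL 𝕜 m n u‖ ^ 2 : ℝ)) : 𝕜) =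
      ∑ m, ∑ n, inner 𝕜 (gradL 𝕜 m n u) (gradL 𝕜 m n u) := by
    push_cast
    simp only [inner_self_eq_norm_sq_to_K]
  have hint : ∀ f g : Fin 3 → Fin 3 → L2 𝕜, Integrable (fun x => ∑ m, ∑ n,
      star ((f m n : Space → 𝕜) x) * (g m n : Space → 𝕜) x) (volume.restrict cell) := fun f g =>
    integrable_finsetSum _ fun m _ => integrable_finsetSum _ fun n _ =>
      (L2.integrable_inner (𝕜 := 𝕜) (f m n) (g m n)).congr
        (Eventually.of_forall fun x => by simp [RCLike.inner_apply, mul_comm])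
  have h2 : (∑ m, ∑ n, ‖gradL 𝕜 m n u‖ ^ 2 : ℝ) = ∫ x in cell, RCLike.re (∑ m, ∑ n,
      star ((gradL 𝕜 m n u : Space → 𝕜) x) * (gradL 𝕜 m n u : Space → 𝕜) x) := by
    rw [integral_re (hint _ _), ← sum_inner_eq_integral, ← h1, RCLike.ofReal_re]
  rw [h2, sum_inner_eq_integral, ← integral_re (hint _ _), ← integral_const_mul]
  refine integral_mono_ae ((hint _ _).re.const_mul a) (hint _ _).re ?_
  have h3 : ∀ᵐ x ∂(volume.restrict cell), ∀ m n, (gradL 𝕜 m n u : Space → 𝕜) x = symGrad u x m n :=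
    ae_all_iff.2 fun m => ae_all_iff.2 fun n => coeFn_gradL u m n
  have h4 : ∀ᵐ x ∂(volume.restrict cell), ∀ m n, (stressL 𝕜 h m n u : Space → 𝕜) x =
      ddot (castT 𝕜 (C x)) (symGrad u x) m n :=
    ae_all_iff.2 fun m => ae_all_iff.2 fun n => coeFn_stressL h u m n
  filter_upwards [h3, h4, h.coercive] with x h3 h4 hx
  have hs : (symGrad u x).IsSymm := Matrix.IsSymm.ext fun i j => by
    simp only [symGrad, add_comm]
  have := hx.hermitian hs
  simp only [h3, h4]
  refine le_trans (le_of_eq ?_) this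
  congr 1
  simp only [map_sum, RCLike.star_def, RCLike.conj_mul]
  simp only [← RCLike.ofReal_pow, RCLike.ofReal_re]

end Operators

/-- The energy alone does not see constant fields. With the mean value term added, the form controls
both sides of `korn_poincare_real` and is coercive on the whole Sobolev space, so no mean-zero
subspace is needed. The 4 in the constant is the Korn constant. -/
theorem energyL_coercive_real {C : Space → Tensor4 ℝ} {a K : ℝ} (h : IsStiffnessField C a K) :
    ∃ c : ℝ, 0 < c ∧ ∀ u : H1 ℝ, c * ‖u‖ ^ 2 ≤ inner ℝ u (energyL ℝ h u) := by
  have hc : 0 < min a 1 := lt_min h.pos one_pos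
  refine ⟨min a 1 / 4, by positivity, fun u => ?_⟩
  have h1 := korn_poincare_real u
  have h2 := re_sum_inner_stressL h u
  have h3 : ∑ m, ∑ n, ‖gradL ℝ m n u‖ ^ 2 = ∑ m, ∑ n, ‖symL ℝ m n (u : Jet ℝ)‖ ^ 2 := rfl
  have h4 : ∑ j, star (meanL ℝ j u) * meanL ℝ j u = ∑ j, (∫ x in cell, comp u j x) ^ 2 := by
    refine Finset.sum_congr rfl fun j _ => ?_
    rw [meanL_apply, star_trivial, sq]
  rw [inner_energyL, h4]
  rw [RCLike.re_to_real] at h2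
  have h5 : 0 ≤ ∑ m, ∑ n, ‖gradL ℝ m n u‖ ^ 2 := by positivity
  have h6 : 0 ≤ ∑ j, (∫ x in cell, comp u j x) ^ 2 := by positivity
  rw [← h3] at h1
  have h7 := mul_le_mul_of_nonneg_right (min_le_left a 1) h5
  have h8 := mul_le_mul_of_nonneg_right (min_le_right a 1) h6
  have h9 := mul_le_mul_of_nonneg_left h1 hc.le
  nlinarith

/-- Pairing with u itself kills both the symmetric gradient and the means. In the weak limit this
injectivity supplies a dense set of test vectors. -/
theorem energyL_injective_complex {C : Space → Tensor4 ℝ} {a K : ℝ} (h : IsStiffnessField C a K)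
    {u : H1 ℂ} (hu : energyL ℂ h u = 0) : u = 0 := by
  have h0 : inner ℂ u (energyL ℂ h u) = 0 := by rw [hu, inner_zero_right]
  rw [inner_energyL] at h0
  have h1 := korn_poincare u
  have h2 := re_sum_inner_stressL h u
  have h3 : ∑ m, ∑ n, ‖gradL ℂ m n u‖ ^ 2 = ∑ m, ∑ n, ‖symL ℂ m n (u : Jet ℂ)‖ ^ 2 := rfl
  have h4 : RCLike.re (∑ j, star (meanL ℂ j u) * meanL ℂ j u) = ∑ j, ‖fcoef (comp u j) 0‖ ^ 2 := by
    rw [map_sum]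
    refine Finset.sum_congr rfl fun j _ => ?_
    rw [meanL_apply, fcoef_zero, RCLike.star_def, RCLike.conj_mul, ← RCLike.ofReal_pow,
      RCLike.ofReal_re]
  have h0' := congrArg RCLike.re h0
  rw [map_add, h4, map_zero] at h0'
  have h5 : 0 ≤ ∑ m, ∑ n, ‖gradL ℂ m n u‖ ^ 2 := by positivity
  have h6 : 0 ≤ ∑ j, ‖fcoef (comp u j) 0‖ ^ 2 := by positivity
  have h7 := mul_nonneg h.pos.le h5
  have h8 : ∑ m, ∑ n, ‖gradL ℂ m n u‖ ^ 2 = 0 := by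
    have : a * ∑ m, ∑ n, ‖gradL ℂ m n u‖ ^ 2 = 0 := by linarith
    exact (mul_eq_zero.1 this).resolve_left h.pos.ne'
  rw [← h3, h8] at h1
  have h9 : ‖u‖ ^ 2 ≤ 0 := by linarith
  exact norm_eq_zero.1 (pow_eq_zero_iff two_ne_zero |>.1 (le_antisymm h9 (sq_nonneg _)))

/-! ### Fields with one smooth component -/

section ScalarField

variable {𝕜 : Type*} [RCLike 𝕜]

theorem memLp_of_continuous {f : Space → 𝕜} (hf : Continuous f) :
    MemLp f 2 (volume.restrict cell) := by
  obtain ⟨B, hB⟩ := (isCompact_Icc (a := (0 : Space)) (b := 1)).exists_bound_of_continuousOn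
    hf.continuousOn
  refine MemLp.of_bound hf.aestronglyMeasurable B ?_
  filter_upwards [ae_restrict_mem measurableSet_cell] with x hx
  exact hB x ⟨fun i => (hx i).1.le, fun i => (hx i).2.le⟩

/-- The vector field `x ↦ f x • b_j`. -/
def scalarField {f : Space → 𝕜} (hf : IsSmoothPeriodic f) (j : Fin 3) : H1 𝕜 :=
  ⟨WithLp.toLp 2 fun i => if i.1 = j then
      match i.2 with
      | none => (memLp_of_continuous hf.1.continuous).toLp f
      | some m => (memLp_of_continuous (continuous_pderiv hf.1 m)).toLp (pderiv m f)
    else 0, by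
    refine Submodule.le_topologicalClosure _ ⟨fun k => if k = j then f else 0,
      fun k => ?_, fun k => ?_, fun k m => ?_⟩
    · dsimp only
      split_ifs
      · exact hf
      · exact ⟨contDiff_const, fun _ _ => rfl⟩
    · dsimp only
      split_ifs
      · exact MemLp.coeFn_toLp _
      · exact Lp.coeFn_zero 𝕜 2 _
    · dsimp only
      split_ifs
      · exact MemLp.coeFn_toLp _
      · refine (Lp.coeFn_zero 𝕜 2 _).trans (Eventually.of_forall fun x => ?_)
        simp [pderiv]⟩

theorem symGrad_scalarField {f : Space → 𝕜} (hf : IsSmoothPeriodic f) (j : Fin 3) :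
    ∀ᵐ x ∂(volume.restrict cell), ∀ m n, symGrad (scalarField hf j) x m n =
      ((if n = j then pderiv m f x else 0) + if m = j then pderiv n f x else 0) / 2 := by
  have h : ∀ m n, grad (scalarField hf j) m n =ᵐ[volume.restrict cell]
      fun x => if n = j then pderiv m f x else 0 := by
    intro m n
    simp only [grad, scalarField]
    split_ifs
    · exact MemLp.coeFn_toLp _
    · exact Lp.coeFn_zero 𝕜 2 _
  have h' := ae_all_iff.2 fun m => ae_all_iff.2 fun n => h m n
  filter_upwards [h'] with x hx m n
  simp only [symGrad, hx]

theorem meanL_scalarField {f : Space → 𝕜} (hf : IsSmoothPeriodic f) (i j : Fin 3) :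
    meanL 𝕜 i (scalarField hf j) = if i = j then ∫ x in cell, f x else 0 := by
  rw [meanL_apply]
  simp only [comp, scalarField]
  split_ifs
  · exact integral_congr_ae (MemLp.coeFn_toLp _)
  · rw [integral_congr_ae (Lp.coeFn_zero 𝕜 2 _)]; simp

/-- Symmetry of S makes both halves of the symmetrized gradient contribute equally. With d a
gradient, this turns the weak equation tested with f b_j into row j of the divergence. -/
theorem sum_pairing_single (d : Fin 3 → 𝕜) {S : Fin 3 → Fin 3 → 𝕜} (hS : ∀ m n, S m n = S n m)
    (j : Fin 3) :
    ∑ m, ∑ n, (((if n = j then d m else 0) + if m = j then d n else 0) / 2) * S m n =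
      ∑ m, d m * S m j := by
  have h1 : ∀ m n, (((if n = j then d m else 0) + if m = j then d n else 0) / 2) * S m n =
      (if n = j then d m * S m n / 2 else 0) + if m = j then d n * S m n / 2 else 0 := by
    intro m n; split_ifs <;> ring
  simp only [h1, Finset.sum_add_distrib, Finset.sum_ite_eq', Finset.mem_univ, if_true]
  rw [Finset.sum_comm]
  simp only [Finset.sum_ite_eq', Finset.mem_univ, if_true]
  rw [← Finset.sum_add_distrib]
  refine Finset.sum_congr rfl fun m _ => ?_
  rw [hS j m]; ring

end ScalarField

/-! ### The cell problem -/

section CellProblem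

variable {C : Space → Tensor4 ℝ} {a K : ℝ} (h : IsStiffnessField C a K)

theorem IsStiffnessField.memLp_load (h : IsStiffnessField C a K) (𝕜 : Type*) [RCLike 𝕜] (E : Mat 𝕜) (m n : Fin 3) :
    MemLp (fun x => ddot (castT 𝕜 (C x)) E m n) 2 (volume.restrict cell) :=
  memLp_finsetSum _ fun p _ => memLp_finsetSum _ fun q _ =>
    ((h.memLp_coef 𝕜 m n p q).mono_exponent le_top).mul_const (E p q)

/-- The stress due to a constant strain. -/
def loadL2 (E : Mat ℝ) (m n : Fin 3) : L2 ℝ := (h.memLp_load ℝ E m n).toLp _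

theorem integral_mdot_stress (v u : H1 ℝ) :
    ∫ x in cell, mdot (symGrad v x) (ddot (C x) (symGrad u x)) =
      ∑ m, ∑ n, inner ℝ (gradL ℝ m n v) (stressL ℝ h m n u) := by
  rw [sum_inner_eq_integral]
  refine integral_congr_ae ?_
  filter_upwards [ae_all_iff.2 fun m => ae_all_iff.2 fun n => coeFn_gradL v m n,
    ae_all_iff.2 fun m => ae_all_iff.2 fun n => coeFn_stressL h u m n] with x h1 h2
  simp only [h1, h2, mdot, castT_real, star_trivial]

theorem integral_mdot_load (v : H1 ℝ) (E : Mat ℝ) :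
    ∫ x in cell, mdot (symGrad v x) (ddot (C x) E) =
      ∑ m, ∑ n, inner ℝ (gradL ℝ m n v) (loadL2 h E m n) := by
  rw [sum_inner_eq_integral]
  refine integral_congr_ae ?_
  filter_upwards [ae_all_iff.2 fun m => ae_all_iff.2 fun n => coeFn_gradL v m n,
    ae_all_iff.2 fun m => ae_all_iff.2 fun n => (h.memLp_load ℝ E m n).coeFn_toLp] with x h1 h2
  have h2' : ∀ m n, (loadL2 h E m n : Space → ℝ) x = ddot (castT ℝ (C x)) E m n := h2
  simp only [h1, h2', mdot, castT_real, star_trivial]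

/-- The right-hand side of the cell problem. -/
def cellRhs (E : Mat ℝ) : H1 ℝ := -∑ m, ∑ n, (gradL ℝ m n).adjoint (loadL2 h E m n)

theorem inner_cellRhs (v : H1 ℝ) (E : Mat ℝ) :
    inner ℝ v (cellRhs h E) = -∫ x in cell, mdot (symGrad v x) (ddot (C x) E) := by
  simp only [cellRhs, inner_neg_right, inner_sum, ContinuousLinearMap.adjoint_inner_right,
    integral_mdot_load h]

theorem isCellSolution_iff (E : Mat ℝ) (u : H1 ℝ) :
    IsCellSolution C E u ↔ energyL ℝ h u = cellRhs h E := by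
  constructor
  · rintro ⟨h0, h1⟩
    refine ext_inner_left ℝ fun v => ?_
    rw [inner_energyL, inner_cellRhs, ← h1 v, integral_mdot_stress h]
    simp [meanL_apply, h0 _]
  · intro hu
    have key : ∀ v, (∑ m, ∑ n, inner ℝ (gradL ℝ m n v) (stressL ℝ h m n u)) +
        ∑ j, star (meanL ℝ j v) * meanL ℝ j u =
        -∑ m, ∑ n, inner ℝ (gradL ℝ m n v) (loadL2 h E m n) := fun v => by
      rw [← inner_energyL, hu, inner_cellRhs, integral_mdot_load h]
    have h0 : MeanZero u := by
      intro j
      -- The constant field b_j has no strain, so testing with it isolates the mean of component j.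
      have h1 : IsSmoothPeriodic (fun _ : Space => (1 : ℝ)) := ⟨contDiff_const, fun _ _ => rfl⟩
      have hg : ∀ m n, gradL ℝ m n (scalarField h1 j) = 0 := by
        intro m n
        refine Lp.ext ((coeFn_gradL _ m n).trans (EventuallyEq.trans ?_ (Lp.coeFn_zero ℝ 2 _).symm))
        filter_upwards [symGrad_scalarField h1 j] with x hx
        rw [hx]; simp [pderiv]
      have := key (scalarField h1 j)
      rw [← meanL_apply]
      simpa [hg, meanL_scalarField, volume_cell, Measure.real] using this
    refine ⟨h0, fun v => ?_⟩
    rw [integral_mdot_stress h, integral_mdot_load h, ← key v]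
    simp [meanL_apply, h0 _]

theorem existsUnique_isCellSolution (h : IsStiffnessField C a K) (E : Mat ℝ) : ∃! u : H1 ℝ, IsCellSolution C E u := by
  obtain ⟨c, hc, hcoer⟩ := energyL_coercive_real h
  simp only [isCellSolution_iff h]
  let B : H1 ℝ →L[ℝ] H1 ℝ →L[ℝ] ℝ := innerSL ℝ ∘L energyL ℝ h
  have hB : IsCoercive B := ⟨c, hc, fun u => by
    have := hcoer u
    rw [real_inner_comm, sq, ← mul_assoc] at this
    exact this⟩
  refine ⟨hB.continuousLinearEquivOfBilin.symm (cellRhs h E), ?_, fun u hu => ?_⟩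
  · refine ext_inner_right ℝ fun v => ?_
    have := hB.continuousLinearEquivOfBilin_apply
      (hB.continuousLinearEquivOfBilin.symm (cellRhs h E)) v
    rw [ContinuousLinearEquiv.apply_symm_apply] at this
    exact this.symm
  · rw [ContinuousLinearEquiv.eq_symm_apply]
    refine ext_inner_right ℝ fun v => ?_
    rw [hB.continuousLinearEquivOfBilin_apply]
    exact congrArg (fun w => inner ℝ w v) hu

end CellProblem

/-! ### The discrete Fourier transform -/

/-- The corner of the voxel `Y_I`. -/
def gridPt {N : ℕ} (I : Idx N) : Space := fun m => (I m : ℝ) / N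

theorem mem_freqs {N : ℕ} {ξ : Freq} :
    ξ ∈ freqs N ↔ ∀ m, -(N : ℤ) ≤ 2 * ξ m ∧ 2 * ξ m < N := by
  simp only [freqs, Fintype.mem_piFinset, Finset.mem_filter, Finset.mem_Icc]
  exact forall_congr' fun m => ⟨fun h => h.2, fun h => ⟨by omega, h⟩⟩

theorem mem_freqsMinus {N : ℕ} {ξ : Freq} :
    ξ ∈ freqsMinus N ↔ ∀ m, -(N : ℤ) < 2 * ξ m ∧ 2 * ξ m < N := by
  simp only [freqsMinus, Fintype.mem_piFinset, Finset.mem_filter, Finset.mem_Icc]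
  exact forall_congr' fun m => ⟨fun h => h.2, fun h => ⟨by omega, h⟩⟩

theorem freqsMinus_subset (N : ℕ) : freqsMinus N ⊆ freqs N := fun _ hξ =>
  mem_freqs.2 fun m => ⟨(mem_freqsMinus.1 hξ m).1.le, (mem_freqsMinus.1 hξ m).2⟩

theorem neg_mem_freqsMinus {N : ℕ} {ξ : Freq} (h : ξ ∈ freqsMinus N) : -ξ ∈ freqsMinus N :=
  mem_freqsMinus.2 fun m => by
    have := mem_freqsMinus.1 h m
    simp only [Pi.neg_apply]; omega

theorem zero_mem_freqsMinus {N : ℕ} (hN : 1 ≤ N) : (0 : Freq) ∈ freqsMinus N :=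
  mem_freqsMinus.2 fun m => by simp only [Pi.zero_apply]; omega

theorem card_freqs (N : ℕ) : (freqs N).card = N ^ 3 := by
  have h : (Finset.Icc (-(N : ℤ)) N).filter (fun k => -(N : ℤ) ≤ 2 * k ∧ 2 * k < N) =
      Finset.Ico (-((N : ℤ) / 2)) ((N : ℤ) - (N : ℤ) / 2) := by
    ext k; simp only [Finset.mem_filter, Finset.mem_Icc, Finset.mem_Ico]; omega
  rw [freqs, Fintype.card_piFinset, h]
  simp

/-- A geometric sum of N-th roots of unity. The range of k contains 0 as its only multiple of N, so
otherwise the ratio is not 1. -/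
theorem sum_exp_grid {N : ℕ} (hN : 1 ≤ N) {k : ℤ} (h1 : -(N : ℤ) < k) (h2 : k < N) :
    ∑ i : Fin N, Complex.exp (2 * Real.pi * Complex.I * (k * ((i : ℝ) / N : ℝ))) =
      if k = 0 then (N : ℂ) else 0 := by
  have hN' : (N : ℂ) ≠ 0 := by exact_mod_cast (by omega : N ≠ 0)
  have hpi : 2 * (Real.pi : ℂ) * Complex.I ≠ 0 := Complex.two_pi_I_ne_zero
  split_ifs with hk
  · simp [hk]
  · have h3 : ∀ i : Fin N, Complex.exp (2 * Real.pi * Complex.I * (k * ((i : ℝ) / N : ℝ))) =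
        Complex.exp (2 * Real.pi * Complex.I * (k / N)) ^ (i : ℕ) := by
      intro i
      rw [← Complex.exp_nat_mul]
      congr 1
      push_cast
      field_simp
    simp only [h3]
    rw [Fin.sum_univ_eq_sum_range (fun i => Complex.exp (2 * Real.pi * Complex.I * (k / N)) ^ i),
      geom_sum_eq]
    · rw [← Complex.exp_nat_mul]
      have : (N : ℂ) * (2 * Real.pi * Complex.I * (k / N)) = k * (2 * Real.pi * Complex.I) := by
        field_simp
      rw [this, Complex.exp_int_mul_two_pi_mul_I, sub_self, zero_div]
    · intro h
      obtain ⟨n, hn⟩ := Complex.exp_eq_one_iff.1 h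
      rw [mul_comm, mul_eq_mul_right_iff] at hn
      have hn' := hn.resolve_right hpi
      rw [div_eq_iff hN'] at hn'
      have hkn : k = n * N := by exact_mod_cast hn'
      rcases lt_trichotomy n 0 with h0 | h0 | h0
      · nlinarith
      · simp [h0] at hkn; exact hk hkn
      · nlinarith

theorem sum_expo_gridPt {N : ℕ} (hN : 1 ≤ N) {ξ η : Freq} (hξ : ξ ∈ freqs N) (hη : η ∈ freqs N) :
    ∑ I : Idx N, expo (ξ - η) (gridPt I) = if ξ = η then (N : ℂ) ^ 3 else 0 := by
  simp only [expo_eq_prod, gridPt]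
  have h := Finset.prod_univ_sum (fun _ : Fin 3 => (Finset.univ : Finset (Fin N)))
    (fun m i => Complex.exp (2 * Real.pi * Complex.I * (((ξ - η) m : ℤ) * ((i : ℝ) / N : ℝ))))
  rw [Fintype.piFinset_univ] at h
  rw [← h]
  have h1 : ∀ m, ∑ i : Fin N,
      Complex.exp (2 * Real.pi * Complex.I * (((ξ - η) m : ℤ) * ((i : ℝ) / N : ℝ))) =
      if (ξ - η) m = 0 then (N : ℂ) else 0 := by
    intro m
    have a1 := mem_freqs.1 hξ m
    have a2 := mem_freqs.1 hη m
    exact sum_exp_grid hN (by simp only [Pi.sub_apply]; omega) (by simp only [Pi.sub_apply]; omega)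
  simp only [h1]
  split_ifs with heq
  · subst heq; simp
  · obtain ⟨m, hm⟩ := Function.ne_iff.mp heq
    exact Finset.prod_eq_zero (Finset.mem_univ m) (if_neg (by simpa [sub_eq_zero] using hm))

theorem dft_eq {N : ℕ} (f : Idx N → ℂ) (ξ : Freq) :
    dft f ξ = ((N : ℂ) ^ 3)⁻¹ * ∑ I, f I * expo (-ξ) (gridPt I) := rfl

theorem dft_add {N : ℕ} (f g : Idx N → ℂ) (ξ : Freq) :
    dft (fun I => f I + g I) ξ = dft f ξ + dft g ξ := by
  simp [dft_eq, add_mul, Finset.sum_add_distrib, mul_add]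

theorem dft_const_mul {N : ℕ} (c : ℂ) (f : Idx N → ℂ) (ξ : Freq) :
    dft (fun I => c * f I) ξ = c * dft f ξ := by
  simp only [dft_eq, mul_assoc, ← Finset.mul_sum]
  ring

theorem dft_sum {N : ℕ} {ι : Type*} (s : Finset ι) (f : ι → Idx N → ℂ) (ξ : Freq) :
    dft (fun I => ∑ i ∈ s, f i I) ξ = ∑ i ∈ s, dft (f i) ξ := by
  simp only [dft_eq, Finset.sum_mul, ← Finset.mul_sum]
  rw [Finset.sum_comm]

theorem dft_star {N : ℕ} (f : Idx N → ℂ) (ξ : Freq) :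
    dft (fun I => star (f I)) ξ = star (dft f (-ξ)) := by
  simp only [dft_eq, star_mul', star_sum, neg_neg, expo_neg]
  congr 1
  simp

theorem dft_expo {N : ℕ} (hN : 1 ≤ N) {ξ η : Freq} (hξ : ξ ∈ freqs N) (hη : η ∈ freqs N) :
    dft (fun I : Idx N => expo ξ (gridPt I)) η = if ξ = η then 1 else 0 := by
  have hN' : (N : ℂ) ≠ 0 := by exact_mod_cast (by omega : N ≠ 0)
  simp only [dft_eq, ← expo_add, ← sub_eq_add_neg, sum_expo_gridPt hN hξ hη]
  split_ifs <;> simp [hN']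

theorem dft_trig {N : ℕ} (hN : 1 ≤ N) {s : Finset Freq} (hs : s ⊆ freqs N) (c : Freq → ℂ)
    {η : Freq} (hη : η ∈ freqs N) :
    dft (fun I : Idx N => ∑ ξ ∈ s, c ξ * expo ξ (gridPt I)) η = if η ∈ s then c η else 0 := by
  classical
  rw [dft_sum, ← Finset.sum_ite_eq' s η c]
  refine Finset.sum_congr rfl fun ξ hξ => ?_
  rw [dft_const_mul, dft_expo hN (hs hξ) hη]
  simp

theorem dft_inversion {N : ℕ} (hN : 1 ≤ N) (f : Idx N → ℂ) (I : Idx N) :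
    f I = ∑ ξ ∈ freqs N, dft f ξ * expo ξ (gridPt I) := by
  classical
  have hN' : (N : ℂ) ≠ 0 := by exact_mod_cast (by omega : N ≠ 0)
  let U : Matrix (freqs N) (Idx N) ℂ := fun ξ I => ((N : ℂ) ^ 3)⁻¹ * expo (-ξ.1) (gridPt I)
  let V : Matrix (Idx N) (freqs N) ℂ := fun I ξ => expo ξ.1 (gridPt I)
  have hUV : U * V = 1 := by
    ext ξ η
    have h := dft_expo hN η.2 ξ.2
    rw [dft_eq, Finset.mul_sum] at h
    rw [Matrix.mul_apply, Matrix.one_apply]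
    have h' : (if (ξ : freqs N) = η then (1 : ℂ) else 0) = if η.1 = ξ.1 then 1 else 0 := by
      simp only [Subtype.ext_iff, eq_comm]
    rw [h', ← h]
    refine Finset.sum_congr rfl fun I _ => ?_
    simp only [U, V]; ring
  have hcard : Fintype.card (freqs N) = Fintype.card (Idx N) := by
    rw [Fintype.card_coe, card_freqs]; simp
  -- Orthogonality of the exponentials is UV = 1; as frequencies and grid points are equally many,
  -- the one-sided inverse is two-sided, which is inversion.
  have hVU : V * U = 1 := (Matrix.mul_eq_one_comm_of_card_eq _ _ _ hcard).1 hUV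
  have h1 : f I = ((V * U).mulVec f) I := by rw [hVU, Matrix.one_mulVec]
  rw [h1, ← Matrix.mulVec_mulVec, Matrix.mulVec, dotProduct, ← Finset.sum_coe_sort (freqs N)]
  refine Finset.sum_congr rfl fun ξ _ => ?_
  rw [dft_eq, Matrix.mulVec, dotProduct, Finset.mul_sum, Finset.mul_sum, Finset.sum_mul]
  refine Finset.sum_congr rfl fun J _ => ?_
  simp only [U, V]; ring

theorem sum_star_trig_mul {N : ℕ} (s : Finset Freq) (c : Freq → ℂ) (g : Idx N → ℂ) :
    ((N : ℂ) ^ 3)⁻¹ * ∑ I, star (∑ ξ ∈ s, c ξ * expo ξ (gridPt I)) * g I =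
      ∑ ξ ∈ s, star (c ξ) * dft g ξ := by
  simp only [star_sum, star_mul', ← expo_neg, Finset.sum_mul, dft_eq]
  rw [Finset.sum_comm, Finset.mul_sum]
  refine Finset.sum_congr rfl fun ξ _ => ?_
  simp only [Finset.mul_sum]
  refine Finset.sum_congr rfl fun I _ => ?_
  ring

/-! ### Symmetric products with symbols -/

/-- The symmetrized tensor product `k ⊗ˢ a`. -/
def symProd (k a : Fin 3 → ℂ) : Mat ℂ := fun m n => (k m * a n + k n * a m) / 2

theorem symProd_symm (k a : Fin 3 → ℂ) (m n : Fin 3) : symProd k a m n = symProd k a n m := by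
  simp only [symProd, add_comm]

theorem symProd_smul_left (c : ℂ) (k a : Fin 3 → ℂ) (m n : Fin 3) :
    symProd (fun j => c * k j) a m n = c * symProd k a m n := by
  simp only [symProd]; ring

theorem symProd_smul_right (c : ℂ) (k a : Fin 3 → ℂ) (m n : Fin 3) :
    symProd k (fun j => c * a j) m n = c * symProd k a m n := by
  simp only [symProd]; ring

theorem sum_star_symProd_mul (k a : Fin 3 → ℂ) {S : Mat ℂ} (hS : ∀ m n, S m n = S n m) :
    ∑ m, ∑ n, star (symProd k a m n) * S m n = ∑ j, star (a j) * ∑ m, star (k m) * S m j := by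
  simp only [symProd, star_div₀, star_add, star_mul', Fin.sum_univ_three, star_ofNat,
    hS 1 0, hS 2 0, hS 2 1]
  ring

/-- The tangent symbol of the scheme. -/
def tanSymbol (N : ℕ) (ξ : Freq) (m : Fin 3) : ℝ := Real.tan (Real.pi * ξ m / N)

theorem tanSymbol_neg (N : ℕ) (ξ : Freq) (m : Fin 3) : tanSymbol N (-ξ) m = -tanSymbol N ξ m := by
  rw [tanSymbol, tanSymbol, ← Real.tan_neg]
  congr 1
  push_cast [Pi.neg_apply]
  ring

/-- The complex version of the tangent symbol. -/
def tanC (N : ℕ) (ξ : Freq) (m : Fin 3) : ℂ := (tanSymbol N ξ m : ℂ)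

/-- Here the removal of the frequencies with ξ_m = −N/2 pays off: the angle stays strictly inside
(−π/2, π/2), where the tangent is finite and dominates its argument. -/
theorem angle_bounds {N : ℕ} (hN : 1 ≤ N) {ξ : Freq} (hξ : ξ ∈ freqsMinus N) (m : Fin 3) :
    |Real.pi * ξ m / N| < Real.pi / 2 := by
  have hN' : (0 : ℝ) < N := by exact_mod_cast hN
  obtain ⟨h1, h2⟩ := mem_freqsMinus.1 hξ m
  have h1' : -(N : ℝ) < 2 * ξ m := by exact_mod_cast h1
  have h2' : 2 * (ξ m : ℝ) < N := by exact_mod_cast h2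
  rw [abs_lt, lt_div_iff₀ hN', div_lt_iff₀ hN']
  constructor <;> nlinarith [Real.pi_pos]

theorem abs_le_abs_tan {x : ℝ} (h : |x| < Real.pi / 2) : |x| ≤ |Real.tan x| := by
  rcases le_total 0 x with hx | hx
  · rw [abs_of_nonneg hx] at h ⊢
    exact (Real.le_tan hx h).trans (le_abs_self _)
  · rw [abs_of_nonpos hx] at h ⊢
    have := Real.le_tan (x := -x) (by linarith) h
    rw [Real.tan_neg] at this
    exact this.trans (neg_le_abs _)

/-- The nonzero frequencies with `-N/2 < ξ_m < N/2`. -/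
def freqsZero (N : ℕ) : Finset Freq := (freqsMinus N).erase 0

theorem mem_freqsZero {N : ℕ} {ξ : Freq} : ξ ∈ freqsZero N ↔ ξ ≠ 0 ∧ ξ ∈ freqsMinus N :=
  Finset.mem_erase

theorem freqsZero_subset (N : ℕ) : freqsZero N ⊆ freqs N :=
  (Finset.erase_subset _ _).trans (freqsMinus_subset N)

theorem neg_mem_freqsZero {N : ℕ} {ξ : Freq} (h : ξ ∈ freqsZero N) : -ξ ∈ freqsZero N :=
  mem_freqsZero.2 ⟨neg_ne_zero.2 (mem_freqsZero.1 h).1, neg_mem_freqsMinus (mem_freqsZero.1 h).2⟩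

theorem sum_tanSymbol_sq_pos {N : ℕ} (hN : 1 ≤ N) {ξ : Freq} (hξ : ξ ∈ freqsZero N) :
    0 < ∑ m, tanSymbol N ξ m ^ 2 := by
  have hN' : (0 : ℝ) < N := by exact_mod_cast hN
  obtain ⟨h0, h1⟩ := mem_freqsZero.1 hξ
  obtain ⟨m, hm⟩ := Function.ne_iff.mp h0
  have hm' : (ξ m : ℝ) ≠ 0 := by exact_mod_cast hm
  refine Finset.sum_pos' (fun _ _ => sq_nonneg _) ⟨m, Finset.mem_univ m, ?_⟩
  have h2 := abs_le_abs_tan (angle_bounds hN h1 m)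
  have h3 : 0 < |Real.pi * ξ m / N| :=
    abs_pos.2 (div_ne_zero (mul_ne_zero Real.pi_ne_zero hm') hN'.ne')
  exact sq_pos_of_ne_zero (abs_pos.1 (h3.trans_le h2))

theorem korn_symProd (t : Fin 3 → ℝ) (a : Fin 3 → ℂ) :
    (∑ m, t m ^ 2) * (∑ n, ‖a n‖ ^ 2) ≤ 2 * ∑ m, ∑ n, ‖symProd (fun m => (t m : ℂ)) a m n‖ ^ 2 :=
  korn_symbol t a

theorem eq_zero_of_symProd {t : Fin 3 → ℝ} (ht : 0 < ∑ m, t m ^ 2) {a : Fin 3 → ℂ}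
    (h : ∑ m, ∑ n, ‖symProd (fun m => (t m : ℂ)) a m n‖ ^ 2 ≤ 0) : a = 0 := by
  have h1 := korn_symProd t a
  have h2 : ∑ n, ‖a n‖ ^ 2 ≤ 0 := by
    by_contra hn
    nlinarith [mul_pos ht (not_le.1 hn)]
  have h3 := (Finset.sum_eq_zero_iff_of_nonneg fun _ _ => sq_nonneg _).1
    (le_antisymm h2 (Finset.sum_nonneg fun _ _ => sq_nonneg _))
  ext n
  simpa using h3 n (Finset.mem_univ n)

/-! ### The discrete elasticity system -/

/-- A symmetric, uniformly coercive, bounded stiffness on the grid. -/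
structure IsGridStiffness {N : ℕ} (Cs : Idx N → Tensor4 ℝ) (a K : ℝ) : Prop where
  symm : ∀ I, IsElasticSymm (Cs I)
  coercive : ∀ I, IsCoerciveTensor a (Cs I)
  bound : ∀ I m n p q, |Cs I m n p q| ≤ K
  pos : 0 < a

/-- The compatible strain field with coefficients `c`. -/
def gridStrain {N : ℕ} (c : Freq → Fin 3 → ℂ) (I : Idx N) : Mat ℂ := fun m n =>
  ∑ ξ ∈ freqsZero N, symProd (tanC N ξ) (c ξ) m n * expo ξ (gridPt I)

theorem gridStrain_symm {N : ℕ} (c : Freq → Fin 3 → ℂ) (I : Idx N) (m n : Fin 3) :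
    gridStrain c I m n = gridStrain c I n m := by
  simp only [gridStrain, symProd_symm _ _ m n]

theorem gridStrain_isSymm {N : ℕ} (c : Freq → Fin 3 → ℂ) (I : Idx N) : (gridStrain c I).IsSymm :=
  Matrix.IsSymm.ext fun m n => gridStrain_symm c I n m

/-- The stress field for the strain field `e`. -/
def gridStress {N : ℕ} (Cs : Idx N → Tensor4 ℝ) (e : Idx N → Mat ℂ) (I : Idx N) : Mat ℂ :=
  ddot (castT ℂ (Cs I)) (e I)

/-- The divergence of a stress field at the frequency `ξ`, up to a factor. -/
def gridDiv {N : ℕ} (σ : Idx N → Mat ℂ) (ξ : Freq) (j : Fin 3) : ℂ :=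
  ∑ m, tanC N ξ m * dft (fun I => σ I m j) ξ

/-- The coefficients `c` solve the discrete elasticity system with macroscopic strain `E`. -/
def IsGridSolution {N : ℕ} (Cs : Idx N → Tensor4 ℝ) (E : Mat ℂ) (c : Freq → Fin 3 → ℂ) : Prop :=
  ∀ ξ ∈ freqsZero N, ∀ j, gridDiv (gridStress Cs fun I => E + gridStrain c I) ξ j = 0

theorem gridDiv_add {N : ℕ} (σ τ : Idx N → Mat ℂ) (ξ : Freq) (j : Fin 3) :
    gridDiv (fun I => σ I + τ I) ξ j = gridDiv σ ξ j + gridDiv τ ξ j := by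
  simp only [gridDiv, Matrix.add_apply, dft_add, mul_add, Finset.sum_add_distrib]

theorem gridDiv_smul {N : ℕ} (c : ℂ) (σ : Idx N → Mat ℂ) (ξ : Freq) (j : Fin 3) :
    gridDiv (fun I => c • σ I) ξ j = c * gridDiv σ ξ j := by
  simp only [gridDiv, Matrix.smul_apply, smul_eq_mul, dft_const_mul, Finset.mul_sum]
  exact Finset.sum_congr rfl fun m _ => by ring

/-- The discrete principle of virtual work: Parseval on the grid, with the symmetry of the stress
removing the symmetrization. A divergence-free stress is thus orthogonal to compatible strains. -/
theorem sum_star_gridStrain_mul {N : ℕ} (c : Freq → Fin 3 → ℂ) {σ : Idx N → Mat ℂ}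
    (hσ : ∀ I m n, σ I m n = σ I n m) :
    ((N : ℂ) ^ 3)⁻¹ * ∑ I, ∑ m, ∑ n, star (gridStrain c I m n) * σ I m n =
      ∑ ξ ∈ freqsZero N, ∑ j, star (c ξ j) * gridDiv σ ξ j := by
  have h1 : ((N : ℂ) ^ 3)⁻¹ * ∑ I, ∑ m, ∑ n, star (gridStrain c I m n) * σ I m n =
      ∑ m, ∑ n, (((N : ℂ) ^ 3)⁻¹ * ∑ I, star (gridStrain c I m n) * σ I m n) := by
    rw [Finset.sum_comm, Finset.mul_sum]
    refine Finset.sum_congr rfl fun m _ => ?_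
    rw [Finset.sum_comm, Finset.mul_sum]
  rw [h1]
  simp only [gridStrain, sum_star_trig_mul]
  have h2 : ∑ m, ∑ n, ∑ ξ ∈ freqsZero N, star (symProd (tanC N ξ) (c ξ) m n) *
      dft (fun I => σ I m n) ξ = ∑ ξ ∈ freqsZero N, ∑ m, ∑ n,
      star (symProd (tanC N ξ) (c ξ) m n) * dft (fun I => σ I m n) ξ := by
    rw [Finset.sum_comm]
    rw [Finset.sum_congr rfl fun m _ => Finset.sum_comm, Finset.sum_comm]
    refine Finset.sum_congr rfl fun ξ _ => ?_
    rw [Finset.sum_comm]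
  rw [h2]
  refine Finset.sum_congr rfl fun ξ _ => ?_
  rw [sum_star_symProd_mul (tanC N ξ) (c ξ) (S := fun m n => dft (fun I => σ I m n) ξ)
    fun m n => by simp only [hσ _ m n]]
  simp [gridDiv, tanC]

theorem gridStress_symm {N : ℕ} {Cs : Idx N → Tensor4 ℝ} {a K : ℝ} (h : IsGridStiffness Cs a K)
    (e : Idx N → Mat ℂ) (I : Idx N) (m n : Fin 3) :
    gridStress Cs e I m n = gridStress Cs e I n m := ddot_symm (h.symm I) _ m n

/-- The mean square of a strain field. -/
def meanSq {N : ℕ} (e : Idx N → Mat ℂ) : ℝ :=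
  ((N : ℝ) ^ 3)⁻¹ * ∑ I, ∑ m, ∑ n, ‖e I m n‖ ^ 2

theorem meanSq_gridStrain {N : ℕ} (hN : 1 ≤ N) (c : Freq → Fin 3 → ℂ) :
    meanSq (gridStrain (N := N) c) =
      ∑ ξ ∈ freqsZero N, ∑ m, ∑ n, ‖symProd (tanC N ξ) (c ξ) m n‖ ^ 2 := by
  -- Parseval is available as a complex identity, so the equality of real numbers is proved after
  -- casting.
  have hc : ((meanSq (gridStrain (N := N) c) : ℝ) : ℂ) =
      ((∑ ξ ∈ freqsZero N, ∑ m, ∑ n, ‖symProd (tanC N ξ) (c ξ) m n‖ ^ 2 : ℝ) : ℂ) := by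
    have h1 : ((meanSq (gridStrain (N := N) c) : ℝ) : ℂ) = ∑ m, ∑ n, (((N : ℂ) ^ 3)⁻¹ *
        ∑ I, star (gridStrain (N := N) c I m n) * gridStrain c I m n) := by
      rw [meanSq]
      push_cast
      rw [Finset.sum_comm, Finset.mul_sum]
      refine Finset.sum_congr rfl fun m _ => ?_
      rw [Finset.sum_comm, Finset.mul_sum]
      refine Finset.sum_congr rfl fun n _ => ?_
      congr 1
      refine Finset.sum_congr rfl fun I _ => ?_
      rw [Complex.star_def, Complex.conj_mul']
    rw [h1]
    push_cast
    rw [Finset.sum_comm' (t' := Finset.univ) (s' := fun _ => freqsZero N) (by simp)]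
    refine Finset.sum_congr rfl fun m _ => ?_
    rw [Finset.sum_comm' (t' := Finset.univ) (s' := fun _ => freqsZero N) (by simp)]
    refine Finset.sum_congr rfl fun n _ => ?_
    have := sum_star_trig_mul (N := N) (freqsZero N) (fun ξ => symProd (tanC N ξ) (c ξ) m n)
      (fun I => gridStrain c I m n)
    simp only [gridStrain] at this ⊢
    rw [this]
    refine Finset.sum_congr rfl fun ξ hξ => ?_
    rw [dft_trig hN (freqsZero_subset N) (fun ξ => symProd (tanC N ξ) (c ξ) m n)
      (freqsZero_subset N hξ), if_pos hξ, Complex.star_def, Complex.conj_mul']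
  exact_mod_cast hc

theorem meanSq_le_energy {N : ℕ} {Cs : Idx N → Tensor4 ℝ} {a K : ℝ} (h : IsGridStiffness Cs a K)
    {e : Idx N → Mat ℂ} (he : ∀ I, (e I).IsSymm) :
    a * meanSq e ≤
      (((N : ℂ) ^ 3)⁻¹ * ∑ I, ∑ m, ∑ n, star (e I m n) * gridStress Cs e I m n).re := by
  have h1 : (((N : ℂ) ^ 3)⁻¹ * ∑ I, ∑ m, ∑ n, star (e I m n) * gridStress Cs e I m n).re =
      ((N : ℝ) ^ 3)⁻¹ * ∑ I, (∑ m, ∑ n, star (e I m n) * gridStress Cs e I m n).re := by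
    rw [← Complex.re_sum, ← Complex.re_ofReal_mul]
    push_cast
    rfl
  rw [h1, meanSq, mul_left_comm, Finset.mul_sum]
  refine mul_le_mul_of_nonneg_left ?_ (by positivity)
  exact Finset.sum_le_sum fun I _ => (h.coercive I).hermitian (he I)

theorem eq_zero_of_meanSq {N : ℕ} (hN : 1 ≤ N) {c : Freq → Fin 3 → ℂ}
    (h : meanSq (gridStrain (N := N) c) ≤ 0) : ∀ ξ ∈ freqsZero N, c ξ = 0 := by
  rw [meanSq_gridStrain hN] at h
  have h0 := (Finset.sum_eq_zero_iff_of_nonneg fun ξ _ => by positivity).1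
    (le_antisymm h (Finset.sum_nonneg fun ξ _ => by positivity))
  exact fun ξ hξ => eq_zero_of_symProd (sum_tanSymbol_sq_pos hN hξ) (h0 ξ hξ).le

/-- Virtual work with the strain itself gives zero energy, so coercivity kills the strain, and
Korn's inequality for the nonzero tangent symbol kills the coefficients. -/
theorem eq_zero_of_gridDiv {N : ℕ} (hN : 1 ≤ N) {Cs : Idx N → Tensor4 ℝ} {a K : ℝ}
    (h : IsGridStiffness Cs a K) {c : Freq → Fin 3 → ℂ}
    (hc : ∀ ξ ∈ freqsZero N, ∀ j, gridDiv (gridStress Cs (gridStrain c)) ξ j = 0) :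
    ∀ ξ ∈ freqsZero N, c ξ = 0 := by
  have h1 := meanSq_le_energy h (gridStrain_isSymm c)
  rw [sum_star_gridStrain_mul c (gridStress_symm h _), Finset.sum_eq_zero fun ξ hξ => by
    simp [hc ξ hξ], Complex.zero_re] at h1
  refine eq_zero_of_meanSq hN ?_
  by_contra hn
  nlinarith [mul_pos h.pos (not_le.1 hn)]

theorem gridStress_add {N : ℕ} (Cs : Idx N → Tensor4 ℝ) (e f : Idx N → Mat ℂ) :
    (gridStress Cs fun I => e I + f I) = fun I => gridStress Cs e I + gridStress Cs f I := by
  ext1 I; exact ddot_add _ _ _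

theorem gridStrain_congr {N : ℕ} {c d : Freq → Fin 3 → ℂ} (h : ∀ ξ ∈ freqsZero N, c ξ = d ξ) :
    gridStrain (N := N) c = gridStrain d := by
  ext I m n
  exact Finset.sum_congr rfl fun ξ hξ => by rw [h ξ hξ]

theorem gridStrain_add {N : ℕ} (c d : Freq → Fin 3 → ℂ) (I : Idx N) :
    gridStrain (c + d) I = gridStrain c I + gridStrain d I := by
  ext m n
  simp only [gridStrain, symProd, Matrix.add_apply, Pi.add_apply, ← Finset.sum_add_distrib]
  exact Finset.sum_congr rfl fun ξ _ => by ring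

theorem gridStrain_smul {N : ℕ} (r : ℂ) (c : Freq → Fin 3 → ℂ) (I : Idx N) :
    gridStrain (r • c) I = r • gridStrain c I := by
  ext m n
  simp only [gridStrain, symProd, Matrix.smul_apply, Pi.smul_apply, smul_eq_mul, Finset.mul_sum]
  exact Finset.sum_congr rfl fun ξ _ => by ring

theorem IsGridSolution.unique {N : ℕ} (hN : 1 ≤ N) {Cs : Idx N → Tensor4 ℝ} {a K : ℝ}
    (h : IsGridStiffness Cs a K) {E : Mat ℂ} {c d : Freq → Fin 3 → ℂ}
    (hc : IsGridSolution Cs E c) (hd : IsGridSolution Cs E d) : ∀ ξ ∈ freqsZero N, c ξ = d ξ := by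
  have key := eq_zero_of_gridDiv hN h (c := c + (-1 : ℂ) • d) fun ξ hξ j => by
    have h1 : (gridStress Cs fun I => E + gridStrain c I) = fun I =>
        gridStress Cs (fun I => E + gridStrain d I) I +
          gridStress Cs (gridStrain (c + (-1 : ℂ) • d)) I := by
      rw [← gridStress_add]
      congr 1
      ext1 I
      rw [gridStrain_add, gridStrain_smul]
      module
    have h2 := hc ξ hξ j
    rw [h1, gridDiv_add, hd ξ hξ j, zero_add] at h2
    exact h2
  intro ξ hξ
  have := key ξ hξ
  simp only [Pi.add_apply, Pi.smul_apply] at this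
  rw [neg_one_smul, ← sub_eq_add_neg] at this
  exact sub_eq_zero.1 this

theorem exists_isGridSolution {N : ℕ} (hN : 1 ≤ N) {Cs : Idx N → Tensor4 ℝ} {a K : ℝ}
    (h : IsGridStiffness Cs a K) (E : Mat ℂ) : ∃ c, IsGridSolution Cs E c := by
  -- Unknowns live on the nonzero frequencies and are extended by zero. There are as many unknowns
  -- as equations, so injectivity gives surjectivity.
  let ext : (freqsZero N → Fin 3 → ℂ) →ₗ[ℂ] Freq → Fin 3 → ℂ :=
    { toFun := fun c ξ => if hξ : ξ ∈ freqsZero N then c ⟨ξ, hξ⟩ else 0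
      map_add' := fun c d => by ext1 ξ; simp only [Pi.add_apply]; split_ifs <;> simp
      map_smul' := fun r c => by
        ext1 ξ; simp only [Pi.smul_apply, RingHom.id_apply]; split_ifs <;> simp }
  let T : (freqsZero N → Fin 3 → ℂ) →ₗ[ℂ] (freqsZero N → Fin 3 → ℂ) :=
    { toFun := fun c ξ j => gridDiv (gridStress Cs (gridStrain (ext c))) ξ j
      map_add' := fun c d => by
        ext ξ j
        have : gridStress Cs (gridStrain (ext (c + d))) = fun I =>
            gridStress Cs (gridStrain (ext c)) I + gridStress Cs (gridStrain (ext d)) I := by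
          rw [← gridStress_add, map_add]
          congr 1
          ext1 I
          exact gridStrain_add _ _ I
        rw [this, gridDiv_add]
        rfl
      map_smul' := fun r c => by
        ext ξ j
        have : gridStress Cs (gridStrain (ext (r • c))) = fun I =>
            r • gridStress Cs (gridStrain (ext c)) I := by
          ext1 I
          simp only [gridStress, map_smul, gridStrain_smul, ddot_smul]
        rw [this, gridDiv_smul]
        rfl }
  have hinj : Function.Injective T := by
    rw [← LinearMap.ker_eq_bot, LinearMap.ker_eq_bot']
    intro c hc
    have h1 := eq_zero_of_gridDiv hN h (c := ext c) fun ξ hξ j =>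
      congrFun (congrFun hc ⟨ξ, hξ⟩) j
    ext1 ξ
    have h2 := h1 ξ ξ.2
    have h3 : ext c ξ = c ξ := by
      simp only [ext, LinearMap.coe_mk, AddHom.coe_mk]
      rw [dif_pos ξ.2]
    rw [← h3, h2]; rfl
  obtain ⟨c, hc⟩ := LinearMap.injective_iff_surjective.1 hinj
    fun ξ j => -gridDiv (gridStress Cs fun _ => E) ξ j
  refine ⟨ext c, fun ξ hξ j => ?_⟩
  have h1 : gridDiv (gridStress Cs (gridStrain (ext c))) ξ j =
      -gridDiv (gridStress Cs fun _ => E) ξ j := congrFun (congrFun hc ⟨ξ, hξ⟩) j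
  rw [gridStress_add Cs (fun _ => E) (gridStrain (ext c)), gridDiv_add, h1]
  ring

theorem norm_ddot_le {T : Tensor4 ℝ} {K : ℝ} (hT : ∀ m n p q, |T m n p q| ≤ K) (F : Mat ℂ)
    (m n : Fin 3) : ‖ddot (castT ℂ T) F m n‖ ≤ K * ∑ p, ∑ q, ‖F p q‖ := by
  simp only [ddot, castT, Finset.mul_sum]
  refine (norm_sum_le _ _).trans (Finset.sum_le_sum fun p _ => ?_)
  refine (norm_sum_le _ _).trans (Finset.sum_le_sum fun q _ => ?_)
  rw [norm_mul]
  exact mul_le_mul_of_nonneg_right (by simpa using hT m n p q) (norm_nonneg _)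

/-- The energy estimate: the strain fluctuation is tested against its own equation, and the load is
absorbed by Young's inequality. B bounds every entry of the load, and 9 counts the entries. What
matters is that the bound does not depend on N. -/
theorem IsGridSolution.meanSq_le {N : ℕ} (hN : 1 ≤ N) {Cs : Idx N → Tensor4 ℝ} {a K : ℝ}
    (h : IsGridStiffness Cs a K) {E : Mat ℂ} {c : Freq → Fin 3 → ℂ} (hc : IsGridSolution Cs E c) :
    meanSq (gridStrain (N := N) c) ≤ 9 * (K * ∑ p, ∑ q, ‖E p q‖) ^ 2 / a ^ 2 := by
  set B := K * ∑ p, ∑ q, ‖E p q‖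
  have hN3 : (0 : ℝ) < (N : ℝ) ^ 3 := by
    have : (0 : ℝ) < N := by exact_mod_cast hN
    positivity
  have h1 := meanSq_le_energy h (gridStrain_isSymm (N := N) c)
  have h2 : ((N : ℂ) ^ 3)⁻¹ * ∑ I : Idx N, ∑ m, ∑ n, star (gridStrain c I m n) *
      gridStress Cs (gridStrain c) I m n = -(((N : ℂ) ^ 3)⁻¹ * ∑ I : Idx N, ∑ m, ∑ n,
      star (gridStrain c I m n) * gridStress Cs (fun _ => E) I m n) := by
    rw [sum_star_gridStrain_mul c (gridStress_symm h _),
      sum_star_gridStrain_mul c (gridStress_symm h _), ← Finset.sum_neg_distrib]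
    refine Finset.sum_congr rfl fun ξ hξ => ?_
    rw [← Finset.sum_neg_distrib]
    refine Finset.sum_congr rfl fun j _ => ?_
    have := hc ξ hξ j
    rw [gridStress_add Cs (fun _ => E) (gridStrain c), gridDiv_add] at this
    linear_combination star (c ξ j) * this
  rw [h2] at h1
  have h3 : ‖((N : ℂ) ^ 3)⁻¹ * ∑ I : Idx N, ∑ m, ∑ n,
      star (gridStrain c I m n) * gridStress Cs (fun _ => E) I m n‖ ≤
      ((N : ℝ) ^ 3)⁻¹ * ∑ I : Idx N, ∑ m : Fin 3, ∑ n : Fin 3,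
        (a / 2 * ‖gridStrain c I m n‖ ^ 2 + B ^ 2 / (2 * a)) := by
    rw [norm_mul]
    refine mul_le_mul (by simp) ?_ (norm_nonneg _) (by positivity)
    refine (norm_sum_le _ _).trans (Finset.sum_le_sum fun I _ => ?_)
    refine (norm_sum_le _ _).trans (Finset.sum_le_sum fun m _ => ?_)
    refine (norm_sum_le _ _).trans (Finset.sum_le_sum fun n _ => ?_)
    rw [norm_mul, norm_star]
    have h4 : ‖gridStress Cs (fun _ => E) I m n‖ ≤ B := norm_ddot_le (h.bound I) E m n
    have ha := h.pos
    -- Young's inequality, weighted so that half of the coercivity constant survives.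
    have h5 : ‖gridStrain c I m n‖ * B ≤ a / 2 * ‖gridStrain c I m n‖ ^ 2 + B ^ 2 / (2 * a) := by
      have h6 : a / 2 * ‖gridStrain c I m n‖ ^ 2 + B ^ 2 / (2 * a) - ‖gridStrain c I m n‖ * B =
          (a * ‖gridStrain c I m n‖ - B) ^ 2 / (2 * a) := by
        field_simp; ring
      have h7 : 0 ≤ (a * ‖gridStrain c I m n‖ - B) ^ 2 / (2 * a) := by positivity
      linarith
    exact (mul_le_mul_of_nonneg_left h4 (norm_nonneg _)).trans h5
  have h8 : ((N : ℝ) ^ 3)⁻¹ * ∑ I : Idx N, ∑ m : Fin 3, ∑ n : Fin 3,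
        (a / 2 * ‖gridStrain c I m n‖ ^ 2 + B ^ 2 / (2 * a)) =
      a / 2 * meanSq (gridStrain (N := N) c) + 9 * (B ^ 2 / (2 * a)) := by
    simp only [Finset.sum_add_distrib, ← Finset.mul_sum, meanSq, mul_add]
    simp only [Finset.sum_const, Finset.card_univ, Fintype.card_fin, Fintype.card_fun, nsmul_eq_mul]
    push_cast
    field_simp
    ring
  have h9 := (Complex.neg_re _ ▸ h1).trans ((neg_le_abs _).trans (Complex.abs_re_le_norm _))
  have h10 := h9.trans (h3.trans h8.le)
  have ha := h.pos
  rw [le_div_iff₀ (by positivity)]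
  have h11 : a * (9 * (B ^ 2 / (2 * a))) = 9 * B ^ 2 / 2 := by field_simp
  nlinarith [mul_le_mul_of_nonneg_left h10 ha.le]

/-! ### Reality of the discrete solution -/

/-- Conjugation reverses the frequency, under which `freqsZero N` is invariant; the minus sign
compensates the oddness of the tangent. -/
theorem gridStrain_conj {N : ℕ} (c : Freq → Fin 3 → ℂ) (I : Idx N) (m n : Fin 3) :
    gridStrain (fun ξ j => -star (c (-ξ) j)) I m n = star (gridStrain c I m n) := by
  simp only [gridStrain, star_sum]
  refine Finset.sum_nbij' (fun ξ => -ξ) (fun ξ => -ξ) (fun ξ hξ => neg_mem_freqsZero hξ)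
    (fun ξ hξ => neg_mem_freqsZero hξ) (fun ξ _ => neg_neg ξ) (fun ξ _ => neg_neg ξ) fun ξ _ => ?_
  simp only [symProd, tanC, tanSymbol_neg, star_mul', expo_neg, star_star, star_div₀, star_add]
  simp

theorem IsGridSolution.conj {N : ℕ} {Cs : Idx N → Tensor4 ℝ} {E : Mat ℝ}
    {c : Freq → Fin 3 → ℂ} (hc : IsGridSolution Cs (castM ℂ E) c) :
    IsGridSolution Cs (castM ℂ E) (fun ξ j => -star (c (-ξ) j)) := by
  intro ξ hξ j
  have h1 : ∀ I m n, gridStress Cs (fun I => castM ℂ E + gridStrain (fun ξ j => -star (c (-ξ) j)) I)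
      I m n = star (gridStress Cs (fun I => castM ℂ E + gridStrain c I) I m n) := by
    intro I m n
    simp only [gridStress, ddot, castT, Matrix.add_apply, gridStrain_conj, star_sum, star_mul',
      star_add, castM]
    simp
  have h2 := hc (-ξ) (neg_mem_freqsZero hξ) j
  simp only [gridDiv, h1, dft_star] at h2 ⊢
  rw [← star_eq_zero, star_sum, ← neg_eq_zero, ← Finset.sum_neg_distrib]
  rw [← h2]
  refine Finset.sum_congr rfl fun m _ => ?_
  simp [tanC, tanSymbol_neg]

/-- For real data the conjugated coefficients solve the same system, so uniqueness makes the strain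
field real. -/
theorem IsGridSolution.star_gridStrain {N : ℕ} (hN : 1 ≤ N) {Cs : Idx N → Tensor4 ℝ} {a K : ℝ}
    (h : IsGridStiffness Cs a K) {E : Mat ℝ} {c : Freq → Fin 3 → ℂ}
    (hc : IsGridSolution Cs (castM ℂ E) c) (I : Idx N) (m n : Fin 3) :
    star (gridStrain c I m n) = gridStrain c I m n := by
  rw [← gridStrain_conj, gridStrain_congr (hc.conj.unique hN h hc)]

/-! ### The strain Green operator -/

theorem castM_symm {E : Mat ℝ} (hE : E.IsSymm) (m n : Fin 3) : castM ℂ E m n = castM ℂ E n m := by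
  simp only [castM, hE.apply m n]

theorem ddot_green (Cref : Tensor4 ℝ) (k : Fin 3 → ℂ) {F : Mat ℂ} (hF : ∀ m n, F m n = F n m) :
    ddot (green Cref k) F =
      symProd k ((acoustic Cref k)⁻¹.mulVec fun p => ∑ q, F p q * star (k q)) := by
  ext m n
  simp only [ddot, green, symProd, Matrix.mulVec, dotProduct, Fin.sum_univ_three, hF 1 0, hF 2 0,
    hF 2 1]
  ring

/-- The index symmetries of `Cref` hide the symmetrization of k ⊗ b. This identity makes the Green
operator undo `Cref` on compatible strains. -/
theorem acoustic_mulVec {Cref : Tensor4 ℝ} (hC : IsElasticSymm Cref) (k b : Fin 3 → ℂ) (n : Fin 3) :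
    (acoustic Cref k).mulVec b n = ∑ q, ddot (castT ℂ Cref) (symProd k b) n q * star (k q) := by
  have h1 : ∀ m, ddot (castT ℂ Cref) (symProd k b) n m = ∑ p, ∑ q, (Cref m n p q : ℂ) * k q * b p := by
    intro m
    have h2 : ddot (castT ℂ Cref) (symProd k b) n m =
        (∑ p, ∑ q, (Cref m n p q : ℂ) * k p * b q + ∑ p, ∑ q, (Cref m n p q : ℂ) * k q * b p) / 2 := by
      rw [← Finset.sum_add_distrib, Finset.sum_div]
      refine Finset.sum_congr rfl fun p _ => ?_
      rw [← Finset.sum_add_distrib, Finset.sum_div]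
      refine Finset.sum_congr rfl fun q _ => ?_
      rw [castT, symProd, (hC m n p q).1]
      simp only [RCLike.ofReal_eq_complex_ofReal]
      ring
    have h3 : ∑ p, ∑ q, (Cref m n p q : ℂ) * k p * b q = ∑ p, ∑ q, (Cref m n p q : ℂ) * k q * b p := by
      rw [Finset.sum_comm]
      refine Finset.sum_congr rfl fun p _ => Finset.sum_congr rfl fun q _ => ?_
      rw [(hC m n q p).2.1]
    rw [h2, h3]; ring
  simp only [h1, Matrix.mulVec, dotProduct, acoustic, Finset.sum_mul]
  rw [Finset.sum_comm]
  refine Finset.sum_congr rfl fun m _ => Finset.sum_congr rfl fun p _ =>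
    Finset.sum_congr rfl fun q _ => ?_
  ring

/-- A kernel vector b gives k ⊗ˢ b zero reference energy, hence k ⊗ˢ b = 0, and Korn's inequality
for symbols gives b = 0. That inequality needs k to be a complex multiple of a real vector. -/
theorem isUnit_det_acoustic {Cref : Tensor4 ℝ} (hC : IsElasticMedium Cref) {t : Fin 3 → ℝ}
    (ht : 0 < ∑ m, t m ^ 2) {γ : ℂ} (hγ : γ ≠ 0) :
    IsUnit (acoustic Cref fun m => γ * t m).det := by
  obtain ⟨hsymm, c, hc, hcoer⟩ := hC
  rw [isUnit_iff_ne_zero]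
  intro hdet
  obtain ⟨b, hb, hb0⟩ := Matrix.exists_mulVec_eq_zero_iff.2 hdet
  refine hb ?_
  set k : Fin 3 → ℂ := fun m => γ * t m
  have hs : ∀ m n, ddot (castT ℂ Cref) (symProd k b) m n = ddot (castT ℂ Cref) (symProd k b) n m :=
    ddot_symm hsymm _
  have h1 := IsCoerciveTensor.hermitian (𝕜 := ℂ) (a := c) hcoer (F := symProd k b)
    (Matrix.IsSymm.ext fun m n => symProd_symm k b n m)
  rw [sum_star_symProd_mul k b hs] at h1
  have h2 : ∀ j, ∑ m, star (k m) * ddot (castT ℂ Cref) (symProd k b) m j = 0 := by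
    intro j
    have := congrFun hb0 j
    rw [acoustic_mulVec hsymm] at this
    rw [Pi.zero_apply] at this
    rw [← this]
    exact Finset.sum_congr rfl fun m _ => by rw [hs m j, mul_comm]
  simp only [h2, mul_zero, Finset.sum_const_zero, map_zero] at h1
  have h3 : ∑ m, ∑ n, ‖symProd k b m n‖ ^ 2 =
      ‖γ‖ ^ 2 * ∑ m, ∑ n, ‖symProd (fun m => (t m : ℂ)) b m n‖ ^ 2 := by
    simp only [k, symProd_smul_left, norm_mul, mul_pow, Finset.mul_sum]
  rw [h3] at h1
  refine eq_zero_of_symProd ht ?_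
  by_contra hn
  have : 0 < c * (‖γ‖ ^ 2 * ∑ m, ∑ n, ‖symProd (fun m => (t m : ℂ)) b m n‖ ^ 2) :=
    mul_pos hc (mul_pos (by positivity) (not_le.1 hn))
  linarith

/-- The scalar factor of the symbol of the scheme. -/
def gammaW (N : ℕ) (ξ : Freq) : ℂ :=
  Complex.I * N / 4 * ∏ j, (Complex.exp (2 * Real.pi * Complex.I * ((ξ j : ℂ) / N)) + 1)

theorem kW_eq (N : ℕ) (ξ : Freq) : kW N ξ = fun m => gammaW N ξ * (tanSymbol N ξ m : ℂ) := rfl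

/-- A factor exp(2πi ξ_j/N) + 1 vanishes only if 2ξ_j is an odd multiple of N, which |2ξ_j| < N
excludes. -/
theorem gammaW_ne_zero {N : ℕ} (hN : 1 ≤ N) {ξ : Freq} (hξ : ξ ∈ freqsMinus N) :
    gammaW N ξ ≠ 0 := by
  have hN' : (N : ℂ) ≠ 0 := by exact_mod_cast (by omega : N ≠ 0)
  refine mul_ne_zero (by simp [hN']) (Finset.prod_ne_zero_iff.2 fun j _ h => ?_)
  rw [add_eq_zero_iff_eq_neg, ← Complex.exp_pi_mul_I, Complex.exp_eq_exp_iff_exists_int] at h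
  obtain ⟨n, hn⟩ := h
  have h1 : (Real.pi * Complex.I : ℂ) ≠ 0 := by simp [Real.pi_ne_zero]
  have h2 : (Real.pi * Complex.I : ℂ) * (2 * ξ j) = Real.pi * Complex.I * (N * (1 + 2 * n)) := by
    have h3 : (Real.pi * Complex.I : ℂ) * (2 * ξ j) =
        N * (2 * Real.pi * Complex.I * ((ξ j : ℂ) / N)) := by field_simp
    rw [h3, hn]; ring
  have h4 := mul_left_cancel₀ h1 h2
  have h5 : 2 * ξ j = N * (1 + 2 * n) := by exact_mod_cast h4
  obtain ⟨h6, h7⟩ := mem_freqsMinus.1 hξ j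
  rcases lt_or_ge n 0 with h0 | h0 <;> nlinarith

/-! ### The fixed point of the scheme -/

section Willot

variable {N : ℕ} {Cs : Idx N → Tensor4 ℝ} {a K : ℝ}

/-- On compatible strains with a nonzero frequency the scheme says that the stress has no
divergence. -/
theorem willot_frequency_iff {Cref : Tensor4 ℝ} (hCref : IsElasticMedium Cref) {t : Fin 3 → ℝ}
    (ht : 0 < ∑ m, t m ^ 2) {γ : ℂ} (hγ : γ ≠ 0) {S e : Mat ℂ} (hS : ∀ m n, S m n = S n m)
    {b : Fin 3 → ℂ} (he : e = symProd (fun m => γ * t m) b) :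
    e = -ddot (green Cref fun m => γ * t m) (S - ddot (castT ℂ Cref) e) ↔
      ∀ j, ∑ m, (t m : ℂ) * S m j = 0 := by
  have hu := isUnit_det_acoustic hCref ht hγ
  set k : Fin 3 → ℂ := fun m => γ * t m
  set B := (acoustic Cref k)⁻¹
  have hCe := ddot_symm hCref.1 e
  -- Since the Green operator returns e from `Cref` : e, the strain cancels in the fixed point
  -- equation and only the Green operator applied to the stress remains.
  have h1 : ddot (green Cref k) (S - ddot (castT ℂ Cref) e) =
      symProd k (B.mulVec fun p => ∑ q, S p q * star (k q)) - e := by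
    rw [ddot_green Cref k fun m n => by rw [Matrix.sub_apply, Matrix.sub_apply, hS, hCe]]
    have h2 : (fun p => ∑ q, (S - ddot (castT ℂ Cref) e) p q * star (k q)) =
        (fun p => ∑ q, S p q * star (k q)) - (acoustic Cref k).mulVec b := by
      ext p
      rw [Pi.sub_apply, acoustic_mulVec hCref.1, ← Finset.sum_sub_distrib, he]
      exact Finset.sum_congr rfl fun q _ => by rw [Matrix.sub_apply]; ring
    rw [h2, Matrix.mulVec_sub, Matrix.mulVec_mulVec, Matrix.nonsing_inv_mul _ hu,
      Matrix.one_mulVec, he]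
    ext m n
    simp only [symProd, Pi.sub_apply, Matrix.sub_apply]
    ring
  have h3 : (∀ j, ∑ m, (t m : ℂ) * S m j = 0) ↔ (fun p => ∑ q, S p q * star (k q)) = 0 := by
    rw [funext_iff]
    refine forall_congr' fun j => ?_
    have : ∑ q, S j q * star (k q) = star γ * ∑ m, (t m : ℂ) * S m j := by
      rw [Finset.mul_sum]
      refine Finset.sum_congr rfl fun q _ => ?_
      rw [hS j q]; simp [k]; ring
    rw [this, Pi.zero_apply, mul_eq_zero, or_iff_right (star_ne_zero.2 hγ)]
  rw [h1, h3, neg_sub]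
  constructor
  · intro h4
    set v := B.mulVec fun p => ∑ q, S p q * star (k q)
    have h5 : symProd k v = 0 := by
      have : symProd k v = e - (e - symProd k v) := by abel
      rw [this, ← h4, sub_self]
    have h6 : v = 0 := by
      refine eq_zero_of_symProd ht (le_of_eq ?_)
      refine Finset.sum_eq_zero fun m _ => Finset.sum_eq_zero fun n _ => ?_
      have := congrFun (congrFun h5 m) n
      rw [symProd_smul_left] at this
      have h7 := (mul_eq_zero.1 this).resolve_left hγ
      rw [h7]; simp
    have h8 := congrArg (acoustic Cref k).mulVec h6
    rwa [Matrix.mulVec_mulVec, Matrix.mul_nonsing_inv _ hu, Matrix.one_mulVec,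
      Matrix.mulVec_zero] at h8
  · intro h4
    rw [h4, Matrix.mulVec_zero]
    ext m n
    simp [symProd]

theorem dft_gridStrain (hN : 1 ≤ N) (c : Freq → Fin 3 → ℂ) {ξ : Freq} (hξ : ξ ∈ freqs N)
    (m n : Fin 3) : dft (fun I : Idx N => gridStrain c I m n) ξ =
      if ξ ∈ freqsZero N then symProd (tanC N ξ) (c ξ) m n else 0 :=
  dft_trig hN (freqsZero_subset N) (fun ξ => symProd (tanC N ξ) (c ξ) m n) hξ

theorem dft_const (hN : 1 ≤ N) (z : ℂ) {ξ : Freq} (hξ : ξ ∈ freqs N) :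
    dft (fun _ : Idx N => z) ξ = if ξ = 0 then z else 0 := by
  have h := dft_const_mul (N := N) z (fun I => expo 0 (gridPt I)) ξ
  rw [dft_expo hN (freqsMinus_subset N (zero_mem_freqsMinus hN)) hξ] at h
  simp only [expo_zero, mul_one] at h
  rw [h, mul_ite, mul_one, mul_zero]
  simp only [eq_comm]

/-- The discrete Fourier coefficient of a field of matrices. -/
def dftMat (σ : Idx N → Mat ℂ) (ξ : Freq) : Mat ℂ := fun m n => dft (fun I => σ I m n) ξ

theorem dftMat_symm {σ : Idx N → Mat ℂ} (hσ : ∀ I m n, σ I m n = σ I n m) (ξ : Freq)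
    (m n : Fin 3) : dftMat σ ξ m n = dftMat σ ξ n m := by
  simp only [dftMat, hσ _ m n]

theorem dft_gridStress_sub (Cref : Tensor4 ℝ) (ε : Idx N → Mat ℝ) (ξ : Freq) :
    dftMat (fun I => castM ℂ (ddot (Cs I - Cref) (ε I))) ξ =
      dftMat (gridStress Cs fun I => castM ℂ (ε I)) ξ -
        ddot (castT ℂ Cref) (dftMat (fun I => castM ℂ (ε I)) ξ) := by
  ext m n
  have h1 : ∀ I, castM ℂ (ddot (Cs I - Cref) (ε I)) m n =
      gridStress Cs (fun I => castM ℂ (ε I)) I m n +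
        (-1) * ∑ p, ∑ q, castT ℂ Cref m n p q * castM ℂ (ε I) p q := by
    intro I
    have h2 : ∑ p, ∑ q, castT ℂ Cref m n p q * castM ℂ (ε I) p q =
      ((ddot Cref (ε I) m n : ℝ) : ℂ) := ddot_cast Cref (ε I) m n
    rw [h2, gridStress, ddot_cast]
    simp only [castM, ddot, Pi.sub_apply, sub_mul, Finset.sum_sub_distrib]
    simp [sub_eq_add_neg]
  simp only [dftMat, h1, dft_add, dft_const_mul, dft_sum, Matrix.sub_apply, ddot]
  ring

/-- The right-hand side mentions neither `Cref` nor the scalar `gammaW`: the scheme computes the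
solution of the discrete elasticity system with the tangent symbol. -/
theorem isWillotStrain_iff (hN : 1 ≤ N) (h : IsGridStiffness Cs a K) {Cref : Tensor4 ℝ}
    (hCref : IsElasticMedium Cref) {E : Mat ℝ} (hE : E.IsSymm) (ε : Idx N → Mat ℝ) :
    IsWillotStrain Cs Cref E ε ↔ ∃ c, IsGridSolution Cs (castM ℂ E) c ∧
      ∀ I, castM ℂ (ε I) = castM ℂ E + gridStrain c I := by
  have hsolve : ∀ c, (∀ I, castM ℂ (ε I) = castM ℂ E + gridStrain c I) →
      ∀ ξ ∈ freqsZero N,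
      (dftMat (fun I => castM ℂ (ε I)) ξ = -ddot (green Cref (kW N ξ))
        (dftMat (fun I => castM ℂ (ddot (Cs I - Cref) (ε I))) ξ) ↔
      ∀ j, gridDiv (gridStress Cs fun I => castM ℂ E + gridStrain c I) ξ j = 0) := by
    intro c hc ξ hξ
    have hγ := gammaW_ne_zero hN (mem_freqsZero.1 hξ).2
    have he : dftMat (fun I => castM ℂ (ε I)) ξ =
        symProd (fun m => gammaW N ξ * (tanSymbol N ξ m : ℂ))
          (fun j => (gammaW N ξ)⁻¹ * c ξ j) := by
      ext m n
      rw [symProd_smul_left, symProd_smul_right, mul_inv_cancel_left₀ hγ]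
      simp only [dftMat, hc, Matrix.add_apply]
      rw [dft_add, dft_const hN _ (freqsZero_subset N hξ), if_neg (mem_freqsZero.1 hξ).1, zero_add,
        dft_gridStrain hN c (freqsZero_subset N hξ), if_pos hξ]
      rfl
    rw [dft_gridStress_sub, kW_eq,
      willot_frequency_iff hCref (sum_tanSymbol_sq_pos hN hξ) hγ
        (dftMat_symm (gridStress_symm h _) ξ) he]
    simp only [gridDiv, tanC, hc, dftMat]
  constructor
  · rintro ⟨hsymm, hε⟩
    -- Compatibility is automatic for a fixed point, as the range of the Green operator consists of
    -- products k ⊗ˢ a; the scalar in k is absorbed into b.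
    have hb : ∀ ξ : Freq, ∃ b : Fin 3 → ℂ, ξ ∈ freqsZero N →
        dftMat (fun I => castM ℂ (ε I)) ξ = symProd (tanC N ξ) b := by
      intro ξ
      by_cases hξ : ξ ∈ freqsZero N
      · obtain ⟨h0, h1⟩ := mem_freqsZero.1 hξ
        have h2 := hε ξ (freqsZero_subset N hξ)
        simp only [if_neg h0, if_pos h1] at h2
        set τ := dftMat (fun I => castM ℂ (ddot (Cs I - Cref) (ε I))) ξ
        have hs : ∀ m n, τ m n = τ n m := by
          refine dftMat_symm (fun I m n => ?_) ξ
          have h3 : ddot (Cs I - Cref) (ε I) m n = ddot (Cs I - Cref) (ε I) n m := by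
            simp only [ddot, Pi.sub_apply, ((h.symm I) m n _ _).1, (hCref.1 m n _ _).1]
          simp only [castM, h3]
        refine ⟨fun j => (-gammaW N ξ) * ((acoustic Cref (kW N ξ))⁻¹.mulVec fun p => ∑ q,
          τ p q * star (kW N ξ q)) j, fun _ => ?_⟩
        ext m n
        have h4 : dftMat (fun I => castM ℂ (ε I)) ξ m n = -ddot (green Cref (kW N ξ)) τ m n := h2 m n
        rw [h4, ddot_green Cref _ hs, symProd_smul_right, neg_mul]
        nth_rewrite 1 [kW_eq]
        rw [symProd_smul_left]
        rfl
      · exact ⟨0, fun h => absurd h hξ⟩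
    choose c hc using hb
    have hexp : ∀ I, castM ℂ (ε I) = castM ℂ E + gridStrain c I := by
      intro I
      ext m n
      have h1 := dft_inversion hN (fun I => (ε I m n : ℂ)) I
      have h2 : ∀ ξ ∈ freqs N, dft (fun I => (ε I m n : ℂ)) ξ * expo ξ (gridPt I) =
          (if ξ = 0 then (E m n : ℂ) else 0) + if ξ ∈ freqsZero N then
            symProd (tanC N ξ) (c ξ) m n * expo ξ (gridPt I) else 0 := by
        intro ξ hξ
        by_cases h0 : ξ = 0
        · have := hε ξ hξ m n
          rw [if_pos h0] at this
          rw [this, if_pos h0, if_neg fun h => (mem_freqsZero.1 h).1 h0, h0]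
          simp
        · by_cases h3 : ξ ∈ freqsMinus N
          · have h4 : ξ ∈ freqsZero N := mem_freqsZero.2 ⟨h0, h3⟩
            rw [if_neg h0, if_pos h4, zero_add, ← hc ξ h4]
            rfl
          · have := hε ξ hξ m n
            rw [if_neg h0, if_neg h3] at this
            rw [if_neg h0, if_neg fun h => h3 (mem_freqsZero.1 h).2, this]
            simp
      rw [Finset.sum_congr rfl h2, Finset.sum_add_distrib, Finset.sum_ite_eq',
        if_pos (freqsMinus_subset N (zero_mem_freqsMinus hN)), ← Finset.sum_filter,
        Finset.filter_mem_eq_inter, Finset.inter_eq_right.2 (freqsZero_subset N)] at h1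
      exact h1
    refine ⟨c, fun ξ hξ => (hsolve c hexp ξ hξ).1 ?_, hexp⟩
    ext m n
    have := hε ξ (freqsZero_subset N hξ) m n
    rwa [if_neg (mem_freqsZero.1 hξ).1, if_pos (mem_freqsZero.1 hξ).2] at this
  · rintro ⟨c, hc, hε⟩
    refine ⟨fun I => Matrix.IsSymm.ext fun m n => ?_, fun ξ hξ m n => ?_⟩
    · have h1 := congrFun (congrFun (hε I) m) n
      have h2 := congrFun (congrFun (hε I) n) m
      rw [Matrix.add_apply, castM_symm hE, gridStrain_symm, ← Matrix.add_apply, ← h2] at h1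
      exact (Complex.ofReal_injective h1).symm
    · have h1 : ∀ I, (ε I m n : ℂ) = castM ℂ E m n + gridStrain c I m n := fun I =>
        congrFun (congrFun (hε I) m) n
      split_ifs with h0 h2
      · simp only [h1, dft_add]
        rw [dft_const hN _ hξ, dft_gridStrain hN c hξ, if_pos h0,
          if_neg fun h => (mem_freqsZero.1 h).1 h0, add_zero]
        rfl
      · have h3 : ξ ∈ freqsZero N := mem_freqsZero.2 ⟨h0, h2⟩
        exact congrFun (congrFun ((hsolve c hε ξ h3).2 (hc ξ h3)) m) n
      · simp only [h1, dft_add]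
        rw [dft_const hN _ hξ, dft_gridStrain hN c hξ, if_neg h0,
          if_neg fun h => h2 (mem_freqsZero.1 h).2, add_zero]

theorem existsUnique_isWillotStrain (hN : 1 ≤ N) (h : IsGridStiffness Cs a K) {Cref : Tensor4 ℝ}
    (hCref : IsElasticMedium Cref) {E : Mat ℝ} (hE : E.IsSymm) :
    ∃! ε, IsWillotStrain Cs Cref E ε := by
  obtain ⟨c, hc⟩ := exists_isGridSolution hN h (castM ℂ E)
  refine ⟨fun I m n => E m n + (gridStrain c I m n).re, ?_, fun ε hε => ?_⟩
  · refine (isWillotStrain_iff hN h hCref hE _).2 ⟨c, hc, fun I => ?_⟩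
    ext m n
    have h1 := Complex.conj_eq_iff_re.1 (hc.star_gridStrain hN h I m n)
    change ((E m n + (gridStrain c I m n).re : ℝ) : ℂ) = (E m n : ℂ) + gridStrain c I m n
    rw [Complex.ofReal_add, h1]
  · obtain ⟨d, hd, hεd⟩ := (isWillotStrain_iff hN h hCref hE ε).1 hε
    ext I m n
    have h1 := congrFun (congrFun (hεd I) m) n
    rw [gridStrain_congr (hd.unique hN h hc)] at h1
    have h2 := congrArg Complex.re h1
    simpa [castM] using h2

end Willot

/-! ### Trigonometric polynomials in the Sobolev space -/

theorem H1_ext_fcoef {u v : H1 ℂ} (h : ∀ ξ j, fcoef (comp u j) ξ = fcoef (comp v j) ξ) : u = v := by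
  have hu := hasSum_mode u
  simp only [h] at hu
  exact hu.unique (hasSum_mode v)

theorem fcoef_comp_mode (ξ η : Freq) (i j : Fin 3) :
    fcoef (comp (mode ξ j) i) η = if i = j ∧ η = ξ then 1 else 0 := by
  have h : ((mode ξ j : Jet ℂ) (i, none)) = if i = j then modeCoef ξ none • eL2 ξ else 0 := rfl
  rw [comp, ← fcoefL_apply, h]
  by_cases hij : i = j
  · simp [hij, modeCoef, fcoefL_eL2]
  · simp [hij]

/-- The trigonometric vector field with mean zero and coefficients `d`. -/
def trigField (N : ℕ) (d : Freq → Fin 3 → ℂ) : H1 ℂ :=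
  ∑ ξ ∈ freqsZero N, ∑ j, d ξ j • mode ξ j

theorem fcoef_comp_eq (u : H1 ℂ) (i : Fin 3) (ξ : Freq) :
    fcoef (comp u i) ξ = (fcoefL ξ ∘L entryL ℂ (i, none) ∘L (H1 ℂ).subtypeL) u :=
  (fcoefL_apply ξ _).symm

theorem fcoef_trigField (N : ℕ) (d : Freq → Fin 3 → ℂ) (i : Fin 3) (η : Freq) :
    fcoef (comp (trigField N d) i) η = if η ∈ freqsZero N then d η i else 0 := by
  rw [fcoef_comp_eq, trigField, map_sum]
  simp only [map_sum, map_smul, ← fcoef_comp_eq, fcoef_comp_mode, smul_eq_mul, mul_ite, mul_one,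
    mul_zero, ite_and, Finset.sum_ite_eq, Finset.mem_univ, if_true]

theorem comp_eq_sum {N : ℕ} {w : H1 ℂ}
    (hw : ∀ ξ ∉ freqsZero N, ∀ j, fcoef (comp w j) ξ = 0) (j : Fin 3) :
    comp w j =ᵐ[volume.restrict cell] fun x =>
      ∑ ξ ∈ freqsZero N, fcoef (comp w j) ξ * expo ξ x := by
  have h1 : (w : Jet ℂ) (j, none) = ∑ ξ ∈ freqsZero N, fcoef (comp w j) ξ • eL2 ξ :=
    (hasSum_fcoef ((w : Jet ℂ) (j, none))).unique
      (hasSum_sum_of_ne_finset_zero fun ξ hξ => by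
        have := hw ξ hξ j
        rw [comp] at this
        rw [this, zero_smul])
  have h2 : ∀ᵐ x ∂(volume.restrict cell), ∀ ξ : Freq,
      ((fcoef (comp w j) ξ • eL2 ξ : L2 ℂ) : Space → ℂ) x = fcoef (comp w j) ξ * expo ξ x := by
    refine ae_all_iff.2 fun ξ => ?_
    filter_upwards [Lp.coeFn_smul (fcoef (comp w j) ξ) (eL2 ξ), coeFn_eL2 ξ] with x h3 h4
    rw [h3, Pi.smul_apply, h4, smul_eq_mul]
  have h3 := coeFn_finset_sum (freqsZero N) fun ξ => fcoef (comp w j) ξ • eL2 ξ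
  rw [← h1] at h3
  filter_upwards [h2, h3] with x h4 h5
  rw [comp] at h4 ⊢
  rw [h5]
  exact Finset.sum_congr rfl fun ξ _ => h4 ξ

/-- Replaces the two conditions on the trial function by a support condition on its Fourier
coefficients, which is how they are used below. -/
theorem isTrigMinus_meanZero_iff {N : ℕ} {w : H1 ℂ} :
    (IsTrigMinus N w ∧ MeanZero w) ↔ ∀ ξ ∉ freqsZero N, ∀ j, fcoef (comp w j) ξ = 0 := by
  classical
  constructor
  · rintro ⟨⟨c, hc⟩, h0⟩ ξ hξ j
    by_cases hz : ξ = 0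
    · rw [hz, fcoef_zero, h0 j]
    · rw [fcoef_congr (hc j), fcoef_sum_expo _ (fun ξ => c ξ j),
        if_neg fun h => hξ (mem_freqsZero.2 ⟨hz, h⟩)]
  · intro h
    refine ⟨⟨fun ξ j => if ξ ∈ freqsZero N then fcoef (comp w j) ξ else 0, fun j => ?_⟩, fun j => ?_⟩
    · filter_upwards [comp_eq_sum h j] with x hx
      rw [hx]
      simp only [ite_mul, zero_mul]
      have hsub : freqsZero N ⊆ freqsMinus N := Finset.erase_subset _ _
      rw [← Finset.sum_filter, Finset.filter_mem_eq_inter, Finset.inter_eq_right.2 hsub]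
    · rw [← fcoef_zero]
      exact h 0 (fun h => (mem_freqsZero.1 h).1 rfl) j

/-! ### The operators of the rescaled problem on trigonometric polynomials -/

theorem symDMod_eq (N : ℕ) (f : Fin 3 → Space → ℂ) (x : Space) (m n : Fin 3) :
    symDMod N f x m n = ∑ ξ ∈ freqsZero N,
      (2 * Complex.I * N * symProd (tanC N ξ) (fun j => fcoef (f j) ξ) m n) * expo ξ x := by
  have h : ∀ ξ, (kMod N ξ m * fcoef (f n) ξ + kMod N ξ n * fcoef (f m) ξ) / 2 =
      2 * Complex.I * N * symProd (tanC N ξ) (fun j => fcoef (f j) ξ) m n := by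
    intro ξ; simp only [kMod, symProd, tanC, tanSymbol]; ring
  simp only [symDMod, h]
  refine (Finset.sum_subset (Finset.erase_subset _ _) fun ξ h1 h2 => ?_).symm
  have h0 : ξ = 0 := by_contra fun hne => h2 (mem_freqsZero.2 ⟨hne, h1⟩)
  simp [h0, symProd, tanC, tanSymbol]

/-- Jordan's inequality. The bound is uniform in ξ and N, so dividing by `hatG` costs only a fixed
constant. -/
theorem sinc_pos {N : ℕ} (hN : 1 ≤ N) {ξ : Freq} (hξ : ξ ∈ freqsMinus N) (m : Fin 3) :
    2 / Real.pi ≤ Real.sinc (Real.pi * ξ m / N) := by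
  have h := angle_bounds hN hξ m
  set x := Real.pi * ξ m / N
  by_cases hx : x = 0
  · rw [hx, Real.sinc_zero, div_le_one Real.pi_pos]
    linarith [Real.pi_gt_three]
  have hpos : 0 < |x| := abs_pos.2 hx
  have h1 : Real.sinc x = Real.sinc |x| := by
    rcases abs_choice x with h2 | h2 <;> rw [h2]
    rw [Real.sinc_neg]
  rw [h1, Real.sinc_of_ne_zero hpos.ne', le_div_iff₀ hpos]
  exact Real.mul_le_sin hpos.le h.le

theorem hatG_lower {N : ℕ} (hN : 1 ≤ N) {ξ : Freq} (hξ : ξ ∈ freqsMinus N) :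
    (2 / Real.pi) ^ 3 ≤ hatG N ξ := by
  have hpos : (0 : ℝ) ≤ 2 / Real.pi := by positivity
  have := Finset.prod_le_prod (s := Finset.univ) (f := fun _ : Fin 3 => 2 / Real.pi)
    (g := fun m => Real.sinc (Real.pi * ξ m / N)) (fun _ _ => hpos) fun m _ => sinc_pos hN hξ m
  rwa [Finset.prod_const, Finset.card_univ, Fintype.card_fin] at this

theorem hatG_pos {N : ℕ} (hN : 1 ≤ N) {ξ : Freq} (hξ : ξ ∈ freqsMinus N) : 0 < hatG N ξ :=
  lt_of_lt_of_le (by positivity) (hatG_lower hN hξ)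

theorem hatG_neg (N : ℕ) (ξ : Freq) : hatG N (-ξ) = hatG N ξ := by
  refine Finset.prod_congr rfl fun m _ => ?_
  rw [← Real.sinc_neg]
  congr 1
  push_cast [Pi.neg_apply]
  ring

/-- Exponentials do not notice the reduction of the argument modulo 1, and each is an eigenfunction
of the convolution; its eigenvalue comes from `integral_expo_box` on the cube centred at 0. -/
theorem convG_trig {N : ℕ} (s : Finset Freq) (c : Freq → ℂ) (hN : 1 ≤ N) :
    convG N (fun x => ∑ ξ ∈ s, c ξ * expo ξ x) =
      fun x => ∑ ξ ∈ s, (hatG N ξ * c ξ) * expo ξ x := by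
  have hN' : (N : ℂ) ≠ 0 := by exact_mod_cast (by omega : N ≠ 0)
  have hN'' : (0 : ℝ) < N := by exact_mod_cast hN
  have hset : {y : Space | ∀ m, |y m| ≤ 1 / (2 * N)} =ᵐ[volume]
      Set.univ.pi fun m => Set.Ioo ((0 : Space) m - (1 / N : ℝ) / 2) ((0 : Space) m + (1 / N : ℝ) / 2) := by
    refine EventuallyEq.trans (Eventually.of_forall fun y => ?_)
      (Measure.univ_pi_Ioo_ae_eq_Icc (μ := fun _ : Fin 3 => (volume : Measure ℝ))
        (f := fun m => (0 : Space) m - (1 / N : ℝ) / 2)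
        (g := fun m => (0 : Space) m + (1 / N : ℝ) / 2)).symm
    have h1 : (1 : ℝ) / (2 * N) = 1 / N / 2 := by field_simp
    refine propext ?_
    change (∀ m, |y m| ≤ 1 / (2 * N)) ↔ y ∈ Set.Icc _ _
    rw [Set.mem_Icc, Pi.le_def, Pi.le_def, ← forall_and]
    refine forall_congr' fun m => ?_
    rw [abs_le, h1]
    simp
  have hbox : ∀ ξ : Freq, ∫ y in {y : Space | ∀ m, |y m| ≤ 1 / (2 * N)}, expo (-ξ) y =
      ((N : ℂ) ^ 3)⁻¹ * hatG N ξ := by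
    intro ξ
    rw [setIntegral_congr_set hset, integral_expo_box (-ξ) (0 : Space) (by positivity), ← hatG_neg]
    have : (∏ m, Real.sinc (Real.pi * ((-ξ) m : ℤ) * (1 / N))) = hatG N (-ξ) := by
      simp only [hatG, mul_one_div]
    rw [this]
    simp [expo]
  funext x
  have h1 : ∀ y : Space, (∑ ξ ∈ s, c ξ * expo ξ (fun m => Int.fract (x m - y m))) =
      ∑ ξ ∈ s, (c ξ * expo ξ x) * expo (-ξ) y := by
    intro y
    refine Finset.sum_congr rfl fun ξ _ => ?_
    have := expo_fract ξ (x - y)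
    rw [expo_sub_right] at this
    rw [mul_assoc, ← this]
    rfl
  simp only [convG, h1]
  rw [integral_finsetSum]
  · simp only [integral_const_mul, hbox]
    rw [Finset.mul_sum]
    refine Finset.sum_congr rfl fun ξ _ => ?_
    field_simp
  · intro ξ _
    refine (((continuous_expo (-ξ)).integrableOn_Icc (a := fun _ => -(1 / (2 * N : ℝ)))
      (b := fun _ => 1 / (2 * N : ℝ))).mono_set fun y hy => ?_).const_mul _
    exact ⟨fun m => (abs_le.1 (hy m)).1, fun m => (abs_le.1 (hy m)).2⟩

theorem opR_trig {N : ℕ} (hN : 1 ≤ N) (s : Finset Freq) (c : Freq → ℂ) :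
    opR N (fun x => ∑ ξ ∈ s, c ξ * expo ξ x) =
      fun x => ∑ ξ ∈ s, (hatG N ξ ^ 2 * c ξ) * expo ξ x := by
  rw [opR, convG_trig s c hN, convG_trig s (fun ξ => hatG N ξ * c ξ) hN]
  simp only [sq, mul_assoc]

/-- The phase `exp (πi ∑ ξ_m / N)` of a shift by half a voxel. -/
def halfShift (N : ℕ) (ξ : Freq) : ℂ := expo ξ fun _ => 1 / (2 * (N : ℝ))

theorem halfShift_inv (N : ℕ) (ξ : Freq) :
    Complex.exp (-(Real.pi * Complex.I * ((∑ m, (ξ m : ℂ)) / N))) = star (halfShift N ξ) := by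
  rw [halfShift, ← expo_neg, expo]
  congr 1
  push_cast [Pi.neg_apply]
  simp only [← Finset.sum_mul, Finset.sum_neg_distrib]
  ring

theorem norm_halfShift (N : ℕ) (ξ : Freq) : ‖halfShift N ξ‖ = 1 := norm_expo _ _

/-- The grid point is the corner of the voxel, but the sinc formula is centred at its midpoint; the
shift between the two produces the phase that Q_N removes. -/
theorem average_expo {N : ℕ} (hN : 1 ≤ N) (ξ : Freq) (I : Idx N) :
    ⨍ y in voxel N I, expo ξ y = hatG N ξ * halfShift N ξ * expo ξ (gridPt I) := by
  have hN' : (N : ℂ) ≠ 0 := by exact_mod_cast (by omega : N ≠ 0)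
  have hN'' : (N : ℝ) ≠ 0 := by exact_mod_cast (by omega : N ≠ 0)
  set c : Space := gridPt I + fun _ => 1 / (2 * (N : ℝ)) with hc
  have hset : voxel N I =
      Set.univ.pi fun m => Set.Ioo (c m - (1 / N : ℝ) / 2) (c m + (1 / N : ℝ) / 2) := by
    rw [voxel_eq_pi]
    refine congrArg _ (funext fun m => ?_)
    have h1 : c m - (1 / N : ℝ) / 2 = (I m : ℝ) / N := by
      simp only [hc, Pi.add_apply, gridPt]; field_simp; ring
    have h2 : c m + (1 / N : ℝ) / 2 = ((I m : ℝ) + 1) / N := by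
      simp only [hc, Pi.add_apply, gridPt]; field_simp; ring
    rw [h1, h2]
  rw [setAverage_eq, volume_real_voxel, hset, integral_expo_box ξ c (by positivity), hc,
    expo_add_right, inv_inv, Complex.real_smul]
  have : (∏ m, Real.sinc (Real.pi * (ξ m : ℤ) * (1 / N))) = hatG N ξ := by
    simp only [hatG, mul_one_div]
  rw [this, halfShift]
  push_cast
  field_simp

theorem average_sum_mul {N : ℕ} {ι : Type*} (s : Finset ι) (I : Idx N) (c : ι → ℂ)
    {f : ι → Space → ℂ} (hf : ∀ i ∈ s, IntegrableOn (f i) (voxel N I)) :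
    ⨍ y in voxel N I, ∑ i ∈ s, c i * f i y = ∑ i ∈ s, c i * ⨍ y in voxel N I, f i y := by
  simp only [setAverage_eq]
  rw [integral_finsetSum _ fun i hi => (hf i hi).const_mul (c i), Finset.smul_sum]
  refine Finset.sum_congr rfl fun i _ => ?_
  rw [integral_const_mul, mul_smul_comm]

theorem integrableOn_voxel {N : ℕ} (hN : 1 ≤ N) (I : Idx N) {f : Space → ℂ} (hf : Continuous f) :
    IntegrableOn f (voxel N I) :=
  (hf.integrableOn_Icc (a := 0) (b := 1)).mono_set fun _ hy =>
    ⟨fun m => ((voxel_subset_cell hN I hy) m).1.le, fun m => ((voxel_subset_cell hN I hy) m).2.le⟩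

/-- The scalar factor of the symbol of the rescaled problem. -/
def gammaR (N : ℕ) (ξ : Freq) : ℂ := hatG N ξ * halfShift N ξ * (2 * Complex.I * N)

theorem gammaR_ne_zero {N : ℕ} (hN : 1 ≤ N) {ξ : Freq} (hξ : ξ ∈ freqsMinus N) :
    gammaR N ξ ≠ 0 := by
  have hN' : (N : ℂ) ≠ 0 := by exact_mod_cast (by omega : N ≠ 0)
  have h1 : (hatG N ξ : ℂ) ≠ 0 := by exact_mod_cast (hatG_pos hN hξ).ne'
  have h2 : halfShift N ξ ≠ 0 := expo_ne_zero _ _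
  simp [gammaR, hN', h1, h2]

theorem continuous_symDMod (N : ℕ) (f : Fin 3 → Space → ℂ) (m n : Fin 3) :
    Continuous fun x => symDMod N f x m n := by
  simp only [symDMod_eq]
  exact continuous_finsetSum _ fun ξ _ => continuous_const.mul (continuous_expo ξ)

/-- The link between the continuous unknown and the grid: all scalars from averaging and from the
modified gradient collect in `gammaR`, leaving the pure tangent symbol. -/
theorem average_symDMod {N : ℕ} (hN : 1 ≤ N) (f : Fin 3 → Space → ℂ) (I : Idx N) (m n : Fin 3) :
    ⨍ y in voxel N I, symDMod N f y m n =
      gridStrain (fun ξ j => gammaR N ξ * fcoef (f j) ξ) I m n := by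
  simp only [symDMod_eq]
  rw [average_sum_mul _ _ _ fun ξ _ => integrableOn_voxel hN I (continuous_expo ξ)]
  simp only [average_expo hN, gridStrain, symProd_smul_right, gammaR]
  exact Finset.sum_congr rfl fun ξ _ => by ring

theorem average_ddot_pwConst {N : ℕ} (hN : 1 ≤ N) (Cs : Idx N → Tensor4 ℝ) {F : Space → Mat ℂ}
    (hF : ∀ m n, Continuous fun x => F x m n) (I : Idx N) (m n : Fin 3) :
    ⨍ y in voxel N I, ddot (castT ℂ (pwConst N Cs y)) (F y) m n =
      gridStress Cs (fun I m n => ⨍ y in voxel N I, F y m n) I m n := by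
  have h1 : ⨍ y in voxel N I, ddot (castT ℂ (pwConst N Cs y)) (F y) m n =
      ⨍ y in voxel N I, ∑ p, ∑ q, (Cs I m n p q : ℂ) * F y p q := by
    rw [setAverage_eq, setAverage_eq]
    congr 1
    refine setIntegral_congr_fun (measurableSet_voxel N I) fun y hy => ?_
    simp only [ddot, castT, pwConst_of_mem hN Cs hy]
    rfl
  have h2 : ∀ y, ∑ p, ∑ q, (Cs I m n p q : ℂ) * F y p q =
      ∑ i : Fin 3 × Fin 3, (Cs I m n i.1 i.2 : ℂ) * F y i.1 i.2 := fun y => by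
    rw [Fintype.sum_prod_type]
  rw [h1]
  simp only [h2]
  rw [average_sum_mul _ _ _ fun i _ => integrableOn_voxel hN I (hF i.1 i.2), Fintype.sum_prod_type]
  rfl

theorem integral_trig_mul_trig {N : ℕ} (b : Freq → ℂ) (q : Freq → ℂ) :
    ∫ x in cell, (∑ ξ ∈ freqsZero N, b ξ * expo ξ x) * (∑ η ∈ freqs N, q η * expo η x) =
      ∑ ξ ∈ freqsZero N, b (-ξ) * q ξ := by
  have h1 : ∀ x, (∑ ξ ∈ freqsZero N, b ξ * expo ξ x) * (∑ η ∈ freqs N, q η * expo η x) =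
      ∑ ξ ∈ freqsZero N, b ξ * (expo (- -ξ) x * ∑ η ∈ freqs N, q η * expo η x) := by
    intro x
    rw [Finset.sum_mul]
    exact Finset.sum_congr rfl fun ξ _ => by rw [neg_neg]; ring
  simp only [h1]
  rw [integral_finsetSum]
  · simp only [integral_const_mul]
    refine Finset.sum_nbij' (fun ξ => -ξ) (fun ξ => -ξ) (fun ξ hξ => neg_mem_freqsZero hξ)
      (fun ξ hξ => neg_mem_freqsZero hξ) (fun ξ _ => neg_neg ξ) (fun ξ _ => neg_neg ξ) fun ξ hξ => ?_
    have := fcoef_sum_expo (freqs N) q (-ξ)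
    rw [fcoef, if_pos (freqsZero_subset N (neg_mem_freqsZero hξ))] at this
    rw [this, neg_neg]
  · intro ξ _
    refine Integrable.const_mul ?_ _
    refine (memLp_of_continuous ?_).integrable (by norm_num)
    exact (continuous_expo _).mul
      (continuous_finsetSum _ fun η _ => continuous_const.mul (continuous_expo η))

theorem fcoef_star (f : Space → ℂ) (ξ : Freq) :
    fcoef (fun x => star (f x)) ξ = star (fcoef f (-ξ)) := by
  simp only [fcoef, neg_neg, Complex.star_def]
  rw [← integral_conj]
  refine integral_congr_ae (Eventually.of_forall fun x => ?_)
  simp [expo_neg]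

/-- The pairing of the rescaled problem in terms of the divergence of the voxel stresses. -/
theorem integral_mdot_opR_opQ {N : ℕ} (hN : 1 ≤ N) (v : H1 ℂ) {G : Space → Mat ℂ}
    {σ : Idx N → Mat ℂ} (hG : ∀ I m n, ⨍ y in voxel N I, G y m n = σ I m n)
    (hσ : ∀ I m n, σ I m n = σ I n m) :
    ∫ x in cell, mdot
      (fun m n => opR N (fun y => symDMod N (fun j z => star (comp v j z)) y m n) x)
      (fun m n => opQ N (fun y => G y m n) x) =
      ∑ ξ ∈ freqsZero N, star (gammaR N ξ) * ∑ j, star (fcoef (comp v j) ξ) * gridDiv σ ξ j := by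
  have h1 : ∀ m n, opR N (fun y => symDMod N (fun j z => star (comp v j z)) y m n) = fun x =>
      ∑ ξ ∈ freqsZero N, (hatG N ξ ^ 2 * (2 * Complex.I * N * symProd (tanC N ξ)
        (fun j => star (fcoef (comp v j) (-ξ))) m n)) * expo ξ x := by
    intro m n
    simp only [symDMod_eq, fcoef_star]
    rw [opR_trig hN]
  have h2 : ∀ m n, opQ N (fun y => G y m n) = fun x => ∑ ξ ∈ freqs N,
      ((hatG N ξ : ℂ)⁻¹ * star (halfShift N ξ) * dft (fun I => σ I m n) ξ) * expo ξ x := by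
    intro m n
    funext x
    simp only [opQ, halfShift_inv, hG]
  simp only [h1, h2, mdot]
  have hint : ∀ m n, Integrable (fun x => (∑ ξ ∈ freqsZero N, (hatG N ξ ^ 2 * (2 * Complex.I * N *
      symProd (tanC N ξ) (fun j => star (fcoef (comp v j) (-ξ))) m n)) * expo ξ x) *
      ∑ ξ ∈ freqs N, ((hatG N ξ : ℂ)⁻¹ * star (halfShift N ξ) * dft (fun I => σ I m n) ξ) *
        expo ξ x) (volume.restrict cell) := fun m n =>
    (memLp_of_continuous ((continuous_finsetSum _ fun η _ => continuous_const.mul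
      (continuous_expo η)).mul (continuous_finsetSum _ fun η _ => continuous_const.mul
      (continuous_expo η)))).integrable (by norm_num)
  rw [integral_finsetSum _ fun m _ => integrable_finsetSum _ fun n _ => hint m n]
  rw [Finset.sum_congr rfl fun m _ => integral_finsetSum _ fun n _ => hint m n]
  simp only [integral_trig_mul_trig (N := N) (fun ξ => hatG N ξ ^ 2 * (2 * Complex.I * N *
    symProd (tanC N ξ) (fun j => star (fcoef (comp v j) (-ξ))) _ _))]
  rw [Finset.sum_congr rfl fun m _ => Finset.sum_comm, Finset.sum_comm]
  refine Finset.sum_congr rfl fun ξ hξ => ?_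
  have h3 := sum_star_symProd_mul (tanC N ξ) (fun j => fcoef (comp v j) ξ)
    (S := dftMat σ ξ) (dftMat_symm hσ ξ)
  have h4 : ∑ j, star (fcoef (comp v j) ξ) * gridDiv σ ξ j =
      ∑ m, ∑ n, star (symProd (tanC N ξ) (fun j => fcoef (comp v j) ξ) m n) * dftMat σ ξ m n := by
    rw [h3]
    simp [gridDiv, tanC, dftMat]
  rw [h4, Finset.mul_sum]
  refine Finset.sum_congr rfl fun m _ => ?_
  rw [Finset.mul_sum]
  refine Finset.sum_congr rfl fun n _ => ?_
  -- R_N contributes `hatG` squared and Q_N its inverse together with the conjugate half-voxel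
  -- phase. One factor `hatG` is left, which completes the conjugate of `gammaR`; the sign from
  -- conjugating i cancels that of the tangent at −ξ.
  have hg : (hatG N ξ : ℂ) ≠ 0 := by
    exact_mod_cast (hatG_pos hN (mem_freqsZero.1 hξ).2).ne'
  simp only [hatG_neg, neg_neg, symProd, tanC, tanSymbol_neg, gammaR, star_mul', star_div₀,
    star_add, dftMat]
  simp only [Complex.star_def, Complex.conj_ofReal, Complex.conj_I, map_ofNat, map_natCast,
    Complex.ofReal_neg]
  field_simp
  ring

/-- The weak form is a combination of the discrete divergences with nonzero weights, so it holds for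
all test fields exactly when each divergence vanishes. Together with `isWillotStrain_iff` it
identifies the rescaled problem with the scheme. -/
theorem isRescaledSolution_iff {N : ℕ} (hN : 1 ≤ N) {Cs : Idx N → Tensor4 ℝ} {a K : ℝ}
    (h : IsGridStiffness Cs a K) (E : Mat ℝ) (w : H1 ℂ) :
    IsRescaledSolution Cs E w ↔ (∀ ξ ∉ freqsZero N, ∀ j, fcoef (comp w j) ξ = 0) ∧
      IsGridSolution Cs (castM ℂ E) fun ξ j => gammaR N ξ * fcoef (comp w j) ξ := by
  set c : Freq → Fin 3 → ℂ := fun ξ j => gammaR N ξ * fcoef (comp w j) ξ with hc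
  have h1 : ∀ I m n, ⨍ y in voxel N I,
      ddot (castT ℂ (pwConst N Cs y)) (symDMod N (comp w) y) m n =
      gridStress Cs (gridStrain c) I m n := by
    intro I m n
    rw [average_ddot_pwConst hN Cs (continuous_symDMod N (comp w))]
    simp only [average_symDMod hN]
    rfl
  have h2 : ∀ I m n, ⨍ y in voxel N I, ddot (castT ℂ (pwConst N Cs y)) (castM ℂ E) m n =
      gridStress Cs (fun _ => castM ℂ E) I m n := by
    intro I m n
    rw [average_ddot_pwConst hN Cs (F := fun _ => castM ℂ E) (fun m n => continuous_const)]
    have h3 : volume (voxel N I) ≠ 0 := by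
      intro h0
      have := volume_real_voxel I
      rw [Measure.real, h0] at this
      have hN' : (0 : ℝ) < N := by exact_mod_cast hN
      exact (inv_pos.2 (pow_pos hN' 3)).ne this
    have h4 : volume (voxel N I) ≠ ⊤ :=
      ((measure_mono (voxel_subset_cell hN I)).trans_lt (by simp [volume_cell])).ne
    simp only [gridStress, setAverage_const h3 h4]
  have h3 := fun v => integral_mdot_opR_opQ hN v h1 (gridStress_symm h _)
  have h4 := fun v => integral_mdot_opR_opQ hN v h2 (gridStress_symm h _)
  have h5 : ∀ ξ j, gridDiv (gridStress Cs fun I => castM ℂ E + gridStrain c I) ξ j =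
      gridDiv (gridStress Cs (gridStrain c)) ξ j +
        gridDiv (gridStress Cs fun _ => castM ℂ E) ξ j := by
    intro ξ j
    rw [gridStress_add Cs (fun _ => castM ℂ E) (gridStrain c), gridDiv_add, add_comm]
  rw [IsRescaledSolution, ← and_assoc, isTrigMinus_meanZero_iff]
  refine and_congr_right fun _ => ?_
  simp only [h3, h4, IsGridSolution, h5]
  constructor
  · intro hv ξ hξ j
    -- Testing with a single mode extracts one divergence component.
    have := hv (mode ξ j)
    rw [Finset.sum_eq_single ξ, Finset.sum_eq_single ξ] at this
    · simp only [fcoef_comp_mode, and_true, apply_ite star, star_one, star_zero, ite_mul, one_mul,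
        zero_mul, Finset.sum_ite_eq', Finset.mem_univ, if_true] at this
      rw [← mul_neg] at this
      have h6 := mul_left_cancel₀ (star_ne_zero.2 (gammaR_ne_zero hN (mem_freqsZero.1 hξ).2)) this
      rw [h6, neg_add_cancel]
    · intro η _ hη
      simp [fcoef_comp_mode, hη]
    · exact fun h => absurd hξ h
    · intro η _ hη
      simp [fcoef_comp_mode, hη]
    · exact fun h => absurd hξ h
  · intro hd v
    rw [← Finset.sum_neg_distrib]
    refine Finset.sum_congr rfl fun ξ hξ => ?_
    rw [← mul_neg, ← Finset.sum_neg_distrib]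
    congr 1
    refine Finset.sum_congr rfl fun j _ => ?_
    rw [eq_neg_of_add_eq_zero_left (hd ξ hξ j), mul_neg]

theorem existsUnique_isRescaledSolution {N : ℕ} (hN : 1 ≤ N) {Cs : Idx N → Tensor4 ℝ} {a K : ℝ}
    (h : IsGridStiffness Cs a K) (E : Mat ℝ) : ∃! w : H1 ℂ, IsRescaledSolution Cs E w := by
  obtain ⟨c, hc⟩ := exists_isGridSolution hN h (castM ℂ E)
  have hγ : ∀ ξ ∈ freqsZero N, gammaR N ξ ≠ 0 := fun ξ hξ =>
    gammaR_ne_zero hN (mem_freqsZero.1 hξ).2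
  refine ⟨trigField N fun ξ j => (gammaR N ξ)⁻¹ * c ξ j, ?_, fun w hw => ?_⟩
  · refine (isRescaledSolution_iff hN h E _).2 ⟨fun ξ hξ j => ?_, ?_⟩
    · rw [fcoef_trigField, if_neg hξ]
    · intro ξ hξ j
      have h1 : gridStrain (N := N) (fun ξ j => gammaR N ξ *
          fcoef (comp (trigField N fun ξ j => (gammaR N ξ)⁻¹ * c ξ j) j) ξ) = gridStrain c := by
        refine gridStrain_congr fun ξ hξ => ?_
        ext j
        rw [fcoef_trigField, if_pos hξ, mul_inv_cancel_left₀ (hγ ξ hξ)]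
      rw [h1]
      exact hc ξ hξ j
  · obtain ⟨h0, h1⟩ := (isRescaledSolution_iff hN h E w).1 hw
    refine H1_ext_fcoef fun ξ j => ?_
    rw [fcoef_trigField]
    split_ifs with hξ
    · rw [← congrFun (h1.unique hN h hc ξ hξ) j, inv_mul_cancel_left₀ (hγ ξ hξ)]
    · exact h0 ξ hξ j

/-! ### Weak convergence in Hilbert spaces -/

/-- A bounded sequence whose inner products with a set of vectors with dense span tend to zero
converges weakly to zero. -/
theorem tendsto_inner_zero_of_dense {H : Type*} [NormedAddCommGroup H] [InnerProductSpace ℂ H]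
    {z : ℕ → H} {R : ℝ} (hz : ∀ᶠ N in atTop, ‖z N‖ ≤ R) {S : Set H}
    (hS : (Submodule.span ℂ S).topologicalClosure = ⊤)
    (h : ∀ s ∈ S, Tendsto (fun N => inner ℂ s (z N)) atTop (𝓝 0)) (y : H) :
    Tendsto (fun N => inner ℂ y (z N)) atTop (𝓝 0) := by
  have hspan : ∀ y ∈ Submodule.span ℂ S, Tendsto (fun N => inner ℂ y (z N)) atTop (𝓝 0) := by
    intro y hy
    induction hy using Submodule.span_induction with
    | mem x hx => exact h x hx
    | zero => simp
    | add x y _ _ hx hy => simpa only [inner_add_left, add_zero] using hx.add hy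
    | smul a x _ hx => simpa only [inner_smul_left, mul_zero] using hx.const_mul _
  have hR : 0 ≤ R := by
    obtain ⟨N, hN⟩ := hz.exists
    exact (norm_nonneg _).trans hN
  have hy : y ∈ closure (Submodule.span ℂ S : Set H) := by
    have : y ∈ (Submodule.span ℂ S).topologicalClosure := hS ▸ Submodule.mem_top
    exact this
  rw [Metric.tendsto_nhds]
  intro ε hε
  -- R + 1 in place of R keeps the denominator positive when R = 0.
  obtain ⟨y', hy', hd⟩ := Metric.mem_closure_iff.1 hy (ε / (2 * (R + 1))) (by positivity)
  filter_upwards [hz, (Metric.tendsto_nhds.1 (hspan y' hy')) (ε / 2) (by positivity)] with N h1 h2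
  rw [dist_zero_right] at h2 ⊢
  have h3 : inner ℂ y (z N) = inner ℂ (y - y') (z N) + inner ℂ y' (z N) := by
    rw [← inner_add_left, sub_add_cancel]
  have h4 : ‖inner ℂ (y - y') (z N)‖ ≤ ε / 2 := by
    refine (norm_inner_le_norm _ _).trans ?_
    rw [dist_eq_norm] at hd
    calc ‖y - y'‖ * ‖z N‖ ≤ ε / (2 * (R + 1)) * (R + 1) :=
          mul_le_mul hd.le (by linarith) (norm_nonneg _) (by positivity)
      _ = ε / 2 := by field_simp
  rw [h3]
  exact (norm_add_le _ _).trans_lt (by linarith)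

theorem integral_mul_eq_inner {g : Space → ℂ} (hg : MemLp g 2 (volume.restrict cell)) (f : L2 ℂ) :
    ∫ x in cell, g x * f x = inner ℂ (hg.star.toLp (star g)) f := by
  rw [L2.inner_def]
  refine integral_congr_ae ?_
  filter_upwards [hg.star.coeFn_toLp] with x hx
  rw [hx, RCLike.inner_apply, Pi.star_apply, mul_comm]
  simp

theorem norm_toLp_sq {g : Space → ℂ} (hg : MemLp g 2 (volume.restrict cell)) :
    ‖hg.toLp g‖ ^ 2 = ∫ x in cell, ‖g x‖ ^ 2 := by
  have h1 : ((‖hg.toLp g‖ ^ 2 : ℝ) : ℂ) = ((∫ x in cell, ‖g x‖ ^ 2 : ℝ) : ℂ) := by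
    rw [← integral_complex_ofReal]
    push_cast
    have h2 := inner_self_eq_norm_sq_to_K (𝕜 := ℂ) (hg.toLp g)
    rw [L2.inner_def] at h2
    refine h2.symm.trans (integral_congr_ae ?_)
    filter_upwards [hg.coeFn_toLp] with x hx
    rw [hx]
    exact inner_self_eq_norm_sq_to_K (𝕜 := ℂ) (g x)
  exact_mod_cast h1

/-- Strong convergence of bounded multipliers against weak convergence. -/
theorem tendsto_pairing_sub {φ : ℕ → Space → ℂ} {ψ : Space → ℂ} {K R : ℝ}
    (hφm : ∀ N, AEStronglyMeasurable (φ N) (volume.restrict cell))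
    (hφb : ∀ N, 1 ≤ N → ∀ x, ‖φ N x‖ ≤ K)
    (hlim : ∀ᵐ x ∂(volume.restrict cell), Tendsto (fun N => φ N x) atTop (𝓝 (ψ x)))
    {f g : ℕ → L2 ℂ} (hf : ∀ N, 1 ≤ N → ‖f N‖ ≤ R) (hg : ∀ N, 1 ≤ N → ‖g N‖ ≤ R)
    (hfg : ∀ ξ, Tendsto (fun N => fcoefL ξ (f N - g N)) atTop (𝓝 0)) :
    Tendsto (fun N => (∫ x in cell, φ N x * f N x) - ∫ x in cell, ψ x * g N x) atTop (𝓝 0) := by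
  have hψm : AEStronglyMeasurable ψ (volume.restrict cell) :=
    aestronglyMeasurable_of_tendsto_ae atTop hφm hlim
  have hψb : ∀ᵐ x ∂(volume.restrict cell), ‖ψ x‖ ≤ K := by
    filter_upwards [hlim] with x hx
    exact le_of_tendsto hx.norm ((eventually_ge_atTop 1).mono fun N hN => hφb N hN x)
  have hψ : MemLp ψ 2 (volume.restrict cell) := MemLp.of_bound hψm K hψb
  have hφ : ∀ N, 1 ≤ N → MemLp (φ N) 2 (volume.restrict cell) := fun N hN =>
    MemLp.of_bound (hφm N) K (Eventually.of_forall (hφb N hN))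
  have hR : 0 ≤ R := (norm_nonneg _).trans (hf 1 le_rfl)
  -- Dominated convergence upgrades bounded almost everywhere convergence of the multipliers to
  -- convergence in L².
  have hsq : Tendsto (fun N => ∫ x in cell, ‖φ N x - ψ x‖ ^ 2) atTop (𝓝 0) := by
    have := tendsto_integral_filter_of_dominated_convergence (μ := volume.restrict cell)
      (l := (atTop : Filter ℕ)) (F := fun N x => ‖φ N x - ψ x‖ ^ 2) (f := fun _ => (0 : ℝ))
      (fun _ => (2 * K) ^ 2) (Eventually.of_forall fun N => (((hφm N).sub hψm).norm.pow 2))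
      (by
        filter_upwards [eventually_ge_atTop 1] with N hN
        filter_upwards [hψb] with x hx
        rw [Real.norm_of_nonneg (by positivity)]
        refine pow_le_pow_left₀ (norm_nonneg _) ?_ 2
        exact (norm_sub_le _ _).trans (by linarith [hφb N hN x]))
      (integrable_const _)
      (by
        filter_upwards [hlim] with x hx
        have := ((hx.sub_const (ψ x)).norm.pow 2)
        simpa using this)
    simpa using this
  have h1 : Tendsto (fun N => R * Real.sqrt (∫ x in cell, ‖φ N x - ψ x‖ ^ 2)) atTop (𝓝 0) := by
    simpa using (hsq.sqrt).const_mul R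
  -- Only the difference f − g needs to be weakly null; neither sequence is assumed to converge, so
  -- no subsequences enter.
  have h2 := tendsto_inner_zero_of_dense (z := fun N => f N - g N) (R := R + R)
    ((eventually_ge_atTop 1).mono fun N hN =>
      (norm_sub_le _ _).trans (add_le_add (hf N hN) (hg N hN)))
    span_eL2_dense (by rintro _ ⟨ξ, rfl⟩; exact hfg ξ) (hψ.star.toLp (star ψ))
  have h3 : Tendsto (fun N => (∫ x in cell, φ N x * f N x) - ∫ x in cell, ψ x * f N x) atTop
      (𝓝 0) := by
    refine squeeze_zero_norm' ?_ h1
    filter_upwards [eventually_ge_atTop 1] with N hN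
    have hd : MemLp (φ N - ψ) 2 (volume.restrict cell) := (hφ N hN).sub hψ
    have h4 : (∫ x in cell, φ N x * f N x) - ∫ x in cell, ψ x * f N x =
        ∫ x in cell, (φ N - ψ) x * f N x := by
      rw [integral_mul_eq_inner (hφ N hN), integral_mul_eq_inner hψ, integral_mul_eq_inner hd,
        ← inner_sub_left, ← MemLp.toLp_sub]
      congr 1
      exact MemLp.toLp_congr _ _ (Eventually.of_forall fun x => by simp)
    rw [h4, integral_mul_eq_inner hd]
    refine (norm_inner_le_norm _ _).trans ?_
    rw [mul_comm]
    refine mul_le_mul (hf N hN) ?_ (norm_nonneg _) hR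
    refine Real.le_sqrt_of_sq_le ?_
    rw [norm_toLp_sq hd.star]
    refine le_of_eq (integral_congr_ae (Eventually.of_forall fun x => ?_))
    simp only [Pi.star_apply, norm_star, Pi.sub_apply]
  have h5 := h3.add h2
  rw [add_zero] at h5
  refine h5.congr fun N => ?_
  rw [inner_sub_right, ← integral_mul_eq_inner hψ, ← integral_mul_eq_inner hψ]
  ring

/-! ### Bounds for the solutions of the rescaled problem -/

/-- The entry `(m, n)` of the modified symmetric gradient as an element of `L²(Y)`. -/
def modGrad (N : ℕ) (w : H1 ℂ) (m n : Fin 3) : L2 ℂ :=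
  ∑ ξ ∈ freqsZero N,
    (2 * Complex.I * N * symProd (tanC N ξ) (fun j => fcoef (comp w j) ξ) m n) • eL2 ξ

theorem coeFn_modGrad (N : ℕ) (w : H1 ℂ) (m n : Fin 3) :
    modGrad N w m n =ᵐ[volume.restrict cell] fun x => symDMod N (comp w) x m n := by
  have h2 : ∀ᵐ x ∂(volume.restrict cell), ∀ ξ : Freq,
      (((2 * Complex.I * N * symProd (tanC N ξ) (fun j => fcoef (comp w j) ξ) m n) • eL2 ξ :
        L2 ℂ) : Space → ℂ) x =
      (2 * Complex.I * N * symProd (tanC N ξ) (fun j => fcoef (comp w j) ξ) m n) * expo ξ x := by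
    refine ae_all_iff.2 fun ξ => ?_
    filter_upwards [Lp.coeFn_smul (2 * Complex.I * N *
      symProd (tanC N ξ) (fun j => fcoef (comp w j) ξ) m n) (eL2 ξ), coeFn_eL2 ξ] with x h3 h4
    rw [h3, Pi.smul_apply, h4, smul_eq_mul]
  filter_upwards [h2, coeFn_finset_sum (freqsZero N) fun ξ => (2 * Complex.I * N *
      symProd (tanC N ξ) (fun j => fcoef (comp w j) ξ) m n) • eL2 ξ] with x h4 h5
  rw [modGrad, h5, symDMod_eq]
  exact Finset.sum_congr rfl fun ξ _ => h4 ξ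

theorem fcoefL_modGrad (N : ℕ) (w : H1 ℂ) (m n : Fin 3) (η : Freq) :
    fcoefL η (modGrad N w m n) = if η ∈ freqsZero N then
      2 * Complex.I * N * symProd (tanC N η) (fun j => fcoef (comp w j) η) m n else 0 := by
  simp only [modGrad, map_sum, map_smul, fcoefL_eL2, smul_eq_mul, mul_ite, mul_one, mul_zero,
    Finset.sum_ite_eq]

theorem norm_modGrad_sq (N : ℕ) (w : H1 ℂ) (m n : Fin 3) :
    ‖modGrad N w m n‖ ^ 2 = ∑ ξ ∈ freqsZero N,
      (2 * N) ^ 2 * ‖symProd (tanC N ξ) (fun j => fcoef (comp w j) ξ) m n‖ ^ 2 := by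
  refine (hasSum_norm_fcoef_sq (modGrad N w m n)).unique ?_
  have h : HasSum (fun ξ => ‖fcoef (modGrad N w m n) ξ‖ ^ 2)
      (∑ ξ ∈ freqsZero N, ‖fcoef (modGrad N w m n) ξ‖ ^ 2) :=
    hasSum_sum_of_ne_finset_zero fun ξ hξ => by
      rw [← fcoefL_apply, fcoefL_modGrad, if_neg hξ]; simp
  convert! h using 1
  refine Finset.sum_congr rfl fun ξ hξ => ?_
  rw [← fcoefL_apply, fcoefL_modGrad, if_pos hξ, norm_mul, mul_pow]
  simp [mul_pow]

/-- Passing from the grid strain to the modified gradient divides each mode by `hatG`, up to a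
phase; (π/2)^6 is the inverse square of the bound in `hatG_lower`. -/
theorem sum_norm_modGrad_sq_le {N : ℕ} (hN : 1 ≤ N) (w : H1 ℂ) :
    ∑ m, ∑ n, ‖modGrad N w m n‖ ^ 2 ≤ (Real.pi / 2) ^ 6 *
      meanSq (gridStrain (N := N) fun ξ j => gammaR N ξ * fcoef (comp w j) ξ) := by
  have h1 : ∑ m, ∑ n, ‖modGrad N w m n‖ ^ 2 = ∑ ξ ∈ freqsZero N, ∑ m, ∑ n,
      (2 * N) ^ 2 * ‖symProd (tanC N ξ) (fun j => fcoef (comp w j) ξ) m n‖ ^ 2 := by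
    simp only [norm_modGrad_sq]
    rw [Finset.sum_congr rfl fun m _ => Finset.sum_comm, Finset.sum_comm]
  rw [h1, meanSq_gridStrain hN, Finset.mul_sum]
  refine Finset.sum_le_sum fun ξ hξ => ?_
  simp only [Finset.mul_sum]
  refine Finset.sum_le_sum fun m _ => Finset.sum_le_sum fun n _ => ?_
  rw [symProd_smul_right, norm_mul, mul_pow ‖gammaR N ξ‖, ← mul_assoc]
  refine mul_le_mul_of_nonneg_right ?_ (sq_nonneg _)
  have h2 := hatG_lower hN (mem_freqsZero.1 hξ).2
  have h3 : ‖gammaR N ξ‖ = hatG N ξ * (2 * N) := by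
    rw [gammaR, norm_mul, norm_mul, norm_halfShift, Complex.norm_real,
      Real.norm_of_nonneg (hatG_pos hN (mem_freqsZero.1 hξ).2).le]
    simp
  have h4 : (1 : ℝ) ≤ (Real.pi / 2) ^ 3 * hatG N ξ := by
    have h5 := mul_le_mul_of_nonneg_left h2 (by positivity : 0 ≤ (Real.pi / 2) ^ 3)
    rwa [← mul_pow, show Real.pi / 2 * (2 / Real.pi) = 1 by field_simp, one_pow] at h5
  rw [h3, mul_pow (hatG N ξ), ← mul_assoc]
  refine le_mul_of_one_le_left (by positivity) ?_
  have h6 : (Real.pi / 2) ^ 6 * hatG N ξ ^ 2 = ((Real.pi / 2) ^ 3 * hatG N ξ) ^ 2 := by ring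
  rw [h6]
  exact one_le_pow₀ h4

/-- Because |tan x| ≥ |x|, the symbol 2N tan(πξ_m/N) dominates the true symbol 2πξ_m, so the
argument of `korn_poincare` carries over with the same constant. -/
theorem norm_sq_le_modGrad {N : ℕ} (hN : 1 ≤ N) {w : H1 ℂ}
    (hw : ∀ ξ ∉ freqsZero N, ∀ j, fcoef (comp w j) ξ = 0) :
    ‖w‖ ^ 2 ≤ 4 * ∑ m, ∑ n, ‖modGrad N w m n‖ ^ 2 := by
  have hN' : (0 : ℝ) < N := by exact_mod_cast hN
  have h0 := (hasSum_norm_sq w).unique (hasSum_sum_of_ne_finset_zero (s := freqsZero N)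
    fun ξ hξ => by simp [hw ξ hξ])
  rw [h0]
  simp only [norm_modGrad_sq]
  rw [Finset.sum_congr rfl fun m _ => Finset.sum_comm, Finset.sum_comm, Finset.mul_sum]
  refine Finset.sum_le_sum fun ξ hξ => ?_
  have h1 := korn_symProd (tanSymbol N ξ) (fun j => fcoef (comp w j) ξ)
  have h2 := one_le_sum_sq (mem_freqsZero.1 hξ).1
  have h3 : (2 * Real.pi) ^ 2 * ∑ m, (ξ m : ℝ) ^ 2 ≤ (2 * N) ^ 2 * ∑ m, tanSymbol N ξ m ^ 2 := by
    rw [Finset.mul_sum, Finset.mul_sum]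
    refine Finset.sum_le_sum fun m _ => ?_
    have h4 := abs_le_abs_tan (angle_bounds hN (mem_freqsZero.1 hξ).2 m)
    have h5 : (Real.pi * ξ m / N) ^ 2 ≤ tanSymbol N ξ m ^ 2 := sq_le_sq.2 h4
    calc (2 * Real.pi) ^ 2 * (ξ m : ℝ) ^ 2 = (2 * N) ^ 2 * (Real.pi * ξ m / N) ^ 2 := by
          field_simp
      _ ≤ _ := mul_le_mul_of_nonneg_left h5 (sq_nonneg _)
  have h6 : (1 : ℝ) ≤ (2 * Real.pi) ^ 2 * ∑ m, (ξ m : ℝ) ^ 2 := by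
    have : (1 : ℝ) ≤ (2 * Real.pi) ^ 2 := by nlinarith [Real.pi_gt_three]
    nlinarith
  have h7 : (0 : ℝ) ≤ ∑ j, ‖fcoef (comp w j) ξ‖ ^ 2 := by positivity
  calc (1 + (2 * Real.pi) ^ 2 * ∑ m, (ξ m : ℝ) ^ 2) * ∑ j, ‖fcoef (comp w j) ξ‖ ^ 2
      ≤ (2 * ((2 * N) ^ 2 * ∑ m, tanSymbol N ξ m ^ 2)) * ∑ j, ‖fcoef (comp w j) ξ‖ ^ 2 :=
        mul_le_mul_of_nonneg_right (by linarith) h7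
    _ = 2 * (2 * N) ^ 2 * ((∑ m, tanSymbol N ξ m ^ 2) * ∑ j, ‖fcoef (comp w j) ξ‖ ^ 2) := by ring
    _ ≤ 2 * (2 * N) ^ 2 * (2 * ∑ m, ∑ n,
        ‖symProd (tanC N ξ) (fun j => fcoef (comp w j) ξ) m n‖ ^ 2) :=
        mul_le_mul_of_nonneg_left h1 (by positivity)
    _ = _ := by
        simp only [← Finset.mul_sum]; ring

/-- Uniform bounds for the solutions of the rescaled problem. -/
theorem exists_rescaled_bound (a K : ℝ) (E : Mat ℝ) : ∃ R : ℝ, ∀ N : ℕ, 1 ≤ N →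
    ∀ Cs : Idx N → Tensor4 ℝ, IsGridStiffness Cs a K → ∀ w, IsRescaledSolution Cs E w →
      ‖w‖ ≤ R ∧ ∀ m n, ‖modGrad N w m n‖ ≤ R := by
  set B := (Real.pi / 2) ^ 6 * (9 * (K * ∑ p, ∑ q, ‖castM ℂ E p q‖) ^ 2 / a ^ 2) with hB
  refine ⟨Real.sqrt (4 * B), fun N hN Cs h w hw => ?_⟩
  obtain ⟨h0, h1⟩ := (isRescaledSolution_iff hN h E w).1 hw
  have h2 : ∑ m, ∑ n, ‖modGrad N w m n‖ ^ 2 ≤ B :=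
    (sum_norm_modGrad_sq_le hN w).trans
      (mul_le_mul_of_nonneg_left (h1.meanSq_le hN h) (by positivity))
  have hB0 : 0 ≤ B := le_trans (by positivity) h2
  refine ⟨Real.le_sqrt_of_sq_le ((norm_sq_le_modGrad hN h0).trans (by linarith)), fun m n =>
    Real.le_sqrt_of_sq_le ?_⟩
  have h3 := Finset.single_le_sum (f := fun m => ∑ n, ‖modGrad N w m n‖ ^ 2)
    (fun _ _ => by positivity) (Finset.mem_univ m)
  have h4 := Finset.single_le_sum (f := fun n => ‖modGrad N w m n‖ ^ 2)
    (fun _ _ => by positivity) (Finset.mem_univ n)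
  exact h4.trans (h3.trans (h2.trans (by linarith)))

/-! ### Consistency of the modified gradient -/

/-- The derivative of the tangent at 0, taken along the steps 1/N. -/
theorem tendsto_tanSymbol (ξ : Freq) (m : Fin 3) :
    Tendsto (fun N : ℕ => 2 * (N : ℝ) * tanSymbol N ξ m) atTop (𝓝 (2 * Real.pi * ξ m)) := by
  have h1 : HasDerivAt (fun s : ℝ => Real.tan (Real.pi * ξ m * s)) (Real.pi * ξ m) 0 := by
    have h2 : HasDerivAt (fun s : ℝ => Real.pi * ξ m * s) (Real.pi * ξ m) 0 := by
      simpa using (hasDerivAt_id (0 : ℝ)).const_mul (Real.pi * ξ m)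
    have h3 : HasDerivAt Real.tan 1 (Real.pi * ξ m * 0) := by
      have := Real.hasDerivAt_tan (x := Real.pi * ξ m * 0) (by simp)
      simpa using this
    have h4 := HasDerivAt.comp (0 : ℝ) h3 h2
    rw [one_mul] at h4
    exact h4
  have h4 := (hasDerivAt_iff_tendsto_slope_zero.1 h1)
  have h5 : Tendsto (fun N : ℕ => (1 : ℝ) / N) atTop (𝓝[≠] 0) := by
    rw [tendsto_nhdsWithin_iff]
    refine ⟨tendsto_one_div_atTop_nhds_zero_nat, ?_⟩
    filter_upwards [eventually_ge_atTop 1] with N hN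
    have : (N : ℝ) ≠ 0 := by exact_mod_cast (by omega : N ≠ 0)
    simp [this]
  have h6 := (h4.comp h5).const_mul 2
  rw [mul_assoc]
  refine h6.congr fun N => ?_
  simp [tanSymbol, mul_assoc, div_eq_mul_inv]

theorem eventually_mem_freqsZero {ξ : Freq} (hξ : ξ ≠ 0) :
    ∀ᶠ N : ℕ in atTop, ξ ∈ freqsZero N := by
  filter_upwards [eventually_gt_atTop (2 * ∑ m, (ξ m).natAbs)] with N hN
  refine mem_freqsZero.2 ⟨hξ, mem_freqsMinus.2 fun m => ?_⟩
  have h1 : (ξ m).natAbs ≤ ∑ m, (ξ m).natAbs :=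
    Finset.single_le_sum (f := fun m => (ξ m).natAbs) (fun _ _ => Nat.zero_le _)
      (Finset.mem_univ m)
  omega

theorem norm_fcoef_comp_le (w : H1 ℂ) (j : Fin 3) (ξ : Freq) : ‖fcoef (comp w j) ξ‖ ≤ ‖w‖ := by
  have h1 : ‖fcoef (comp w j) ξ‖ ≤ ‖(w : Jet ℂ) (j, none)‖ := by
    rw [comp, ← inner_eL2]
    refine (norm_inner_le_norm _ _).trans ?_
    rw [orthonormal_eL2.1 ξ, one_mul]
  exact h1.trans (PiLp.norm_apply_le (w : Jet ℂ) (j, none))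

/-- At a fixed frequency the two symbols differ by a vanishing amount while the coefficients of w_N
stay bounded by R. Convergence uniform in ξ is neither claimed nor needed. -/
theorem tendsto_fcoefL_modGrad_sub {w : ℕ → H1 ℂ} {R : ℝ} (hw : ∀ N, 1 ≤ N → ‖w N‖ ≤ R)
    (hsupp : ∀ N, 1 ≤ N → ∀ ξ ∉ freqsZero N, ∀ j, fcoef (comp (w N) j) ξ = 0) (m n : Fin 3)
    (ξ : Freq) :
    Tendsto (fun N => fcoefL ξ (modGrad N (w N) m n - gradL ℂ m n (w N))) atTop (𝓝 0) := by
  have hd : ∀ m, Tendsto (fun N : ℕ => ‖Complex.I * ((2 * (N : ℝ) * tanSymbol N ξ m -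
      2 * Real.pi * ξ m : ℝ) : ℂ)‖) atTop (𝓝 0) := by
    intro m
    have := ((tendsto_tanSymbol ξ m).sub_const (2 * Real.pi * ξ m)).norm
    rw [sub_self, norm_zero] at this
    refine this.congr fun N => ?_
    rw [norm_mul, Complex.norm_I, one_mul, Complex.norm_real]
  have h1 := (((hd m).add (hd n)).mul_const R).div_const 2
  rw [add_zero, zero_mul, zero_div] at h1
  refine squeeze_zero_norm' ?_ h1
  filter_upwards [eventually_ge_atTop 1] with N hN
  have hR : 0 ≤ R := (norm_nonneg _).trans (hw N hN)
  have h2 : fcoefL ξ (gradL ℂ m n (w N)) = 2 * Real.pi * Complex.I *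
      ((ξ m * fcoef (comp (w N) n) ξ + ξ n * fcoef (comp (w N) m) ξ) / 2) := by
    rw [fcoefL_apply]; exact fcoef_symL (w N) m n ξ
  by_cases hξ : ξ ∈ freqsZero N
  · have h3 : fcoefL ξ (modGrad N (w N) m n - gradL ℂ m n (w N)) =
        (Complex.I * ((2 * (N : ℝ) * tanSymbol N ξ m - 2 * Real.pi * ξ m : ℝ) : ℂ) *
          fcoef (comp (w N) n) ξ + Complex.I * ((2 * (N : ℝ) * tanSymbol N ξ n -
          2 * Real.pi * ξ n : ℝ) : ℂ) * fcoef (comp (w N) m) ξ) / 2 := by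
      rw [map_sub, fcoefL_modGrad, if_pos hξ, h2, symProd, tanC, tanC]
      push_cast
      ring
    rw [h3, norm_div, Complex.norm_ofNat, add_mul]
    refine div_le_div_of_nonneg_right ((norm_add_le _ _).trans ?_) (by norm_num)
    rw [norm_mul, norm_mul _ (fcoef (comp (w N) m) ξ)]
    exact add_le_add
      (mul_le_mul_of_nonneg_left ((norm_fcoef_comp_le _ _ _).trans (hw N hN)) (norm_nonneg _))
      (mul_le_mul_of_nonneg_left ((norm_fcoef_comp_le _ _ _).trans (hw N hN)) (norm_nonneg _))
  -- Off the support w_N has no mode, so both gradients have coefficient 0.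
  · rw [map_sub, fcoefL_modGrad, if_neg hξ, h2, hsupp N hN ξ hξ, hsupp N hN ξ hξ]
    simp only [mul_zero, add_zero, zero_div, sub_zero, norm_zero]
    positivity

/-! ### Consistency of the stress -/

/-- The strain `E + ∇ˢu` as a family of elements of `L²(Y)`. -/
def strainL2 (E : Mat ℝ) (u : H1 ℂ) (p q : Fin 3) : L2 ℂ := castM ℂ E p q • eL2 0 + gradL ℂ p q u

/-- The modified strain as a family of elements of `L²(Y)`. -/
def modStrainL2 (N : ℕ) (E : Mat ℝ) (w : H1 ℂ) (p q : Fin 3) : L2 ℂ :=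
  castM ℂ E p q • eL2 0 + modGrad N w p q

theorem coeFn_const_add (c : ℂ) (f : L2 ℂ) :
    ((c • eL2 0 + f : L2 ℂ) : Space → ℂ) =ᵐ[volume.restrict cell] fun x => c + f x := by
  filter_upwards [Lp.coeFn_add (c • eL2 0) f, Lp.coeFn_smul c (eL2 0), coeFn_eL2 0] with x h1 h2 h3
  rw [h1, Pi.add_apply, h2, Pi.smul_apply, h3, expo_zero, smul_eq_mul, mul_one]

theorem coeFn_strainL2 (E : Mat ℝ) (u : H1 ℂ) (p q : Fin 3) :
    strainL2 E u p q =ᵐ[volume.restrict cell] fun x => (castM ℂ E + symGrad u x) p q := by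
  filter_upwards [coeFn_const_add (castM ℂ E p q) (gradL ℂ p q u), coeFn_gradL u p q]
    with x h1 h2
  rw [strainL2, h1, h2]; rfl

theorem coeFn_modStrainL2 (N : ℕ) (E : Mat ℝ) (w : H1 ℂ) (p q : Fin 3) :
    modStrainL2 N E w p q =ᵐ[volume.restrict cell]
      fun x => castM ℂ E p q + symDMod N (comp w) x p q := by
  filter_upwards [coeFn_const_add (castM ℂ E p q) (modGrad N w p q), coeFn_modGrad N w p q]
    with x h1 h2
  rw [modStrainL2, h1, h2]

theorem average_const_add {N : ℕ} (hN : 1 ≤ N) (I : Idx N) (c : ℂ) {f : Space → ℂ}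
    (hf : Continuous f) : ⨍ y in voxel N I, (c + f y) = c + ⨍ y in voxel N I, f y := by
  have hv : IntegrableOn (fun _ : Space => c) (voxel N I) := integrableOn_voxel hN I continuous_const
  have h0 : ((N : ℝ) ^ 3) ≠ 0 := by positivity
  rw [setAverage_eq, setAverage_eq, integral_add hv (integrableOn_voxel hN I hf), smul_add,
    setIntegral_const, volume_real_voxel, smul_smul, inv_inv, mul_inv_cancel₀ h0, one_smul]

/-- The coefficients of the grid strain of a solution of the rescaled problem. -/
def gridCoef (N : ℕ) (w : H1 ℂ) (ξ : Freq) (j : Fin 3) : ℂ := gammaR N ξ * fcoef (comp w j) ξ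

/-- The grid strain is the voxel average of the modified strain, so `sum_mul_average_voxel` applies
with the exponential sampled at the voxel corners as part of the weight. In this form the limit N →
∞ is a pairing of a strongly with a weakly convergent factor. -/
theorem dft_gridStress_eq {N : ℕ} (hN : 1 ≤ N) (Cs : Idx N → Tensor4 ℝ) (E : Mat ℝ) (w : H1 ℂ)
    (ξ : Freq) (m n : Fin 3) :
    dft (fun I => gridStress Cs (fun I => castM ℂ E + gridStrain (gridCoef N w) I) I m n) ξ =
      ∑ p, ∑ q, ∫ x in cell, pwScalar N
        (fun I => expo (-ξ) (fun m => (I m : ℝ) / N) * (Cs I m n p q : ℂ)) x *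
          modStrainL2 N E w p q x := by
  simp only [gridStress, ddot, dft_sum]
  refine Finset.sum_congr rfl fun p _ => Finset.sum_congr rfl fun q _ => ?_
  have hF : Integrable (modStrainL2 N E w p q) (volume.restrict cell) :=
    (Lp.memLp _).integrable (by norm_num)
  rw [← sum_mul_average_voxel hN _ hF, dft]
  congr 1
  refine Finset.sum_congr rfl fun I _ => ?_
  have h1 : ⨍ x in voxel N I, (modStrainL2 N E w p q : Space → ℂ) x =
      (castM ℂ E + gridStrain (gridCoef N w) I) p q := by
    have h2 : (modStrainL2 N E w p q : Space → ℂ) =ᵐ[volume.restrict (voxel N I)]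
        fun x => castM ℂ E p q + symDMod N (comp w) x p q :=
      ae_mono (Measure.restrict_mono (voxel_subset_cell hN I) le_rfl) (coeFn_modStrainL2 N E w p q)
    rw [average_congr h2, average_const_add hN I _ (continuous_symDMod N _ p q),
      average_symDMod hN]
    rfl
  rw [h1]
  simp only [castT, Complex.coe_algebraMap]
  ring

/-- The Fourier coefficients of the stress `C : (E + ∇ˢu)`. -/
def stressCoef (C : Space → Tensor4 ℝ) (E : Mat ℝ) (u : H1 ℂ) (ξ : Freq) (m n : Fin 3) : ℂ :=
  fcoef (fun x => ddot (castT ℂ (C x)) (castM ℂ E + symGrad u x) m n) ξ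

variable {M : ℕ} {D : Fin (M + 1) → Set Space} {Λ : Fin (M + 1) → Tensor4 ℝ}
  {C : Space → Tensor4 ℝ} {Cs : ∀ N : ℕ, Idx N → Tensor4 ℝ} {a K : ℝ}

theorem IsStiffnessField.memLp_expo_mul (h : IsStiffnessField C a K) (ξ : Freq)
    (m n p q : Fin 3) :
    MemLp (fun x => expo (-ξ) x * (C x m n p q : ℂ)) 2 (volume.restrict cell) := by
  refine MemLp.of_bound ((continuous_expo _).aestronglyMeasurable.mul
    (h.memLp_coef ℂ m n p q).aestronglyMeasurable) K ?_
  filter_upwards [h.bound] with x hx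
  rw [norm_mul, norm_expo, one_mul, Complex.norm_real]
  exact hx m n p q

theorem stressCoef_eq (h : IsStiffnessField C a K) (E : Mat ℝ) (u : H1 ℂ) (ξ : Freq)
    (m n : Fin 3) :
    stressCoef C E u ξ m n =
      ∑ p, ∑ q, ∫ x in cell, (expo (-ξ) x * (C x m n p q : ℂ)) * strainL2 E u p q x := by
  have hi : ∀ p q, Integrable (fun x => (expo (-ξ) x * (C x m n p q : ℂ)) *
      strainL2 E u p q x) (volume.restrict cell) := fun p q =>
    (h.memLp_expo_mul ξ m n p q).integrable_mul (Lp.memLp _)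
  have hae : ∀ᵐ x ∂(volume.restrict cell), ∀ p q,
      (strainL2 E u p q : Space → ℂ) x = (castM ℂ E + symGrad u x) p q :=
    ae_all_iff.2 fun p => ae_all_iff.2 fun q => coeFn_strainL2 E u p q
  rw [stressCoef, fcoef, Finset.sum_congr rfl fun p _ => (integral_finsetSum _ fun q _ => hi p q).symm,
    ← integral_finsetSum _ fun p _ => integrable_finsetSum _ fun q _ => hi p q]
  refine integral_congr_ae ?_
  filter_upwards [hae] with x hx
  simp only [ddot, Finset.mul_sum, hx, castT, Complex.coe_algebraMap, mul_assoc]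

theorem norm_const_add_le {c : ℂ} {f : L2 ℂ} {R : ℝ} (hf : ‖f‖ ≤ R) :
    ‖c • eL2 0 + f‖ ≤ ‖c‖ + R := by
  refine (norm_add_le _ _).trans (add_le_add ?_ hf)
  rw [norm_smul, orthonormal_eL2.1 0, mul_one]

/-- The Fourier coefficients of the grid stress and of the continuous stress have the same
asymptotics along the solutions of the rescaled problems. -/
theorem tendsto_stress_sub (hD : IsPhaseStructure D Λ C)
    (hCs : ∀ N : ℕ, 1 ≤ N → IsVoxelImage D Λ N (Cs N)) (h : IsStiffnessField C a K)
    (hst : ∀ N : ℕ, 1 ≤ N → IsGridStiffness (Cs N) a K) {E : Mat ℝ} {w : ℕ → H1 ℂ}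
    (hw : ∀ N : ℕ, 1 ≤ N → IsRescaledSolution (Cs N) E (w N)) (ξ : Freq) (m n : Fin 3) :
    Tendsto (fun N => dft (fun I => gridStress (Cs N)
        (fun I => castM ℂ E + gridStrain (gridCoef N (w N)) I) I m n) ξ -
      stressCoef C E (w N) ξ m n) atTop (𝓝 0) := by
  obtain ⟨R, hR⟩ := exists_rescaled_bound a K E
  have hR' := fun N hN => hR N hN (Cs N) (hst N hN) (w N) (hw N hN)
  have hR0 : 0 ≤ R := (norm_nonneg _).trans (hR' 1 le_rfl).1
  have hsupp := fun N hN => ((isRescaledSolution_iff hN (hst N hN) E (w N)).1 (hw N hN)).1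
  have hg : ∀ p q, ∃ G, ∀ u : H1 ℂ, ‖gradL ℂ p q u‖ ≤ G * ‖u‖ := fun p q =>
    ⟨‖gradL ℂ p q‖, fun u => (gradL ℂ p q).le_opNorm u⟩
  have key : ∀ p q, Tendsto (fun N => (∫ x in cell, pwScalar N
        (fun I => expo (-ξ) (fun m => (I m : ℝ) / N) * (Cs N I m n p q : ℂ)) x *
          modStrainL2 N E (w N) p q x) -
      ∫ x in cell, (expo (-ξ) x * (C x m n p q : ℂ)) * strainL2 E (w N) p q x) atTop (𝓝 0) := by
    intro p q
    obtain ⟨G, hG⟩ := hg p q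
    -- One constant has to bound both families: G serves the true gradient and 1 the modified
    -- gradient.
    have hG0 : 0 ≤ max G 1 := le_max_of_le_right zero_le_one
    refine tendsto_pairing_sub (K := K) (R := ‖castM ℂ E p q‖ + max G 1 * R)
      (fun N => (measurable_pwScalar N _).aestronglyMeasurable) (fun N hN x => ?_)
      (tendsto_pwScalar hD hCs (continuous_expo (-ξ)) m n p q) (fun N hN => ?_) (fun N hN => ?_) ?_
    · have hK : 0 ≤ K := (abs_nonneg _).trans ((hst 1 le_rfl).bound 0 m n p q)
      refine norm_pwScalar_le hN hK (fun I => ?_) x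
      rw [norm_mul, norm_expo, one_mul, Complex.norm_real]
      exact (hst N hN).bound I m n p q
    · refine norm_const_add_le (((hR' N hN).2 p q).trans ?_)
      exact le_mul_of_one_le_left hR0 (le_max_right _ _)
    · refine norm_const_add_le ((hG (w N)).trans ?_)
      exact mul_le_mul (le_max_left _ _) (hR' N hN).1 (norm_nonneg _) hG0
    · intro η
      refine (tendsto_fcoefL_modGrad_sub (fun N hN => (hR' N hN).1) hsupp p q η).congr fun N => ?_
      rw [modStrainL2, strainL2, add_sub_add_left_eq_sub]
  have hsum := tendsto_finsetSum Finset.univ fun p _ =>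
    tendsto_finsetSum Finset.univ fun q _ => key p q
  simp only [Finset.sum_const_zero] at hsum
  refine hsum.congr' ?_
  filter_upwards [eventually_ge_atTop 1] with N hN
  rw [dft_gridStress_eq hN, stressCoef_eq h]
  simp only [Finset.sum_sub_distrib]

theorem stressCoef_eq_add (h : IsStiffnessField C a K) (E : Mat ℝ) (u : H1 ℂ) (ξ : Freq)
    (m n : Fin 3) : stressCoef C E u ξ m n =
      fcoef (fun x => ddot (castT ℂ (C x)) (castM ℂ E) m n) ξ + fcoefL ξ (stressL ℂ h m n u) := by
  have h1 : (h.memLp_load ℂ (castM ℂ E) m n).toLp _ + stressL ℂ h m n u =ᵐ[volume.restrict cell]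
      fun x => ddot (castT ℂ (C x)) (castM ℂ E + symGrad u x) m n := by
    filter_upwards [Lp.coeFn_add ((h.memLp_load ℂ (castM ℂ E) m n).toLp _) (stressL ℂ h m n u),
      (h.memLp_load ℂ (castM ℂ E) m n).coeFn_toLp, coeFn_stressL h u m n] with x h2 h3 h4
    rw [h2, Pi.add_apply, h3, h4, ddot_add]; rfl
  rw [stressCoef, ← fcoef_congr h1, ← fcoefL_apply, map_add, fcoefL_apply,
    fcoef_congr (h.memLp_load ℂ (castM ℂ E) m n).coeFn_toLp]

theorem exists_stressCoef_bound (h : IsStiffnessField C a K) (E : Mat ℝ) (R : ℝ) (ξ : Freq)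
    (m n : Fin 3) : ∃ B, ∀ u : H1 ℂ, ‖u‖ ≤ R → ‖stressCoef C E u ξ m n‖ ≤ B := by
  refine ⟨‖fcoef (fun x => ddot (castT ℂ (C x)) (castM ℂ E) m n) ξ‖ +
    ‖fcoefL ξ ∘L stressL ℂ h m n‖ * R, fun u hu => ?_⟩
  rw [stressCoef_eq_add h]
  refine (norm_add_le _ _).trans (add_le_add le_rfl ?_)
  exact ((fcoefL ξ ∘L stressL ℂ h m n).le_opNorm u).trans
    (mul_le_mul_of_nonneg_left hu (ContinuousLinearMap.opNorm_nonneg _))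

/-- The stresses of the solutions of the rescaled problems are asymptotically in equilibrium. -/
theorem tendsto_div_stressCoef (hD : IsPhaseStructure D Λ C)
    (hCs : ∀ N : ℕ, 1 ≤ N → IsVoxelImage D Λ N (Cs N)) (h : IsStiffnessField C a K)
    (hst : ∀ N : ℕ, 1 ≤ N → IsGridStiffness (Cs N) a K) {E : Mat ℝ} {w : ℕ → H1 ℂ}
    (hw : ∀ N : ℕ, 1 ≤ N → IsRescaledSolution (Cs N) E (w N)) (ξ : Freq) (j : Fin 3) :
    Tendsto (fun N => ∑ m, (2 * Real.pi * ξ m : ℂ) * stressCoef C E (w N) ξ m j) atTop (𝓝 0) := by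
  by_cases hξ : ξ = 0
  · simp [hξ]
  obtain ⟨R, hR⟩ := exists_rescaled_bound a K E
  have hs : ∀ m, Tendsto (fun N : ℕ => 2 * (N : ℂ) * tanC N ξ m) atTop
      (𝓝 (2 * Real.pi * ξ m)) := fun m => by
    have h1 := (Complex.continuous_ofReal.tendsto _).comp (tendsto_tanSymbol ξ m)
    simpa [tanC, Function.comp_def] using h1
  -- Two errors vanish: replacing the true symbol by the tangent symbol (here) and the continuous
  -- stress by the grid stress (`h3`). What is left is the exact discrete equilibrium at ξ,
  -- available once ξ lies in `freqsZero N`.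
  have h1 : ∀ m, Tendsto (fun N : ℕ => (2 * Real.pi * ξ m - 2 * (N : ℂ) * tanC N ξ m) *
      stressCoef C E (w N) ξ m j) atTop (𝓝 0) := by
    intro m
    obtain ⟨B, hB⟩ := exists_stressCoef_bound h E R ξ m j
    have h2 := ((hs m).const_sub (2 * Real.pi * ξ m : ℂ)).norm.mul_const B
    rw [sub_self, norm_zero, zero_mul] at h2
    refine squeeze_zero_norm' ?_ h2
    filter_upwards [eventually_ge_atTop 1] with N hN
    rw [norm_mul]
    exact mul_le_mul_of_nonneg_left (hB _ (hR N hN (Cs N) (hst N hN) _ (hw N hN)).1)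
      (norm_nonneg _)
  have h3 : ∀ m, Tendsto (fun N : ℕ => (2 * (N : ℂ) * tanC N ξ m) *
      (dft (fun I => gridStress (Cs N)
        (fun I => castM ℂ E + gridStrain (gridCoef N (w N)) I) I m j) ξ -
        stressCoef C E (w N) ξ m j)) atTop (𝓝 0) := fun m => by
    simpa using (hs m).mul (tendsto_stress_sub hD hCs h hst hw ξ m j)
  have h4 := tendsto_finsetSum Finset.univ fun m _ => (h1 m).sub (h3 m)
  simp only [sub_zero, Finset.sum_const_zero] at h4
  refine h4.congr' ?_
  filter_upwards [eventually_ge_atTop 1, eventually_mem_freqsZero hξ] with N hN hN'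
  have h5 := ((isRescaledSolution_iff hN (hst N hN) E (w N)).1 (hw N hN)).2 ξ hN' j
  have h6 : ∑ m, (2 * (N : ℂ) * tanC N ξ m) * dft (fun I => gridStress (Cs N)
      (fun I => castM ℂ E + gridStrain (gridCoef N (w N)) I) I m j) ξ = 0 := by
    simp only [mul_assoc, ← Finset.mul_sum]
    have : ∑ m, tanC N ξ m * dft (fun I => gridStress (Cs N)
      (fun I => castM ℂ E + gridStrain (gridCoef N (w N)) I) I m j) ξ = 0 := h5
    rw [this]; simp
  rw [← sub_zero (∑ m, (2 * Real.pi * ξ m : ℂ) * stressCoef C E (w N) ξ m j), ← h6,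
    ← Finset.sum_sub_distrib]
  exact Finset.sum_congr rfl fun m _ => by ring

/-! ### Equilibrium of the solution of the cell problem -/

/-- The stress of a displacement as a family of elements of `L²(Y)`. -/
def cellStress (h : IsStiffnessField C a K) (E : Mat ℝ) (u : H1 ℝ) (m n : Fin 3) : L2 ℝ :=
  loadL2 h E m n + stressL ℝ h m n u

theorem coeFn_cellStress (h : IsStiffnessField C a K) (E : Mat ℝ) (u : H1 ℝ) (m n : Fin 3) :
    cellStress h E u m n =ᵐ[volume.restrict cell]
      fun x => ddot (C x) (symGrad u x + E) m n := by
  filter_upwards [Lp.coeFn_add (loadL2 h E m n) (stressL ℝ h m n u),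
    (h.memLp_load ℝ E m n).coeFn_toLp, coeFn_stressL h u m n] with x h1 h2 h3
  rw [cellStress, h1, Pi.add_apply, loadL2, h2, h3, castT_real, ddot_add, add_comm]; rfl

theorem cellStress_ofReal (h : IsStiffnessField C a K) (E : Mat ℝ) (u : H1 ℝ) (m n : Fin 3) :
    ∀ᵐ x ∂(volume.restrict cell), ddot (castT ℂ (C x)) (castM ℂ E + symGrad (ofRealH1 u) x) m n =
      ((cellStress h E u m n : Space → ℝ) x : ℂ) := by
  have h1 : ∀ᵐ x ∂(volume.restrict cell), ∀ p q, symGrad (ofRealH1 u) x p q =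
      ((symGrad u x p q : ℝ) : ℂ) := by
    refine ae_all_iff.2 fun p => ae_all_iff.2 fun q => ?_
    filter_upwards [symL_ofReal u p q, coeFn_symL u p q, coeFn_symL (ofRealH1 u) p q]
      with x h2 h3 h4
    rw [← h4, h2, h3]
  filter_upwards [h1, coeFn_cellStress h E u m n] with x h2 h3
  have h4 : castM ℂ E + symGrad (ofRealH1 u) x = castM ℂ (symGrad u x + E) := by
    ext p q
    simp only [Matrix.add_apply, h2, castM]
    push_cast
    exact add_comm _ _
  rw [h4, ddot_cast, h3]

theorem integral_pderiv_mul_cellStress (h : IsStiffnessField C a K) {E : Mat ℝ} {u : H1 ℝ}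
    (hu : IsCellSolution C E u) {f : Space → ℝ} (hf : IsSmoothPeriodic f) (j : Fin 3) :
    ∫ x in cell, ∑ m, pderiv m f x * cellStress h E u m j x = 0 := by
  have h1 := hu.2 (scalarField hf j)
  rw [integral_mdot_stress h, integral_mdot_load h] at h1
  have h2 : ∑ m, ∑ n, inner ℝ (gradL ℝ m n (scalarField hf j)) (cellStress h E u m n) = 0 := by
    simp only [cellStress, inner_add_right, Finset.sum_add_distrib, h1, add_neg_cancel]
  rw [sum_inner_eq_integral] at h2
  rw [← h2]
  refine integral_congr_ae ?_
  have h3 : ∀ᵐ x ∂(volume.restrict cell), ∀ m n,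
      (gradL ℝ m n (scalarField hf j) : Space → ℝ) x = symGrad (scalarField hf j) x m n ∧
        (cellStress h E u m n : Space → ℝ) x = ddot (C x) (symGrad u x + E) m n :=
    ae_all_iff.2 fun m => ae_all_iff.2 fun n =>
      (coeFn_gradL (scalarField hf j) m n).and (coeFn_cellStress h E u m n)
  filter_upwards [h3, symGrad_scalarField hf j, h.symm] with x h4 h5 h6
  simp only [(h4 _ _).1, (h4 _ _).2, h5, star_trivial]
  exact (sum_pairing_single (fun m => pderiv m f x) (fun m n => ddot_symm (𝕜 := ℝ) h6 _ m n) j).symm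

theorem div_stressCoef_cell (h : IsStiffnessField C a K) {E : Mat ℝ} {u : H1 ℝ}
    (hu : IsCellSolution C E u) (ξ : Freq) (j : Fin 3) :
    ∑ m, (2 * Real.pi * ξ m : ℂ) * stressCoef C E (ofRealH1 u) ξ m j = 0 := by
  have hi : ∀ m, Integrable (fun x => expo (-ξ) x * ((cellStress h E u m j : Space → ℝ) x : ℂ))
      (volume.restrict cell) := fun m =>
    (memLp_of_continuous (continuous_expo (-ξ))).integrable_mul (Lp.memLp _).ofReal
  have h1 : ∀ m, stressCoef C E (ofRealH1 u) ξ m j =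
      ∫ x in cell, expo (-ξ) x * ((cellStress h E u m j : Space → ℝ) x : ℂ) := fun m =>
    fcoef_congr (cellStress_ofReal h E u m j) ξ
  have hp : ∀ m x, pderiv m (expo (-ξ)) x = -(Complex.I * (2 * Real.pi * ξ m : ℂ)) *
      expo (-ξ) x := fun m x => by
    rw [pderiv_expo]; push_cast [Pi.neg_apply]; ring
  have hF : ∫ x in cell, ∑ m, pderiv m (expo (-ξ)) x *
      ((cellStress h E u m j : Space → ℝ) x : ℂ) = 0 := by
    have hint : Integrable (fun x => ∑ m, pderiv m (expo (-ξ)) x *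
        ((cellStress h E u m j : Space → ℝ) x : ℂ)) (volume.restrict cell) := by
      refine integrable_finsetSum _ fun m _ => ?_
      simp only [hp, mul_assoc]
      exact (hi m).const_mul _
    -- The cell problem admits only real test fields, so the exponential is tested through its real
    -- and imaginary parts; the stress is real and passes through L.
    have hL : ∀ L : ℂ →L[ℝ] ℝ, (∀ (z : ℂ) (r : ℝ), L (z * r) = L z * r) →
        L (∫ x in cell, ∑ m, pderiv m (expo (-ξ)) x *
          ((cellStress h E u m j : Space → ℝ) x : ℂ)) = 0 := by
      intro L hL
      have hf : IsSmoothPeriodic (fun x => L (expo (-ξ) x)) :=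
        ⟨L.contDiff.comp (isSmoothPeriodic_expo (-ξ)).1, fun m x => by
          simp only [(isSmoothPeriodic_expo (-ξ)).2 m x]⟩
      have hd : ∀ m x, pderiv m (fun x => L (expo (-ξ) x)) x = L (pderiv m (expo (-ξ)) x) := by
        intro m x
        have h2 := ((isSmoothPeriodic_expo (-ξ)).1.differentiable (by simp) x).hasFDerivAt
        have h3 := (L.hasFDerivAt.comp x h2).fderiv
        have h4 : (L ∘ expo (-ξ)) = fun x => L (expo (-ξ) x) := rfl
        rw [h4] at h3
        simp [pderiv, h3]
      rw [← L.integral_comp_comm hint, ← integral_pderiv_mul_cellStress h hu hf j]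
      refine integral_congr_ae (Eventually.of_forall fun x => ?_)
      simp only [map_sum, hL, hd]
    exact Complex.ext (hL Complex.reCLM fun z r => by simp) (hL Complex.imCLM fun z r => by simp)
  simp only [hp] at hF
  simp only [h1]
  have h2 : ∫ x in cell, ∑ m, -(Complex.I * (2 * Real.pi * ξ m : ℂ)) * expo (-ξ) x *
      ((cellStress h E u m j : Space → ℝ) x : ℂ) =
      -Complex.I * ∑ m, (2 * Real.pi * ξ m : ℂ) *
        ∫ x in cell, expo (-ξ) x * ((cellStress h E u m j : Space → ℝ) x : ℂ) := by
    rw [integral_finsetSum _ fun m _ => by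
      simp only [mul_assoc]; exact (hi m).const_mul _, Finset.mul_sum]
    refine Finset.sum_congr rfl fun m _ => ?_
    simp only [mul_assoc, neg_mul]
    simp only [integral_neg, integral_const_mul]
  rw [h2] at hF
  exact (mul_eq_zero.1 hF).resolve_left (by simp)

/-! ### Weak convergence of the rescaled solutions -/

theorem gradL_mode (ξ : Freq) (j m n : Fin 3) : gradL ℂ m n (mode ξ j) =
    (((if n = j then 2 * Real.pi * Complex.I * ξ m else 0) +
      if m = j then 2 * Real.pi * Complex.I * ξ n else 0) / 2) • eL2 ξ := by
  change symL ℂ m n (modeJet ξ j) = _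
  rw [symL_apply, div_eq_inv_mul, mul_smul, add_smul, modeJet]
  congr 2 <;> (dsimp only; split_ifs <;> simp [modeCoef])

/-- For mean-zero z the auxiliary mean value term of `energyL` disappears, and pairing with a mode
reads off the divergence of the stress at that frequency. -/
theorem inner_mode_energyL (h : IsStiffnessField C a K) {z : H1 ℂ}
    (hz : ∀ j, fcoef (comp z j) 0 = 0) (ξ : Freq) (j : Fin 3) :
    inner ℂ (mode ξ j) (energyL ℂ h z) =
      -Complex.I * ∑ m, (2 * Real.pi * ξ m : ℂ) * fcoefL ξ (stressL ℂ h m j z) := by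
  have hm : ∀ i, meanL ℂ i z = 0 := fun i => by rw [meanL_apply, ← fcoef_zero, hz]
  have hS : ∀ m n, fcoefL ξ (stressL ℂ h m n z) = fcoefL ξ (stressL ℂ h n m z) := by
    intro m n
    congr 1
    refine Lp.ext ?_
    filter_upwards [coeFn_stressL h z m n, coeFn_stressL h z n m, h.symm] with x h1 h2 h3
    rw [h1, h2, ddot_symm h3]
  rw [inner_energyL]
  simp only [hm, mul_zero, Finset.sum_const_zero, add_zero, gradL_mode, inner_smul_left]
  have h2 : ∀ m n, inner ℂ (eL2 ξ) (stressL ℂ h m n z) = fcoefL ξ (stressL ℂ h m n z) :=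
    fun _ _ => rfl
  simp only [h2]
  rw [Finset.mul_sum]
  have h3 := sum_pairing_single (fun m => -(2 * Real.pi * Complex.I * ξ m) : Fin 3 → ℂ) hS j
  have h4 : ∀ m n, (starRingEnd ℂ) (((if n = j then 2 * Real.pi * Complex.I * (ξ m : ℂ) else 0) +
      if m = j then 2 * Real.pi * Complex.I * (ξ n : ℂ) else 0) / 2) =
      ((if n = j then -(2 * Real.pi * Complex.I * ξ m : ℂ) else 0) +
        if m = j then -(2 * Real.pi * Complex.I * ξ n : ℂ) else 0) / 2 := by
    intro m n
    split_ifs <;> simp [map_ofNat (starRingEnd ℂ) 2]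
  simp only [h4]
  refine h3.trans (Finset.sum_congr rfl fun m _ => ?_)
  ring

/-- With A the energy operator, ⟨A* mode, w_N − u⟩ = ⟨mode, A(w_N − u)⟩ is a divergence coefficient
of the difference of the stresses, and this tends to 0. Boundedness extends the limit from the
vectors A* mode to all y, without extracting subsequences. -/
theorem tendsto_inner_rescaled_sub (hD : IsPhaseStructure D Λ C)
    (hCs : ∀ N : ℕ, 1 ≤ N → IsVoxelImage D Λ N (Cs N)) (h : IsStiffnessField C a K)
    (hst : ∀ N : ℕ, 1 ≤ N → IsGridStiffness (Cs N) a K) {E : Mat ℝ} {u : H1 ℝ}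
    (hu : IsCellSolution C E u) {w : ℕ → H1 ℂ}
    (hw : ∀ N : ℕ, 1 ≤ N → IsRescaledSolution (Cs N) E (w N)) (y : H1 ℂ) :
    Tendsto (fun N => inner ℂ y (w N - ofRealH1 u)) atTop (𝓝 0) := by
  obtain ⟨R, hR⟩ := exists_rescaled_bound a K E
  refine tendsto_inner_zero_of_dense (R := R + ‖ofRealH1 u‖)
    (S := Set.range fun p : Freq × Fin 3 => (energyL ℂ h).adjoint (mode p.1 p.2)) ?_ ?_ ?_ y
  · filter_upwards [eventually_ge_atTop 1] with N hN
    exact (norm_sub_le _ _).trans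
      (add_le_add (hR N hN (Cs N) (hst N hN) (w N) (hw N hN)).1 le_rfl)
  -- If z is orthogonal to every A* mode, then Az is orthogonal to every mode, so Az = 0 and z = 0
  -- by injectivity.
  · rw [Submodule.topologicalClosure_eq_top_iff, Submodule.eq_bot_iff]
    intro z hz
    refine energyL_injective_complex h ?_
    have h1 : energyL ℂ h z ∈
        (Submodule.span ℂ (Set.range fun p : Freq × Fin 3 => mode p.1 p.2))ᗮ := by
      rw [Submodule.mem_orthogonal]
      intro v hv
      induction hv using Submodule.span_induction with
      | mem x hx =>
        obtain ⟨p, rfl⟩ := hx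
        rw [← ContinuousLinearMap.adjoint_inner_left]
        exact (Submodule.mem_orthogonal _ _).1 hz _ (Submodule.subset_span ⟨p, rfl⟩)
      | zero => exact inner_zero_left _
      | add x y _ _ hx hy => rw [inner_add_left, hx, hy, add_zero]
      | smul c x _ hx => rw [inner_smul_left, hx, mul_zero]
    rw [(Submodule.topologicalClosure_eq_top_iff).1 span_mode_dense] at h1
    exact (Submodule.mem_bot ℂ).1 h1
  · rintro _ ⟨⟨ξ, j⟩, rfl⟩
    have h1 := (tendsto_div_stressCoef hD hCs h hst hw ξ j).const_mul (-Complex.I)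
    rw [mul_zero] at h1
    refine h1.congr' ?_
    filter_upwards [eventually_ge_atTop 1] with N hN
    have hs := ((isRescaledSolution_iff hN (hst N hN) E (w N)).1 (hw N hN)).1
    have hz : ∀ i, fcoef (comp (w N - ofRealH1 u) i) 0 = 0 := by
      intro i
      rw [fcoef_comp_eq, map_sub, ← fcoef_comp_eq, ← fcoef_comp_eq, fcoef_zero_ofReal, hu.1 i,
        hs 0 fun h0 => (mem_freqsZero.1 h0).1 rfl]
      simp
    rw [ContinuousLinearMap.adjoint_inner_left, inner_mode_energyL h hz]
    congr 1
    -- The limit's own equilibrium is subtracted, so that the macroscopic load cancels and only the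
    -- stress of w_N − u remains.
    rw [← sub_zero (∑ m, (2 * Real.pi * ξ m : ℂ) * stressCoef C E (w N) ξ m j),
      ← div_stressCoef_cell h hu ξ j, ← Finset.sum_sub_distrib]
    refine Finset.sum_congr rfl fun m _ => ?_
    rw [stressCoef_eq_add h, stressCoef_eq_add h, map_sub, map_sub]
    ring

/-- The solutions of the rescaled problems converge weakly to the solution of the cell problem. -/
theorem tendsto_toWeakSpace_rescaled (hD : IsPhaseStructure D Λ C)
    (hCs : ∀ N : ℕ, 1 ≤ N → IsVoxelImage D Λ N (Cs N)) (h : IsStiffnessField C a K)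
    (hst : ∀ N : ℕ, 1 ≤ N → IsGridStiffness (Cs N) a K) {E : Mat ℝ} {u : H1 ℝ}
    (hu : IsCellSolution C E u) {w : ℕ → H1 ℂ}
    (hw : ∀ N : ℕ, 1 ≤ N → IsRescaledSolution (Cs N) E (w N)) :
    Tendsto (fun N => toWeakSpace ℂ (H1 ℂ) (w N)) atTop
      (𝓝 (toWeakSpace ℂ (H1 ℂ) (ofRealH1 u))) := by
  -- The weak topology is induced by evaluation at continuous functionals, and each of these is an
  -- inner product by Riesz.
  have hind : IsInducing fun (x : WeakSpace ℂ (H1 ℂ)) (l : StrongDual ℂ (H1 ℂ)) =>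
    (topDualPairing ℂ (H1 ℂ)).flip x l := ⟨rfl⟩
  rw [hind.tendsto_nhds_iff, tendsto_pi_nhds]
  intro l
  have h1 := (tendsto_inner_rescaled_sub hD hCs h hst hu hw
    ((InnerProductSpace.toDual ℂ (H1 ℂ)).symm l)).add_const (l (ofRealH1 u))
  rw [zero_add] at h1
  refine h1.congr fun N => ?_
  rw [InnerProductSpace.toDual_symm_apply, map_sub, sub_add_cancel]
  rfl

/-- At fixed ξ the coefficient is a continuous affine functional of the displacement, so weak
convergence is enough. -/
theorem tendsto_stressCoef (hD : IsPhaseStructure D Λ C)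
    (hCs : ∀ N : ℕ, 1 ≤ N → IsVoxelImage D Λ N (Cs N)) (h : IsStiffnessField C a K)
    (hst : ∀ N : ℕ, 1 ≤ N → IsGridStiffness (Cs N) a K) {E : Mat ℝ} {u : H1 ℝ}
    (hu : IsCellSolution C E u) {w : ℕ → H1 ℂ}
    (hw : ∀ N : ℕ, 1 ≤ N → IsRescaledSolution (Cs N) E (w N)) (ξ : Freq) (m n : Fin 3) :
    Tendsto (fun N => stressCoef C E (w N) ξ m n) atTop (𝓝 (stressCoef C E (ofRealH1 u) ξ m n)) := by
  have h1 := (tendsto_inner_rescaled_sub hD hCs h hst hu hw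
    ((InnerProductSpace.toDual ℂ (H1 ℂ)).symm (fcoefL ξ ∘L stressL ℂ h m n))).add_const
      (stressCoef C E (ofRealH1 u) ξ m n)
  rw [zero_add] at h1
  refine h1.congr fun N => ?_
  rw [InnerProductSpace.toDual_symm_apply, map_sub, stressCoef_eq_add h, stressCoef_eq_add h]
  simp only [ContinuousLinearMap.comp_apply]
  ring

/-! ### Tensors given by a linear response -/

/-- The symmetric matrix units. -/
def symUnit (p q : Fin 3) : Mat ℝ := (2⁻¹ : ℝ) • (Matrix.single p q 1 + Matrix.single q p 1)

theorem symUnit_comm (p q : Fin 3) : symUnit p q = symUnit q p := by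
  rw [symUnit, symUnit, add_comm]

theorem symUnit_isSymm (p q : Fin 3) : (symUnit p q).IsSymm := by
  rw [Matrix.IsSymm, symUnit, Matrix.transpose_smul, Matrix.transpose_add,
    Matrix.transpose_single, Matrix.transpose_single, add_comm]

theorem ddot_single (T : Tensor4 ℝ) (p q m n : Fin 3) :
    ddot T (Matrix.single p q 1) m n = T m n p q := by
  simp only [ddot, Matrix.single_apply]
  rw [Finset.sum_eq_single p (fun i _ hi => by simp [hi.symm]) (by simp),
    Finset.sum_eq_single q (fun i _ hi => by simp [hi.symm]) (by simp)]
  simp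

theorem ddot_symUnit {T : Tensor4 ℝ} (hT : ∀ m n p q, T m n p q = T m n q p) (p q m n : Fin 3) :
    ddot T (symUnit p q) m n = T m n p q := by
  rw [symUnit, ddot_smul, ddot_add, Matrix.smul_apply, Matrix.add_apply, ddot_single, ddot_single,
    hT m n q p, smul_eq_mul]
  ring

theorem sum_smul_symUnit {E : Mat ℝ} (hE : E.IsSymm) : ∑ p, ∑ q, E p q • symUnit p q = E := by
  have h1 : ∑ p, ∑ q, E p q • (Matrix.single p q 1 : Mat ℝ) = E := by
    conv_rhs => rw [Matrix.matrix_eq_sum_single E]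
    simp [Matrix.smul_single]
  have h2 : ∑ p, ∑ q, E p q • (Matrix.single q p 1 : Mat ℝ) = E := by
    rw [Finset.sum_comm]
    conv_rhs => rw [← h1]
    simp only [hE.apply]
  simp only [symUnit, smul_comm (E _ _) (2⁻¹ : ℝ), ← Finset.smul_sum, smul_add,
    Finset.sum_add_distrib, h1, h2]
  rw [← add_smul]
  norm_num

/-- A linear relation between symmetric matrices and matrices which is the graph of a map is given
by a unique tensor that is symmetric in its last two indices. -/
theorem existsUnique_tensor {P : Mat ℝ → Mat ℝ → Prop}
    (hex : ∀ E : Mat ℝ, E.IsSymm → ∃ G, P E G)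
    (huniq : ∀ E : Mat ℝ, E.IsSymm → ∀ G G', P E G → P E G' → G = G')
    (hadd : ∀ E E' G G', P E G → P E' G' → P (E + E') (G + G'))
    (hsmul : ∀ (c : ℝ) E G, P E G → P (c • E) (c • G)) :
    ∃! T : Tensor4 ℝ, (∀ m n p q, T m n p q = T m n q p) ∧
      ∀ E : Mat ℝ, E.IsSymm → P E (ddot T E) := by
  choose! Φ hΦ using hex
  have hzero : P 0 0 := by
    simpa using hsmul 0 _ _ (hΦ 0 Matrix.isSymm_zero)
  have hsum : ∀ (s : Finset (Fin 3)) (A B : Fin 3 → Mat ℝ), (∀ i ∈ s, P (A i) (B i)) →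
      P (∑ i ∈ s, A i) (∑ i ∈ s, B i) := by
    intro s A B
    induction s using Finset.induction_on with
    | empty => intro _; simpa using hzero
    | insert i s hi ih =>
      intro h
      rw [Finset.sum_insert hi, Finset.sum_insert hi]
      exact hadd _ _ _ _ (h i (Finset.mem_insert_self i s))
        (ih fun j hj => h j (Finset.mem_insert_of_mem hj))
  -- The tensor is read off on symmetric matrix units. Expanding E in them and using the closure of
  -- P under linear combinations avoids proving that Φ is linear.
  refine ⟨fun m n p q => Φ (symUnit p q) m n, ⟨fun m n p q =>
    congrFun (congrFun (congrArg Φ (symUnit_comm p q)) m) n,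
    fun E hE => ?_⟩, fun T hT => ?_⟩
  · have h1 : P (∑ p, ∑ q, E p q • symUnit p q) (∑ p, ∑ q, E p q • Φ (symUnit p q)) :=
      hsum _ _ _ fun p _ => hsum _ _ _ fun q _ => hsmul _ _ _ (hΦ _ (symUnit_isSymm p q))
    rw [sum_smul_symUnit hE] at h1
    convert! h1 using 1
    ext m n
    simp only [ddot, Matrix.sum_apply, Matrix.smul_apply, smul_eq_mul, mul_comm]
  · ext m n p q
    rw [← ddot_symUnit hT.1 p q m n]
    exact congrFun (congrFun (huniq _ (symUnit_isSymm p q) _ _ (hT.2 _ (symUnit_isSymm p q))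
      (hΦ _ (symUnit_isSymm p q))) m) n

/-! ### The effective tensor of the cell problem -/

theorem loadL2_add (h : IsStiffnessField C a K) (E F : Mat ℝ) (m n : Fin 3) :
    loadL2 h (E + F) m n = loadL2 h E m n + loadL2 h F m n := by
  rw [loadL2, loadL2, loadL2, ← MemLp.toLp_add]
  exact MemLp.toLp_congr _ _ (Eventually.of_forall fun x =>
    congrFun (congrFun (ddot_add _ E F) m) n)

theorem loadL2_smul (h : IsStiffnessField C a K) (c : ℝ) (E : Mat ℝ) (m n : Fin 3) :
    loadL2 h (c • E) m n = c • loadL2 h E m n := by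
  rw [loadL2, loadL2, ← MemLp.toLp_const_smul]
  exact MemLp.toLp_congr _ _ (Eventually.of_forall fun x =>
    congrFun (congrFun (ddot_smul _ c E) m) n)

theorem cellRhs_add (h : IsStiffnessField C a K) (E F : Mat ℝ) :
    cellRhs h (E + F) = cellRhs h E + cellRhs h F := by
  simp only [cellRhs, loadL2_add, map_add, Finset.sum_add_distrib, neg_add]

theorem cellRhs_smul (h : IsStiffnessField C a K) (c : ℝ) (E : Mat ℝ) :
    cellRhs h (c • E) = c • cellRhs h E := by
  simp only [cellRhs, loadL2_smul, map_smul, ← Finset.smul_sum, smul_neg]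

theorem cellStress_add (h : IsStiffnessField C a K) (E F : Mat ℝ) (u v : H1 ℝ) (m n : Fin 3) :
    cellStress h (E + F) (u + v) m n = cellStress h E u m n + cellStress h F v m n := by
  rw [cellStress, cellStress, cellStress, loadL2_add, map_add]
  abel

theorem cellStress_smul (h : IsStiffnessField C a K) (c : ℝ) (E : Mat ℝ) (u : H1 ℝ)
    (m n : Fin 3) : cellStress h (c • E) (c • u) m n = c • cellStress h E u m n := by
  rw [cellStress, cellStress, loadL2_smul, map_smul, smul_add]

theorem integral_cellStress (h : IsStiffnessField C a K) (E : Mat ℝ) (u : H1 ℝ) (m n : Fin 3) :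
    ∫ x in cell, ddot (C x) (symGrad u x + E) m n = ∫ x in cell, cellStress h E u m n x :=
  integral_congr_ae (coeFn_cellStress h E u m n).symm

theorem existsUnique_isEffective (h : IsStiffnessField C a K) :
    ∃! T : Tensor4 ℝ, IsEffective C T := by
  have hint : ∀ f : L2 ℝ, Integrable f (volume.restrict cell) := fun f =>
    (Lp.memLp f).integrable (by norm_num)
  refine existsUnique_tensor (P := fun E G => ∃ u, IsCellSolution C E u ∧
    ∀ m n, G m n = ∫ x in cell, ddot (C x) (symGrad u x + E) m n) ?_ ?_ ?_ ?_
  · intro E _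
    obtain ⟨u, hu, _⟩ := existsUnique_isCellSolution h E
    exact ⟨fun m n => ∫ x in cell, ddot (C x) (symGrad u x + E) m n, u, hu, fun _ _ => rfl⟩
  · rintro E _ G G' ⟨u, hu, hG⟩ ⟨v, hv, hG'⟩
    rw [(existsUnique_isCellSolution h E).unique hv hu] at hG'
    ext m n
    rw [hG, hG']
  · rintro E E' G G' ⟨u, hu, hG⟩ ⟨v, hv, hG'⟩
    rw [isCellSolution_iff h] at hu hv
    refine ⟨u + v, (isCellSolution_iff h _ _).2 ?_, fun m n => ?_⟩
    · rw [map_add, hu, hv, cellRhs_add]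
    · rw [Matrix.add_apply, hG, hG', integral_cellStress h, integral_cellStress h,
        integral_cellStress h, cellStress_add, integral_congr_ae (Lp.coeFn_add _ _)]
      exact (integral_add (hint _) (hint _)).symm
  · rintro c E G ⟨u, hu, hG⟩
    rw [isCellSolution_iff h] at hu
    refine ⟨c • u, (isCellSolution_iff h _ _).2 ?_, fun m n => ?_⟩
    · rw [map_smul, hu, cellRhs_smul]
    · rw [Matrix.smul_apply, hG, integral_cellStress h, integral_cellStress h, cellStress_smul,
        integral_congr_ae (Lp.coeFn_smul _ _)]
      exact (integral_const_mul c _).symm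

/-! ### The effective tensor of the scheme -/

theorem IsWillotStrain.add {N : ℕ} {Cs : Idx N → Tensor4 ℝ} {Cref : Tensor4 ℝ} {E F : Mat ℝ}
    {ε η : Idx N → Mat ℝ} (hε : IsWillotStrain Cs Cref E ε) (hη : IsWillotStrain Cs Cref F η) :
    IsWillotStrain Cs Cref (E + F) (ε + η) := by
  refine ⟨fun I => (hε.1 I).add (hη.1 I), fun ξ hξ m n => ?_⟩
  simp only [Pi.add_apply, Matrix.add_apply, Complex.ofReal_add, dft_add, hε.2 ξ hξ, hη.2 ξ hξ,
    ddot_add]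
  split_ifs
  · rfl
  · rw [← neg_add]
    exact congrArg Neg.neg (congrFun (congrFun (ddot_add (green Cref (kW N ξ)) _ _).symm m) n)
  · exact add_zero 0

theorem IsWillotStrain.smul {N : ℕ} {Cs : Idx N → Tensor4 ℝ} {Cref : Tensor4 ℝ} {E : Mat ℝ}
    {ε : Idx N → Mat ℝ} (c : ℝ) (hε : IsWillotStrain Cs Cref E ε) :
    IsWillotStrain Cs Cref (c • E) (c • ε) := by
  refine ⟨fun I => (hε.1 I).smul c, fun ξ hξ m n => ?_⟩
  simp only [Pi.smul_apply, Matrix.smul_apply, smul_eq_mul, Complex.ofReal_mul, dft_const_mul,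
    hε.2 ξ hξ, ddot_smul]
  split_ifs
  · rfl
  · rw [mul_neg]
    exact congrArg Neg.neg (congrFun (congrFun (ddot_smul (green Cref (kW N ξ)) (c : ℂ) _).symm m) n)
  · exact mul_zero _

theorem existsUnique_isWillotEffective {N : ℕ} (hN : 1 ≤ N) {Cs : Idx N → Tensor4 ℝ}
    (h : IsGridStiffness Cs a K) {Cref : Tensor4 ℝ} (hCref : IsElasticMedium Cref) :
    ∃! T : Tensor4 ℝ, IsWillotEffective Cs Cref T := by
  refine existsUnique_tensor (P := fun E G => ∃ ε, IsWillotStrain Cs Cref E ε ∧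
    G = ((N : ℝ) ^ 3)⁻¹ • ∑ I, ddot (Cs I) (ε I)) ?_ ?_ ?_ ?_
  · intro E hE
    obtain ⟨ε, hε, _⟩ := existsUnique_isWillotStrain hN h hCref hE
    exact ⟨_, ε, hε, rfl⟩
  · rintro E hE G G' ⟨ε, hε, rfl⟩ ⟨η, hη, rfl⟩
    rw [(existsUnique_isWillotStrain hN h hCref hE).unique hη hε]
  · rintro E E' G G' ⟨ε, hε, rfl⟩ ⟨η, hη, rfl⟩
    refine ⟨ε + η, hε.add hη, ?_⟩
    simp only [Pi.add_apply, ddot_add, Finset.sum_add_distrib, smul_add]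
  · rintro c E G ⟨ε, hε, rfl⟩
    refine ⟨c • ε, hε.smul c, ?_⟩
    simp only [Pi.smul_apply, ddot_smul, ← Finset.smul_sum, smul_comm c]

/-! ### Convergence of the effective tensors -/

/-- The mean stress of the scheme in terms of the solution of the rescaled problem. -/
theorem mean_willotStress {N : ℕ} (hN : 1 ≤ N) {Cs : Idx N → Tensor4 ℝ}
    (h : IsGridStiffness Cs a K) {Cref : Tensor4 ℝ} (hCref : IsElasticMedium Cref) {E : Mat ℝ}
    (hE : E.IsSymm) {ε : Idx N → Mat ℝ} (hε : IsWillotStrain Cs Cref E ε) {w : H1 ℂ}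
    (hw : IsRescaledSolution Cs E w) (m n : Fin 3) :
    (((((N : ℝ) ^ 3)⁻¹ • ∑ I, ddot (Cs I) (ε I)) m n : ℝ) : ℂ) =
      dft (fun I => gridStress Cs (fun I => castM ℂ E + gridStrain (gridCoef N w) I) I m n) 0 := by
  obtain ⟨c, hc, hεc⟩ := (isWillotStrain_iff hN h hCref hE ε).1 hε
  -- Both coefficient families solve the same grid system, which has only one solution on `freqsZero
  -- N`.
  have h1 : gridStrain (N := N) c = gridStrain (gridCoef N w) :=
    gridStrain_congr (hc.unique hN h ((isRescaledSolution_iff hN h E w).1 hw).2)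
  rw [← h1, dft, Matrix.smul_apply, Matrix.sum_apply, smul_eq_mul]
  push_cast
  congr 1
  refine Finset.sum_congr rfl fun I _ => ?_
  rw [gridStress, ← hεc, ddot_cast, neg_zero, expo_zero, mul_one]

/-- The effective tensors of the scheme converge to the effective tensor. -/
theorem tendsto_willotEffective (hD : IsPhaseStructure D Λ C)
    (hCs : ∀ N : ℕ, 1 ≤ N → IsVoxelImage D Λ N (Cs N)) (h : IsStiffnessField C a K)
    (hst : ∀ N : ℕ, 1 ≤ N → IsGridStiffness (Cs N) a K) {Cref : Tensor4 ℝ}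
    (hCref : IsElasticMedium Cref) {Ceff : Tensor4 ℝ} (hCeff : IsEffective C Ceff)
    {CeffN : ℕ → Tensor4 ℝ} (hCeffN : ∀ N : ℕ, 1 ≤ N → IsWillotEffective (Cs N) Cref (CeffN N)) :
    Tendsto CeffN atTop (𝓝 Ceff) := by
  simp only [tendsto_pi_nhds]
  intro m n p q
  have hE := symUnit_isSymm p q
  obtain ⟨u, hu, hmean⟩ := hCeff.2 _ hE
  -- Loading with a symmetric matrix unit makes the mean stress a column of the effective tensor.
  -- The field 0 is a dummy value at N = 0.
  have hex : ∀ N, ∃ w, 1 ≤ N → IsRescaledSolution (Cs N) (symUnit p q) w := by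
    intro N
    by_cases hN : 1 ≤ N
    · obtain ⟨w, hw, _⟩ := existsUnique_isRescaledSolution hN (hst N hN) (symUnit p q)
      exact ⟨w, fun _ => hw⟩
    · exact ⟨0, fun h' => absurd h' hN⟩
  choose w hw using hex
  -- Frequency 0 picks out mean stresses: the grid mean is asymptotic to that of C : (E + ∇ˢw_N),
  -- which converges by weak convergence.
  have h1 := (tendsto_stress_sub hD hCs h hst hw 0 m n).add
    (tendsto_stressCoef hD hCs h hst hu hw 0 m n)
  have h2 : stressCoef C (symUnit p q) (ofRealH1 u) 0 m n = ((Ceff m n p q : ℝ) : ℂ) := by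
    rw [← ddot_symUnit hCeff.1, hmean, integral_cellStress h, ← integral_complex_ofReal,
      stressCoef, fcoef_zero]
    exact integral_congr_ae (cellStress_ofReal h _ u m n)
  rw [h2, zero_add] at h1
  have h3 := (Complex.continuous_re.tendsto _).comp h1
  rw [Complex.ofReal_re] at h3
  refine h3.congr' ?_
  filter_upwards [eventually_ge_atTop 1] with N hN
  obtain ⟨ε, hε, hεm⟩ := (hCeffN N hN).2 _ hE
  rw [Function.comp_apply, sub_add_cancel,
    ← mean_willotStress hN (hst N hN) hCref hE hε (hw N hN), Complex.ofReal_re, ← hεm,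
    ddot_symUnit (hCeffN N hN).1]

end Willot

end

/-! ### The main theorem -/

open Willot in
theorem mainTheorem3 {M : ℕ} (D : Fin (M + 1) → Set Space) (Λ : Fin (M + 1) → Tensor4 ℝ)
    (C : Space → Tensor4 ℝ) (Cs : ∀ N : ℕ, Idx N → Tensor4 ℝ) (Cref : Tensor4 ℝ)
    (hD : IsPhaseStructure D Λ C) (hΛ : IsUniformlyElastic Λ)
    (hCs : ∀ N : ℕ, 1 ≤ N → IsVoxelImage D Λ N (Cs N))
    (hCref : IsElasticMedium Cref) :
    -- the cell problem and the effective tensor are well posed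
    (∀ E : Mat ℝ, E.IsSymm → ∃! u : H1 ℝ, IsCellSolution C E u) ∧
    (∃! T : Tensor4 ℝ, IsEffective C T) ∧
    -- the scheme and its effective tensor are well posed
    (∀ N : ℕ, 1 ≤ N → ∀ E : Mat ℝ, E.IsSymm → ∃! ε, IsWillotStrain (Cs N) Cref E ε) ∧
    (∀ N : ℕ, 1 ≤ N → ∃! T : Tensor4 ℝ, IsWillotEffective (Cs N) Cref T) ∧
    -- the rescaled problem has a unique solution
    (∀ E : Mat ℝ, E.IsSymm → ∀ N : ℕ, 1 ≤ N → ∃! w : H1 ℂ, IsRescaledSolution (Cs N) E w) ∧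
    -- its solutions converge weakly to the solution of the cell problem
    (∀ E : Mat ℝ, E.IsSymm → ∀ u : H1 ℝ, IsCellSolution C E u →
      ∀ w : ℕ → H1 ℂ, (∀ N : ℕ, 1 ≤ N → IsRescaledSolution (Cs N) E (w N)) →
        Tendsto (fun N => toWeakSpace ℂ (H1 ℂ) (w N)) atTop
          (𝓝 (toWeakSpace ℂ (H1 ℂ) (ofRealH1 u)))) ∧
    -- the effective tensors of the scheme converge to the effective tensor
    (∀ Ceff : Tensor4 ℝ, IsEffective C Ceff →
      ∀ CeffN : ℕ → Tensor4 ℝ, (∀ N : ℕ, 1 ≤ N → IsWillotEffective (Cs N) Cref (CeffN N)) →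
        Tendsto CeffN atTop (𝓝 Ceff)) := by
  obtain ⟨hsymm, a, b, ha, -, hab⟩ := hΛ
  have hcoer : ∀ l, IsCoerciveTensor a (Λ l) := fun l F hF => (hab F hF l).1
  obtain ⟨K, -, hK⟩ := exists_tensor_bound Λ
  have h : IsStiffnessField C a K := hD.isStiffnessField ha hsymm hcoer hK
  have hst : ∀ N : ℕ, 1 ≤ N → IsGridStiffness (Cs N) a K := fun N hN =>
    { symm := fun I => by
        obtain ⟨l, hl⟩ := (hCs N hN).exists_eq I
        exact hl ▸ hsymm l
      coercive := fun I => by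
        obtain ⟨l, hl⟩ := (hCs N hN).exists_eq I
        exact hl ▸ hcoer l
      bound := fun I => by
        obtain ⟨l, hl⟩ := (hCs N hN).exists_eq I
        exact hl ▸ hK l
      pos := ha }
  exact ⟨fun E _ => existsUnique_isCellSolution h E, existsUnique_isEffective h,
    fun N hN E hE => existsUnique_isWillotStrain hN (hst N hN) hCref hE,
    fun N hN => existsUnique_isWillotEffective hN (hst N hN) hCref,
    fun E _ N hN => existsUnique_isRescaledSolution hN (hst N hN) E,
    fun E _ u hu w hw => tendsto_toWeakSpace_rescaled hD hCs h hst hu hw,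
    fun Ceff hCeff CeffN hCeffN => tendsto_willotEffective hD hCs h hst hCref hCeff hCeffN⟩
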